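/- Let $d\ge 2$. Two sites of $\mathbb Z^d$ are neighbours if they are at Euclidean distance $1$, and for $\rho\in\mathbb R$ let $B_\rho=\{x\in\mathbb Z^d : |x|<\rho\}$, with $|\cdot|$ the Euclidean norm (so $B_\rho=\emptyset$ for $\rho\le 0$). Let $\omega_d$ be the volume of the unit ball in $\mathbb R^d$. For an integer $H\ge 2-2d$ and $n\in\{0,1,2,\dots\}$, consider the abelian sandpile on $\mathbb Z^d$ started from $n$ particles at the origin, where every site begins with a hole of depth $H$: the initial height at $x$ is $n\mathbf 1_{\{x=0\}}-H$ (so for $H<0$ every site already holds $-H$ grains), and a site of height at least $2d$ may topple, losing $2d$ grains and sending one grain to each of its $2d$ neighbours. Let $S_{n,H}$ be the set of visited sites: those that receive a grain in some finite legal sequence of topplings, together with the origin if $n\ge 1$. (If a finite legal sequence of topplings leads to a state in which no site can topple, these are exactly the sites visited along it.) Let $r\ge 0$ be defined by $n=\omega_d r^d$. (1) There is a constant $c_2$ depending only on $d$ such that for all integers $H\ge 2-2d$ and all $n\ge 0$, $$B_{c_1 r-c_2}\subset S_{n,H},\qquad c_1=(2d-1+H)^{-1/d}.$$ (2) If $H\ge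 1-d$ and $0<\epsilon<d+H$, then there is a constant $c_2'$ depending only on $d$, $H$ and $\epsilon$ such that for all $n\ge 0$, $$S_{n,H}\subset B_{c_1' r+c_2'},\qquad c_1'=(d-\epsilon+H)^{-1/d}.$$ In particular, for $H=0$ (the classical abelian sandpile started from $n$ grains at the origin of an empty lattice) these inclusions hold with $c_1=(2d-1)^{-1/d}$ and $c_1'=(d-\epsilon)^{-1/d}$ for $0<\epsilon<d$. -/

import Mathlib

namespace Sandpile

/-- The site set `ℤ^d`. -/
abbrev Site (d : ℕ) : Type := Fin d → ℤ

/-- A configuration: the number of grains at every site, a negative value `-k` being a hole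
that still absorbs `k` grains. -/
abbrev Config (d : ℕ) : Type := Site d → ℤ

/-- Nearest neighbours in `ℤ^d`. -/
def Adj {d : ℕ} (x y : Site d) : Prop := ∑ i, |x i - y i| = 1

instance {d : ℕ} (x y : Site d) : Decidable (Adj x y) :=
  inferInstanceAs (Decidable (_ = _))

/-- Toppling at `x`: the site `x` loses `2d` grains, each of its `2d` neighbours gains one. -/
def topple {d : ℕ} (η : Config d) (x : Site d) : Config d := fun y =>
  η y + (if Adj x y then 1 else 0) - (if y = x then 2 * (d : ℤ) else 0)

/-- Toppling successively at the sites of a list. -/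
def run {d : ℕ} : Config d → List (Site d) → Config d
  | η, [] => η
  | η, x :: l => run (topple η x) l

/-- A toppling sequence is legal if every site in it has at least `2d` grains when it topples. -/
def Legal {d : ℕ} : Config d → List (Site d) → Prop
  | _, [] => True
  | η, x :: l => 2 * (d : ℤ) ≤ η x ∧ Legal (topple η x) l

/-- A configuration is stable if no site can topple. -/
def Stable {d : ℕ} (η : Config d) : Prop := ∀ x, η x < 2 * (d : ℤ)

/-- The initial configuration: every site has a hole of depth `H` (for `H < 0`: it holds `-H`
grains), and `n` particles are put at the origin. -/
def initial (d n : ℕ) (H : ℤ) : Config d := fun x => (if x = 0 then (n : ℤ) else 0) - H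

/-- The sites to which the `n` particles started at the origin, or the grains sent out by the
topplings of the list `l`, come: the origin if `n > 0`, and all sites that receive a grain. -/
def visitedBy {d : ℕ} (n : ℕ) (l : List (Site d)) : Set (Site d) :=
  {x | (x = 0 ∧ 0 < n) ∨ ∃ y ∈ l, Adj y x}

/-- The set `S_{n,H}` of the sites that are visited in the course of a legal evolution of the
abelian sandpile. It does not matter in which order unstable sites topple: see
`visited_eq_visitedBy`. -/
def visited (d n : ℕ) (H : ℤ) : Set (Site d) :=
  {x | ∃ l : List (Site d), Legal (initial d n H) l ∧ x ∈ visitedBy n l}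

/-- The lattice ball `B_ρ = {x ∈ ℤ^d : |x| < ρ}`, with the Euclidean norm (empty for `ρ ≤ 0`). -/
def latticeBall (d : ℕ) (ρ : ℝ) : Set (Site d) :=
  {x | ‖WithLp.toLp 2 (fun i => (x i : ℝ))‖ < ρ}

/-- The volume `ω_d` of the unit ball in `ℝ^d`. -/
noncomputable def unitBallVolume (d : ℕ) : ℝ :=
  (MeasureTheory.volume (Metric.ball (0 : EuclideanSpace ℝ (Fin d)) 1)).toReal

theorem topple_comm {d : ℕ} (η : Config d) (x y : Site d) :
    topple (topple η x) y = topple (topple η y) x := by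
  funext z
  simp only [topple]
  ring

theorem le_topple {d : ℕ} (η : Config d) {x y : Site d} (h : y ≠ x) : η y ≤ topple η x y := by
  simp only [topple, if_neg h]
  split_ifs <;> omega

theorem run_legal_erase {d : ℕ} (x : Site d) (l : List (Site d)) :
    ∀ η : Config d, Legal η l → x ∈ l →
      Legal (topple η x) (l.erase x) ∧ run (topple η x) (l.erase x) = run η l := by
  induction l with
  | nil => intro η _ h; simp at h
  | cons y l ih =>
    intro η hl hx
    by_cases hyx : y = x
    · subst hyx
      simpa [run] using hl.2
    · have hx' : x ∈ l := by
        rcases List.mem_cons.1 hx with h | h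
        · exact absurd h.symm hyx
        · exact h
      have := ih (topple η y) hl.2 hx'
      rw [List.erase_cons_tail (by simpa using hyx)]
      simp only [run, Legal]
      rw [topple_comm η x y]
      exact ⟨⟨hl.1.trans (le_topple η hyx), this.1⟩, this.2⟩

theorem le_run_of_notMem {d : ℕ} (x : Site d) (l : List (Site d)) :
    ∀ η : Config d, x ∉ l → η x ≤ run η l x := by
  induction l with
  | nil => intro η _; exact le_rfl
  | cons y l ih =>
    intro η hx
    rw [List.mem_cons, not_or] at hx
    exact (le_topple η hx.1).trans (ih _ hx.2)

/-- Every site that topples in some legal sequence topples in every stabilizing one. -/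
theorem subset_of_stable {d : ℕ} (l' : List (Site d)) :
    ∀ (η : Config d) (l : List (Site d)), Legal η l → Stable (run η l) → Legal η l' →
      ∀ y ∈ l', y ∈ l := by
  induction l' with
  | nil => intro η l _ _ _ y hy; simp at hy
  | cons x t ih =>
    intro η l hl hs hl' y hy
    have hx : x ∈ l := by
      by_contra h
      have h1 := le_run_of_notMem x l η h
      have h2 := hs x
      have h3 := hl'.1
      omega
    rcases List.mem_cons.1 hy with rfl | hy
    · exact hx
    · obtain ⟨h1, h2⟩ := run_legal_erase x l η hl hx
      exact List.mem_of_mem_erase (ih _ _ h1 (h2 ▸ hs) hl'.2 y hy)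

/-- Whichever legal sequence is used to reach a final, stable state, the sites visited on the way
are those of `visited`. -/
theorem visited_eq_visitedBy {d n : ℕ} {H : ℤ} (l : List (Site d))
    (hl : Legal (initial d n H) l) (hs : Stable (run (initial d n H) l)) :
    visited d n H = visitedBy n l := by
  ext x
  constructor
  · rintro ⟨l', hl', h | ⟨y, hy, hyx⟩⟩
    · exact Or.inl h
    · exact Or.inr ⟨y, subset_of_stable l' _ l hl hs hl' y hy, hyx⟩
  · intro hx
    exact ⟨l, hl, hx⟩

end Sandpile

/-! ### Neighbours, the discrete Laplacian and the maximum principle. -/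

namespace Sandpile

open Finset

variable {d : ℕ}

/-! Let `u` be the odometer, the number of topplings at each site. Its discrete Laplacian is the
final height plus `H`, minus `n` at the origin (`lap_odometer`). Bounds on final heights therefore
become statements about where topplings occur, by discrete potential theory. Write `ω` for the
volume of the unit ball.

Inner bound. Final heights are at most `2d - 1`, so `Δu ≤ K - n δ₀` with `K = 2d - 1 + H`. Suppose
`z` does not topple and put `ρ = |z|`. Test against the Poisson kernel `P(x) = (ρ² - |x|²) / (ρ |x -
z|^d)` of the ball of radius `ρ` with pole `z`: `P(0) = ρ^(1-d)`, and the sum of `P` over lattice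
points of the ball away from the pole is at most `ωρ + O(1)`, by the mean value property and a
midpoint rule (`exists_sum_poissonKernel_le`). A correction `a |x - z|^(-d-1)` makes the kernel
subharmonic on the lattice away from the pole. Near the pole the test function is cut off, at
bounded cost, because `u = O(K)` close to a site that never topples (`odometer_le_of_notMem`).
Green's identity gives `n ρ^(1-d) ≤ K (ωρ + C)` (`exists_card_mul_le`); with `n = KωR^d` this forces
`ρ ≥ R - C/ω`. All errors are proportional to `K`, so the constant does not depend on `H`.

Outer bound. Of two adjacent toppled sites, the one whose last toppling comes first keeps a grain
from the other (`sum_adj_le_sum_run`). A large ball of toppled sites thus holds almost `d` grains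
per site on average, and the average of `u` over translates of a fixed large ball has, away from the
origin, Laplacian at least some `K'` with `d - ε + H < K' < d + H`. Comparison with the radial
function `outerBarrier` bounds this average near the sphere of radius `R`, and a second use of the
maximum principle bounds `u` everywhere outside (`exists_odometer_le`). Where `u` is bounded,
toppled sites must be fed through successive shells, so around a toppled site their number grows
exponentially with the distance; polynomial volume growth stops this after boundedly many steps
(`exists_radius_notMem`). -/

/-- The `i`-th unit vector of `ℤ^d`. -/
def unitVec (i : Fin d) : Site d := Pi.single i 1

/-- The discrete Laplacian on `ℤ^d`. -/
def lap (g : Site d → ℝ) (x : Site d) : ℝ :=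
  ∑ i, (g (x + unitVec i) + g (x - unitVec i) - 2 * g x)

/-- The sum of `g` over the neighbours of `x`. -/
def nbrSum (g : Site d → ℝ) (x : Site d) : ℝ :=
  ∑ i, (g (x + unitVec i) + g (x - unitVec i))

theorem lap_eq (g : Site d → ℝ) (x : Site d) : lap g x = nbrSum g x - 2 * d * g x := by
  simp only [lap, nbrSum, Finset.sum_sub_distrib, Finset.sum_const, Finset.card_univ,
    Fintype.card_fin, nsmul_eq_mul]
  ring

theorem Adj.symm {x y : Site d} (h : Adj x y) : Adj y x := by
  unfold Adj at *
  rw [← h]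
  exact Finset.sum_congr rfl fun i _ => abs_sub_comm _ _

theorem adj_comm {x y : Site d} : Adj x y ↔ Adj y x := ⟨Adj.symm, Adj.symm⟩

theorem Adj.ne {x y : Site d} (h : Adj x y) : x ≠ y := by
  rintro rfl
  simp [Adj] at h

theorem adj_add_unitVec (x : Site d) (i : Fin d) : Adj x (x + unitVec i) := by
  unfold Adj
  rw [Finset.sum_eq_single i]
  · simp [unitVec]
  · intro j _ hj
    simp [unitVec, hj]
  · simp

theorem adj_sub_unitVec (x : Site d) (i : Fin d) : Adj x (x - unitVec i) := by
  simpa using (adj_add_unitVec (x - unitVec i) i).symm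

theorem adj_iff {x y : Site d} :
    Adj x y ↔ ∃ i, y = x + unitVec i ∨ y = x - unitVec i := by
  constructor
  · intro h
    unfold Adj at h
    obtain ⟨i, hi⟩ : ∃ i, |x i - y i| ≠ 0 := by
      by_contra! hc
      simp [hc] at h
    have hsplit := Finset.add_sum_erase Finset.univ (fun i => |x i - y i|) (Finset.mem_univ i)
    rw [h] at hsplit
    have hnn : 0 ≤ ∑ j ∈ Finset.univ.erase i, |x j - y j| :=
      Finset.sum_nonneg fun j _ => abs_nonneg _
    have hi' : 1 ≤ |x i - y i| := Int.one_le_abs (by simpa using hi)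
    have h0 : ∑ j ∈ Finset.univ.erase i, |x j - y j| = 0 := by omega
    have h1 : |x i - y i| = 1 := by omega
    have hj : ∀ j, j ≠ i → x j = y j := by
      intro j hj
      have := (Finset.sum_eq_zero_iff_of_nonneg fun j _ => abs_nonneg (x j - y j)).1 h0 j
        (by simp [hj])
      have := abs_eq_zero.1 this
      omega
    refine ⟨i, ?_⟩
    rcases (abs_eq (by norm_num : (0 : ℤ) ≤ 1)).1 h1 with h2 | h2
    · right
      ext j
      by_cases hji : j = i
      · subst hji; simp [unitVec]; omega
      · simp [unitVec, hji, hj j hji]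
    · left
      ext j
      by_cases hji : j = i
      · subst hji; simp [unitVec]; omega
      · simp [unitVec, hji, hj j hji]
  · rintro ⟨i, rfl | rfl⟩
    · exact adj_add_unitVec x i
    · exact adj_sub_unitVec x i

/-- The neighbours of a site. -/
def nbrs (x : Site d) : Finset (Site d) :=
  Finset.univ.image (fun i => x + unitVec i) ∪ Finset.univ.image (fun i => x - unitVec i)

theorem mem_nbrs {x y : Site d} : y ∈ nbrs x ↔ Adj x y := by
  simp only [nbrs, Finset.mem_union, Finset.mem_image, Finset.mem_univ, true_and, adj_iff]
  constructor
  · rintro (⟨i, rfl⟩ | ⟨i, rfl⟩)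
    · exact ⟨i, Or.inl rfl⟩
    · exact ⟨i, Or.inr rfl⟩
  · rintro ⟨i, rfl | rfl⟩
    · exact Or.inl ⟨i, rfl⟩
    · exact Or.inr ⟨i, rfl⟩

theorem unitVec_injective : Function.Injective (unitVec : Fin d → Site d) := by
  intro i j h
  by_contra hij
  have := congrFun h i
  simp [unitVec, hij] at this

theorem sum_nbrs (g : Site d → ℝ) (x : Site d) : ∑ y ∈ nbrs x, g y = nbrSum g x := by
  unfold nbrs nbrSum
  rw [Finset.sum_union, Finset.sum_image, Finset.sum_image, ← Finset.sum_add_distrib]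
  · intro i _ j _ h
    exact unitVec_injective (by simpa using h)
  · intro i _ j _ h
    exact unitVec_injective (by simpa using h)
  · rw [Finset.disjoint_left]
    intro y hy hy'
    simp only [Finset.mem_image, Finset.mem_univ, true_and] at hy hy'
    obtain ⟨i, rfl⟩ := hy
    obtain ⟨j, hj⟩ := hy'
    have h1 := congrFun hj i
    by_cases hij : i = j
    · subst hij
      simp [unitVec] at h1
      omega
    · simp [unitVec, hij] at h1

theorem nbrSum_eq_sum_ite (g : Site d → ℝ) (a : Site d) (F : Finset (Site d))
    (hF : ∀ y, Adj a y → y ∉ F → g y = 0) :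
    ∑ y ∈ F, (if Adj a y then g y else 0) = nbrSum g a := by
  rw [← sum_nbrs, ← Finset.sum_filter]
  apply Finset.sum_subset
  · intro y hy
    exact mem_nbrs.2 (Finset.mem_filter.1 hy).2
  · intro y hy hy'
    refine hF y (mem_nbrs.1 hy) fun h => hy' (Finset.mem_filter.2 ⟨h, mem_nbrs.1 hy⟩)

theorem nbrSum_const (c : ℝ) (x : Site d) : nbrSum (fun _ => c) x = 2 * d * c := by
  simp only [nbrSum, Finset.sum_const, Finset.card_univ, Fintype.card_fin, nsmul_eq_mul]
  ring

theorem nbrSum_mono {f g : Site d → ℝ} {x : Site d} (h : ∀ y, Adj x y → f y ≤ g y) :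
    nbrSum f x ≤ nbrSum g x := by
  rw [← sum_nbrs, ← sum_nbrs]
  exact Finset.sum_le_sum fun y hy => h y (mem_nbrs.1 hy)

theorem le_nbrSum {g : Site d → ℝ} {x y : Site d} (h : ∀ y, 0 ≤ g y) (hxy : Adj x y) :
    g y ≤ nbrSum g x := by
  rw [← sum_nbrs]
  exact Finset.single_le_sum (fun y _ => h y) (mem_nbrs.2 hxy)

theorem lap_const (c : ℝ) (x : Site d) : lap (fun _ => c) x = 0 := by
  rw [lap_eq, nbrSum_const]; ring

theorem lap_add (f g : Site d → ℝ) (x : Site d) :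
    lap (fun y => f y + g y) x = lap f x + lap g x := by
  simp only [lap, ← Finset.sum_add_distrib]
  exact Finset.sum_congr rfl fun i _ => by ring

theorem lap_sub (f g : Site d → ℝ) (x : Site d) :
    lap (fun y => f y - g y) x = lap f x - lap g x := by
  simp only [lap, ← Finset.sum_sub_distrib]
  exact Finset.sum_congr rfl fun i _ => by ring

theorem lap_const_mul (c : ℝ) (f : Site d → ℝ) (x : Site d) :
    lap (fun y => c * f y) x = c * lap f x := by
  simp only [lap, Finset.mul_sum]
  exact Finset.sum_congr rfl fun i _ => by ring

theorem lap_sum {ι : Type*} (s : Finset ι) (f : ι → Site d → ℝ) (x : Site d) :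
    lap (fun y => ∑ b ∈ s, f b y) x = ∑ b ∈ s, lap (f b) x := by
  simp only [lap]
  rw [Finset.sum_comm]
  refine Finset.sum_congr rfl fun i _ => ?_
  rw [Finset.sum_sub_distrib, Finset.sum_add_distrib, Finset.mul_sum]

theorem lap_comp_add (f : Site d → ℝ) (b x : Site d) :
    lap (fun y => f (y + b)) x = lap f (x + b) := by
  simp only [lap]
  refine Finset.sum_congr rfl fun i _ => ?_
  rw [add_right_comm x (unitVec i) b, sub_add_eq_add_sub]

/-- If two functions agree at `x` and `f ≤ g` at its neighbours, their Laplacians compare. -/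
theorem lap_mono {f g : Site d → ℝ} {x : Site d} (h : ∀ y, Adj x y → f y ≤ g y)
    (hx : f x = g x) : lap f x ≤ lap g x := by
  rw [lap_eq, lap_eq, hx]
  linarith [nbrSum_mono h]

/-- Maximum principle. -/
theorem le_of_lap_nonneg [NeZero d] {g : Site d → ℝ} {D : Finset (Site d)} {C : ℝ}
    (hD : ∀ x ∈ D, 0 ≤ lap g x) (hC : ∀ x, x ∉ D → g x ≤ C) (x : Site d) : g x ≤ C := by
  by_contra! hx
  have hxD : x ∈ D := by
    by_contra h
    exact absurd (hC x h) (not_le.2 hx)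
  obtain ⟨m, hmD, hm⟩ := D.exists_max_image g ⟨x, hxD⟩
  have hCm : C < g m := hx.trans_le (hm x hxD)
  -- Among the maximisers take one with largest coordinate `0`: at a maximum with nonnegative
  -- Laplacian all neighbours are maximisers too, so `w + unitVec 0` contradicts this choice.
  obtain ⟨w, hw, hwmax⟩ := (D.filter fun y => g y = g m).exists_max_image (fun y => y 0)
    ⟨m, by simp [hmD]⟩
  rw [Finset.mem_filter] at hw
  have hall : ∀ y, g y ≤ g w := by
    intro y
    rw [hw.2]
    by_cases hy : y ∈ D
    · exact hm y hy
    · exact (hC y hy).trans hCm.le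
  have hlap := hD w hw.1
  unfold lap at hlap
  have hle : ∀ i ∈ (Finset.univ : Finset (Fin d)),
      g (w + unitVec i) + g (w - unitVec i) - 2 * g w ≤ 0 := by
    intro i _
    linarith [hall (w + unitVec i), hall (w - unitVec i)]
  have hz := (Finset.sum_eq_zero_iff_of_nonpos hle).1
    (le_antisymm (Finset.sum_nonpos hle) hlap) 0 (Finset.mem_univ _)
  have heq : g (w + unitVec 0) = g w := by
    linarith [hall (w + unitVec 0), hall (w - unitVec 0)]
  have hmem : w + unitVec 0 ∈ D := by
    by_contra h
    have := hC _ h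
    rw [heq, hw.2] at this
    linarith
  have := hwmax (w + unitVec 0) (by simp [hmem, heq, hw.2])
  simp [unitVec] at this

/-! ### Toppling sequences -/

theorem legal_append {η : Config d} {l l' : List (Site d)} :
    Legal η (l ++ l') ↔ Legal η l ∧ Legal (run η l) l' := by
  induction l generalizing η with
  | nil => simp [Legal, run]
  | cons a l ih => simp [Legal, run, ih, and_assoc]

/-- Discrete Green identity along a toppling sequence. -/
theorem sum_mul_run (f : Site d → ℝ) (F : Finset (Site d)) (l : List (Site d)) :
    ∀ η : Config d, (∀ a ∈ l, ∀ y, y = a ∨ Adj a y → y ∉ F → f y = 0) →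
      ∑ x ∈ F, f x * (run η l x : ℝ) = ∑ x ∈ F, f x * (η x : ℝ) + (l.map (lap f)).sum := by
  induction l with
  | nil => intro η _; simp [run]
  | cons a l ih =>
    intro η h
    rw [run, ih _ fun b hb => h b (List.mem_cons_of_mem _ hb), List.map_cons, List.sum_cons,
      ← add_assoc]
    congr 1
    have ha := h a List.mem_cons_self
    rw [lap_eq, ← nbrSum_eq_sum_ite f a F fun y hy => ha y (Or.inr hy)]
    have h2 : 2 * (d : ℝ) * f a = ∑ x ∈ F, if x = a then 2 * (d : ℝ) * f x else 0 := by
      rw [Finset.sum_ite_eq']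
      split_ifs with haF
      · rfl
      · rw [ha a (Or.inl rfl) haF, mul_zero]
    rw [h2, ← Finset.sum_sub_distrib, ← Finset.sum_add_distrib]
    refine Finset.sum_congr rfl fun x _ => ?_
    simp only [topple]
    push_cast
    split_ifs <;> ring

/-- One toppling at `a` adds the Laplacian of the indicator of `a`, so only the number of topplings
at each site matters, not their order. -/
theorem run_eq (η : Config d) (l : List (Site d)) (x : Site d) :
    (run η l x : ℝ) = η x + lap (fun y => (l.count y : ℝ)) x := by
  induction l generalizing η with
  | nil => simp [run, lap]
  | cons a l ih =>
    rw [run, ih]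
    have hsum : lap (fun y => ((a :: l).count y : ℝ)) x =
        lap (fun y => (l.count y : ℝ)) x + lap (fun y => if y = a then (1 : ℝ) else 0) x := by
      rw [← lap_add]
      congr 1
      funext y
      rw [List.count_cons]
      by_cases h : y = a
      · simp [h]
      · simp [h, Ne.symm h]
    rw [hsum, lap_eq (fun y => if y = a then (1 : ℝ) else 0),
      ← nbrSum_eq_sum_ite _ x {a} (by intro y _ hy; simpa using hy)]
    simp only [topple, Finset.sum_singleton, adj_comm (x := a)]
    push_cast
    split_ifs <;> simp <;> ring

/-- A site loses grains only when it has at least `2d` of them, so holes never get deeper. This is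
the lower bound on heights that limits the length of legal sequences. -/
theorem min_le_run (l : List (Site d)) :
    ∀ η : Config d, Legal η l → ∀ x, min (η x) 0 ≤ run η l x := by
  induction l with
  | nil => intro η _ x; exact min_le_left _ _
  | cons a l ih =>
    intro η h x
    refine le_trans ?_ (ih _ h.2 x)
    have h1 := h.1
    by_cases hxa : x = a
    · subst hxa
      have : 0 ≤ topple η x x := by
        simp only [topple, if_true]
        split_ifs <;> omega
      omega
    · have := le_topple η (x := a) (y := x) hxa
      omega

/-- Every site of `F` that topples last loses no grain afterwards, so that it keeps the grains it
gets from the other sites of `F`. -/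
theorem sum_adj_le_sum_run (l : List (Site d)) :
    ∀ (η : Config d) (A : Finset (Site d)), Legal η l → (∀ a ∈ A, a ∈ l) →
      ∑ a ∈ A, ∑ b ∈ A, (if Adj a b then (1 : ℤ) else 0) ≤ 2 * ∑ a ∈ A, run η l a := by
  induction l with
  | nil =>
    intro η A _ hA
    have : A = ∅ := Finset.eq_empty_of_forall_notMem fun a ha => by simpa using hA a ha
    simp [this]
  | cons x l ih =>
    intro η A hl hA
    -- This is the case where the toppling at the head of the list is the last one of `x`: peel `x`
    -- off `A`. Otherwise every site of `A` topples again later and the induction hypothesis applies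
    -- unchanged.
    by_cases hx : x ∈ A ∧ x ∉ l
    · obtain ⟨hxA, hxl⟩ := hx
      have hsub : ∀ a ∈ A.erase x, a ∈ l := by
        intro a ha
        rw [Finset.mem_erase] at ha
        exact (List.mem_cons.1 (hA a ha.2)).resolve_left ha.1
      have h1 := ih (topple η x) (A.erase x) hl.2 hsub
      -- Once `x` has finished toppling, it gains at least one grain from each neighbour that
      -- topples afterwards.
      have hlast : ∀ (l : List (Site d)) (ξ : Config d) (B : Finset (Site d)), x ∉ l →
          (∀ b ∈ B, b ∈ l) →
          ξ x + ∑ b ∈ B, (if Adj x b then (1 : ℤ) else 0) ≤ run ξ l x := by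
        intro l
        induction l with
        | nil =>
          intro ξ B _ hB
          have : B = ∅ := Finset.eq_empty_of_forall_notMem fun a ha => by simpa using hB a ha
          simp [this, run]
        | cons y l ih' =>
          intro ξ B hxl hB
          rw [List.mem_cons, not_or] at hxl
          have h := ih' (topple ξ y) (B.erase y) hxl.2 (by
            intro a ha
            rw [Finset.mem_erase] at ha
            exact (List.mem_cons.1 (hB a ha.2)).resolve_left ha.1)
          rw [run]
          refine le_trans ?_ h
          have htop : topple ξ y x = ξ x + if Adj x y then 1 else 0 := by
            simp [topple, hxl.1, adj_comm (x := y)]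
          rw [htop]
          by_cases hyB : y ∈ B
          · rw [← Finset.add_sum_erase B _ hyB]
            omega
          · rw [Finset.erase_eq_of_notMem hyB]
            split_ifs <;> omega
      have h2 := hlast l (topple η x) (A.erase x) hxl hsub
      have h3 : 0 ≤ topple η x x := by
        have := hl.1
        simp only [topple, if_true]
        split_ifs <;> omega
      -- The double sum counts each edge twice; removing `x` removes both orientations of its edges,
      -- whence the factor `2` in the statement.
      have h4 : ∑ a ∈ A, ∑ b ∈ A, (if Adj a b then (1 : ℤ) else 0) =
          ∑ a ∈ A.erase x, ∑ b ∈ A.erase x, (if Adj a b then (1 : ℤ) else 0) +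
            2 * ∑ b ∈ A.erase x, (if Adj x b then (1 : ℤ) else 0) := by
        have hin : ∀ a, ∑ b ∈ A, (if Adj a b then (1 : ℤ) else 0) =
            (if Adj a x then (1 : ℤ) else 0) +
              ∑ b ∈ A.erase x, (if Adj a b then (1 : ℤ) else 0) := fun a =>
          (Finset.add_sum_erase A _ hxA).symm
        simp only [hin]
        rw [← Finset.add_sum_erase A _ hxA, Finset.sum_add_distrib]
        simp only [adj_comm (y := x)]
        have : ¬ Adj x x := fun h => h.ne rfl
        simp only [this, if_false]
        ring
      rw [h4, run, ← Finset.add_sum_erase A _ hxA]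
      linarith
    · have : ∀ a ∈ A, a ∈ l := by
        intro a ha
        rcases List.mem_cons.1 (hA a ha) with rfl | h
        · by_contra hc
          exact hx ⟨ha, hc⟩
        · exact h
      exact ih _ _ hl.2 this

/-- The toppling sequences inside a finite set have bounded length. -/
theorem exists_length_le (hd : 0 < d) (η : Config d) (V : Finset (Site d)) :
    ∃ N : ℕ, ∀ l : List (Site d), Legal η l → (∀ a ∈ l, a ∈ V) → l.length ≤ N := by
  set F := V ∪ V.biUnion nbrs with hF
  obtain ⟨R, hR⟩ := (F.image fun x : Site d => ∑ i, (x i : ℝ) ^ 2).exists_le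
  -- A potential that is nonnegative on `F` and has Laplacian `-2d`: every toppling lowers `∑ f η`
  -- by `2d`, while `min_le_run` bounds that sum from below.
  set f : Site d → ℝ := fun x => R - ∑ i, (x i : ℝ) ^ 2 with hf
  have hfF : ∀ x ∈ F, 0 ≤ f x := fun x hx =>
    sub_nonneg.2 (hR _ (Finset.mem_image_of_mem _ hx))
  have hlap : ∀ x, lap f x = -(2 * d) := by
    intro x
    have : ∀ i, f (x + unitVec i) + f (x - unitVec i) - 2 * f x = -2 := by
      intro i
      have h1 : ∑ j, ((x + unitVec i) j : ℝ) ^ 2 + ∑ j, ((x - unitVec i) j : ℝ) ^ 2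
          - 2 * ∑ j, (x j : ℝ) ^ 2 = 2 := by
        rw [Finset.mul_sum, ← Finset.sum_add_distrib, ← Finset.sum_sub_distrib,
          Finset.sum_eq_single i]
        · simp [unitVec]; ring
        · intro j _ hj
          simp [unitVec, hj]; ring
        · simp
      simp only [hf]
      linarith
    simp only [lap, this, Finset.sum_const, Finset.card_univ, Fintype.card_fin, nsmul_eq_mul]
    ring
  set M : ℝ := ∑ x ∈ F, f x * (η x : ℝ) - ∑ x ∈ F, f x * (min (η x) 0 : ℤ) with hM
  refine ⟨⌈M⌉₊, fun l hl hV => ?_⟩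
  have hg := sum_mul_run f F l η (by
    intro a ha y hy hyF
    exfalso
    apply hyF
    rcases hy with rfl | hy
    · exact Finset.mem_union_left _ (hV _ ha)
    · exact Finset.mem_union_right _ (Finset.mem_biUnion.2 ⟨a, hV _ ha, mem_nbrs.2 hy⟩))
  have hmap : (l.map (lap f)).sum = -(2 * d) * l.length := by
    rw [List.map_congr_left (g := fun _ => -(2 * (d : ℝ))) fun a _ => hlap a]
    simp [mul_comm]
  rw [hmap] at hg
  have hge : ∑ x ∈ F, f x * (min (η x) 0 : ℤ) ≤ ∑ x ∈ F, f x * (run η l x : ℝ) := by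
    refine Finset.sum_le_sum fun x hx => mul_le_mul_of_nonneg_left ?_ (hfF x hx)
    exact_mod_cast min_le_run l η hl x
  have hd' : (1 : ℝ) ≤ d := by exact_mod_cast hd
  have hlen : (l.length : ℝ) ≤ M := by
    have : (0 : ℝ) ≤ l.length := Nat.cast_nonneg _
    nlinarith
  exact_mod_cast hlen.trans (Nat.le_ceil M)

/-- Inside a finite set every configuration can be stabilized. -/
theorem exists_stable_on (hd : 0 < d) (η : Config d) (V : Finset (Site d)) :
    ∃ l : List (Site d), Legal η l ∧ (∀ a ∈ l, a ∈ V) ∧ ∀ x ∈ V, run η l x < 2 * (d : ℤ) := by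
  obtain ⟨N, hN⟩ := exists_length_le hd η V
  by_contra! hc
  have : ∀ k : ℕ, ∃ l : List (Site d), Legal η l ∧ (∀ a ∈ l, a ∈ V) ∧ l.length = k := by
    intro k
    induction k with
    | zero => exact ⟨[], trivial, by simp, rfl⟩
    | succ k ih =>
      obtain ⟨l, hl, hV, hk⟩ := ih
      obtain ⟨x, hx, hxu⟩ := hc l hl hV
      refine ⟨l ++ [x], legal_append.2 ⟨hl, hxu, trivial⟩, ?_, by simp [hk]⟩
      intro a ha
      rcases List.mem_append.1 ha with h | h
      · exact hV a h
      · rw [List.mem_singleton.1 h]; exact hx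
  obtain ⟨l, hl, hV, hk⟩ := this (N + 1)
  have := hN l hl hV
  omega

end Sandpile

/-! ### The odometer, counts of toppled sites, and stabilization. -/

namespace Sandpile

open Finset

variable {d : ℕ}

/-- The `ℓ¹` norm on `ℤ^d`. -/
def l1 (x : Site d) : ℕ := ∑ i, (x i).natAbs

theorem l1_sub_of_adj {x y : Site d} (h : Adj x y) : l1 (x - y) = 1 := by
  have : ((l1 (x - y) : ℕ) : ℤ) = 1 := by
    rw [← (show ∑ i, |x i - y i| = 1 from h)]
    simp [l1]
  exact_mod_cast this

theorem l1_add_le (x y : Site d) : l1 (x + y) ≤ l1 x + l1 y := by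
  simp only [l1, ← Finset.sum_add_distrib]
  exact Finset.sum_le_sum fun i _ => Int.natAbs_add_le _ _

theorem l1_neg (x : Site d) : l1 (-x) = l1 x := by simp [l1]

theorem l1_le_of_adj {x y : Site d} (z : Site d) (h : Adj x y) :
    l1 (y - z) ≤ l1 (x - z) + 1 := by
  have h1 := l1_add_le (x - z) (y - x)
  rw [l1_sub_of_adj h.symm] at h1
  simpa [sub_add_sub_comm] using h1

theorem natAbs_le_l1 (x : Site d) (i : Fin d) : (x i).natAbs ≤ l1 x :=
  Finset.single_le_sum (f := fun i => (x i).natAbs) (fun _ _ => Nat.zero_le _) (Finset.mem_univ i)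

theorem l1_eq_zero {x : Site d} (h : l1 x = 0) : x = 0 := by
  ext i
  have := natAbs_le_l1 x i
  simp only [Pi.zero_apply]
  omega

theorem l1_add_of_ne {w v : Site d} {i : Fin d} (h : ∀ j, j ≠ i → w j = v j)
    (hi : (w i).natAbs = (v i).natAbs + 1) : l1 w = l1 v + 1 := by
  unfold l1
  rw [← Finset.add_sum_erase _ _ (Finset.mem_univ i),
    ← Finset.add_sum_erase _ (fun i => (v i).natAbs) (Finset.mem_univ i), hi,
    Finset.sum_congr rfl fun j hj => by rw [h j (Finset.ne_of_mem_erase hj)]]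
  ring

theorem exists_adj_l1 {x z : Site d} {j : ℕ} (h : l1 (x - z) = j + 1) :
    ∃ y, Adj y x ∧ l1 (y - z) = j := by
  obtain ⟨i, hi⟩ : ∃ i, (x - z) i ≠ 0 := by
    by_contra! hc
    have : x - z = 0 := funext hc
    rw [this] at h
    simp [l1] at h
  rcases lt_or_gt_of_ne hi with hneg | hpos
  · refine ⟨x + unitVec i, (adj_add_unitVec x i).symm, ?_⟩
    have := l1_add_of_ne (w := x - z) (v := x + unitVec i - z) (i := i)
      (fun j hj => by simp [unitVec, hj])
      (by simp only [Pi.sub_apply, Pi.add_apply, unitVec, Pi.single_eq_same] at *; omega)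
    omega
  · refine ⟨x - unitVec i, (adj_sub_unitVec x i).symm, ?_⟩
    have := l1_add_of_ne (w := x - z) (v := x - unitVec i - z) (i := i)
      (fun j hj => by simp [unitVec, hj])
      (by simp only [Pi.sub_apply, unitVec, Pi.single_eq_same] at *; omega)
    omega

/-- The number of topplings at `x`. -/
def odometer (l : List (Site d)) (x : Site d) : ℝ := l.count x

theorem odometer_nonneg (l : List (Site d)) (x : Site d) : 0 ≤ odometer l x := Nat.cast_nonneg _

theorem odometer_of_notMem {l : List (Site d)} {x : Site d} (h : x ∉ l) : odometer l x = 0 := by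
  simp [odometer, List.count_eq_zero_of_not_mem h]

theorem one_le_odometer {l : List (Site d)} {x : Site d} (h : x ∈ l) : 1 ≤ odometer l x := by
  have := List.count_pos_iff.2 h
  simp only [odometer]
  exact_mod_cast this

theorem lap_odometer (n : ℕ) (H : ℤ) (l : List (Site d)) (x : Site d) :
    lap (odometer l) x = run (initial d n H) l x + H - if x = 0 then (n : ℝ) else 0 := by
  have h := run_eq (initial d n H) l x
  have h2 : ((initial d n H x : ℤ) : ℝ) = (if x = 0 then (n : ℝ) else 0) - H := by
    simp only [initial]
    split_ifs <;> push_cast <;> ring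
  rw [h2] at h
  change _ = _ + lap (odometer l) x at h
  linarith

theorem lap_odometer_le {n : ℕ} {H : ℤ} {l : List (Site d)} {x : Site d}
    (h : run (initial d n H) l x < 2 * (d : ℤ)) :
    lap (odometer l) x ≤ 2 * d - 1 + H - if x = 0 then (n : ℝ) else 0 := by
  rw [lap_odometer n H]
  have : (run (initial d n H) l x : ℝ) ≤ 2 * d - 1 := by
    have : run (initial d n H) l x ≤ 2 * (d : ℤ) - 1 := by omega
    exact_mod_cast this
  linarith

theorem nbrSum_odometer_le {n : ℕ} {H : ℤ} {l : List (Site d)} {x : Site d}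
    (h : run (initial d n H) l x < 2 * (d : ℤ)) :
    nbrSum (odometer l) x ≤ 2 * d - 1 + H + 2 * d * odometer l x := by
  have h1 := lap_odometer_le h
  rw [lap_eq] at h1
  have : (0 : ℝ) ≤ if x = 0 then (n : ℝ) else 0 := by split_ifs <;> positivity
  linarith

/-- Near a site that does not topple there are only few topplings. -/
theorem odometer_le_of_notMem (hd : 1 ≤ d) {n : ℕ} {H : ℤ} {l : List (Site d)} {z : Site d}
    (hH : 0 ≤ 2 * (d : ℝ) - 1 + H) (hz : z ∉ l) {j : ℕ}
    (hst : ∀ x, l1 (x - z) ≤ j → run (initial d n H) l x < 2 * (d : ℤ)) :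
    ∀ x, l1 (x - z) ≤ j → odometer l x ≤ (2 * d - 1 + H) * ((2 * d + 1) ^ j - 1) := by
  have hd' : (1 : ℝ) ≤ d := by exact_mod_cast hd
  set K : ℝ := 2 * d - 1 + H with hK
  -- Stability at `y` gives `u(x) ≤ K + 2d u(y)` for each neighbour `x` of `y`; iterate along a path
  -- from `z`. The bound is linear in `K`, which later keeps the inner constant free of `H`.
  have main : ∀ k ≤ j, ∀ x, l1 (x - z) = k → odometer l x ≤ K * ((2 * d + 1) ^ k - 1) := by
    intro k
    induction k with
    | zero =>
      intro _ x hx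
      have : x = z := sub_eq_zero.1 (l1_eq_zero hx)
      subst this
      simp [odometer_of_notMem hz]
    | succ k ih =>
      intro hk x hx
      obtain ⟨y, hyx, hy⟩ := exists_adj_l1 hx
      have h1 := ih (by omega) y hy
      have h2 := nbrSum_odometer_le (hst y (by omega))
      have h3 := le_nbrSum (odometer_nonneg l) hyx
      have hX : (1 : ℝ) ≤ (2 * d + 1) ^ k := one_le_pow₀ (by linarith)
      rw [pow_succ]
      have h4 := mul_le_mul_of_nonneg_left h1 (by positivity : (0 : ℝ) ≤ 2 * d)
      have h5 : 0 ≤ K * ((2 * d + 1 : ℝ) ^ k - 1) := mul_nonneg hH (by linarith)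
      have h6 : 0 ≤ K * (2 * d - 1) := mul_nonneg hH (by linarith)
      nlinarith
  intro x hx
  refine (main _ hx x rfl).trans (mul_le_mul_of_nonneg_left ?_ hH)
  have : (2 * d + 1 : ℝ) ^ l1 (x - z) ≤ (2 * d + 1) ^ j :=
    pow_le_pow_right₀ (by linarith) hx
  linarith

/-- The number of neighbours of `x` in `A`. -/
def degreeIn (A : Finset (Site d)) (x : Site d) : ℝ :=
  ∑ b ∈ A, if Adj x b then (1 : ℝ) else 0

theorem degreeIn_eq (A : Finset (Site d)) (x : Site d) :
    degreeIn A x = nbrSum (fun y => if y ∈ A then (1 : ℝ) else 0) x := by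
  rw [← nbrSum_eq_sum_ite _ _ A (fun y _ hy => by simp [hy])]
  unfold degreeIn
  refine Finset.sum_congr rfl fun b hb => ?_
  simp [hb]

theorem degreeIn_le (A : Finset (Site d)) (x : Site d) : degreeIn A x ≤ 2 * d := by
  rw [degreeIn_eq, ← mul_one (2 * (d : ℝ)), ← nbrSum_const]
  refine nbrSum_mono fun y _ => ?_
  split_ifs <;> norm_num

theorem degreeIn_nonneg (A : Finset (Site d)) (x : Site d) : 0 ≤ degreeIn A x :=
  Finset.sum_nonneg fun b _ => by split_ifs <;> norm_num

theorem degreeIn_eq_of_nbrs {A : Finset (Site d)} {x : Site d} (h : ∀ y, Adj x y → y ∈ A) :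
    degreeIn A x = 2 * d := by
  refine le_antisymm (degreeIn_le A x) ?_
  rw [degreeIn_eq, ← mul_one (2 * (d : ℝ)), ← nbrSum_const]
  exact nbrSum_mono fun y hy => by simp [h y hy]

theorem degreeIn_sum_le {η : Config d} {l : List (Site d)} {A : Finset (Site d)}
    (hl : Legal η l) (hA : ∀ a ∈ A, a ∈ l) :
    ∑ a ∈ A, degreeIn A a ≤ 2 * ∑ a ∈ A, (run η l a : ℝ) := by
  have := sum_adj_le_sum_run l η A hl hA
  unfold degreeIn
  exact_mod_cast this

theorem sum_initial (n : ℕ) (H : ℤ) (A : Finset (Site d)) :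
    ∑ a ∈ A, (initial d n H a : ℝ) = (if (0 : Site d) ∈ A then (n : ℝ) else 0) - H * #A := by
  have h2 : ∀ x : Site d, ((initial d n H x : ℤ) : ℝ) = (if x = 0 then (n : ℝ) else 0) - H := by
    intro x
    simp only [initial]
    split_ifs <;> push_cast <;> ring
  simp only [h2, Finset.sum_sub_distrib, Finset.sum_ite_eq', Finset.sum_const, nsmul_eq_mul]
  ring

/-- Lower bound for the total Laplacian of the odometer over a set of sites that have toppled. -/
theorem sum_lap_odometer_ge {n : ℕ} {H : ℤ} {l : List (Site d)} {A : Finset (Site d)}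
    (hl : Legal (initial d n H) l) (hA : ∀ a ∈ A, a ∈ l) :
    (∑ a ∈ A, degreeIn A a) / 2 + H * #A - (if (0 : Site d) ∈ A then (n : ℝ) else 0) ≤
      ∑ a ∈ A, lap (odometer l) a := by
  have h1 := degreeIn_sum_le hl hA
  simp only [lap_odometer n H, Finset.sum_sub_distrib, Finset.sum_add_distrib,
    Finset.sum_ite_eq', Finset.sum_const, nsmul_eq_mul]
  linarith

/-- The grains that the toppled sites in `A` keep came from the origin or through the boundary. -/
theorem card_mul_le {n : ℕ} {H : ℤ} {l : List (Site d)} {A : Finset (Site d)}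
    (hl : Legal (initial d n H) l) (hA : ∀ a ∈ A, a ∈ l) :
    ((d : ℝ) + H) * #A ≤ (if (0 : Site d) ∈ A then (n : ℝ) else 0) +
      ∑ a ∈ l.toFinset \ A, odometer l a * degreeIn A a := by
  have h1 := degreeIn_sum_le hl hA
  -- Green's identity for the indicator of `A` is the balance of grains in `A`: initial content,
  -- inflow from topplings outside, outflow from topplings inside.
  have h2 := sum_mul_run (fun y => if y ∈ A then (1 : ℝ) else 0) A l (initial d n H)
    (fun a _ y _ hy => by simp [hy])
  have h3 : ∀ η : Config d,
      ∑ x ∈ A, (if x ∈ A then (1 : ℝ) else 0) * (η x : ℝ) = ∑ x ∈ A, (η x : ℝ) := by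
    intro η
    exact Finset.sum_congr rfl fun x hx => by simp [hx]
  rw [h3, h3, sum_initial, Finset.sum_list_map_count] at h2
  have hAl : A ⊆ l.toFinset := fun a ha => List.mem_toFinset.2 (hA a ha)
  rw [← Finset.sum_sdiff hAl] at h2
  have h4 : ∑ a ∈ l.toFinset \ A, l.count a • lap (fun y => if y ∈ A then (1 : ℝ) else 0) a =
      ∑ a ∈ l.toFinset \ A, odometer l a * degreeIn A a := by
    refine Finset.sum_congr rfl fun a ha => ?_
    rw [lap_eq, ← degreeIn_eq, if_neg (Finset.mem_sdiff.1 ha).2, nsmul_eq_mul, odometer]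
    ring
  -- Each toppling at `a` sends `2d - degreeIn A a` grains out of `A`. Counting a single toppling
  -- per site suffices: together with the edge bound it leaves `2d - d = d` grains for each site of
  -- `A`.
  have h5 : ∑ a ∈ A, l.count a • lap (fun y => if y ∈ A then (1 : ℝ) else 0) a ≤
      ∑ a ∈ A, (degreeIn A a - 2 * d) := by
    refine Finset.sum_le_sum fun a ha => ?_
    rw [lap_eq, ← degreeIn_eq, if_pos ha, nsmul_eq_mul, mul_one]
    have h6 := one_le_odometer (hA a ha)
    have h7 := degreeIn_le A a
    unfold odometer at h6
    nlinarith
  rw [h4] at h2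
  have h8 : ∑ a ∈ A, degreeIn A a ≤ 2 * d * #A := by
    refine (Finset.sum_le_sum fun a _ => degreeIn_le A a).trans ?_
    simp [mul_comm]
  rw [Finset.sum_sub_distrib, Finset.sum_const, nsmul_eq_mul] at h5
  linarith

/-- With `A` the set of all toppled sites nothing flows in, and `d + H` is an integer at least `1`.
-/
theorem card_toFinset_le {n : ℕ} {H : ℤ} {l : List (Site d)} (hH : 1 - (d : ℤ) ≤ H)
    (hl : Legal (initial d n H) l) : #l.toFinset ≤ n := by
  have h := card_mul_le hl (A := l.toFinset) fun a ha => List.mem_toFinset.1 ha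
  rw [Finset.sdiff_self, Finset.sum_empty, add_zero] at h
  have h1 : (1 : ℝ) ≤ d + H := by
    have : (1 : ℤ) ≤ d + H := by omega
    exact_mod_cast this
  have h2 : (#l.toFinset : ℝ) ≤ n := by
    refine le_trans ?_ (h.trans ?_)
    · nlinarith [Nat.cast_nonneg (α := ℝ) #l.toFinset]
    · split_ifs <;> simp
  exact_mod_cast h2

/-- Away from the origin a site starts with fewer than `2d` grains, so some neighbour must topple
before it does. Hence the toppled set skips no `ℓ¹` level; with `card_toFinset_le` this confines it
to a bounded region. -/
theorem exists_l1_eq {n : ℕ} {H : ℤ} (hH : 1 - 2 * (d : ℤ) ≤ H) (l : List (Site d)) :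
    Legal (initial d n H) l → ∀ a ∈ l, ∀ j ≤ l1 a, ∃ b ∈ l, l1 b = j := by
  induction l using List.reverseRecOn with
  | nil => intro _ a ha; simp at ha
  | append_singleton l x ih =>
    intro hl a ha j hj
    rw [legal_append] at hl
    have ih := ih hl.1
    rcases List.mem_append.1 ha with h | h
    · obtain ⟨b, hb, hbj⟩ := ih a h j hj
      exact ⟨b, List.mem_append_left _ hb, hbj⟩
    · rw [List.mem_singleton] at h
      subst h
      by_cases hja : j = l1 a
      · exact ⟨a, ha, hja.symm⟩
      · have ha0 : a ≠ 0 := by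
          rintro rfl
          simp [l1] at hj hja
          omega
        have hrun : (2 * d : ℝ) ≤ run (initial d n H) l a := by exact_mod_cast hl.2.1
        have h1 := lap_odometer n H l a
        rw [if_neg ha0, lap_eq] at h1
        have hH' : (1 : ℝ) ≤ 2 * d + H := by
          have : (1 : ℤ) ≤ 2 * d + H := by omega
          exact_mod_cast this
        have hpos : 0 < nbrSum (odometer l) a := by
          have := mul_nonneg (by positivity : (0 : ℝ) ≤ 2 * d) (odometer_nonneg l a)
          linarith
        rw [← sum_nbrs] at hpos
        obtain ⟨b, hb, hb0⟩ : ∃ b ∈ nbrs a, odometer l b ≠ 0 := by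
          by_contra! hc
          rw [Finset.sum_eq_zero hc] at hpos
          exact lt_irrefl _ hpos
        have hbl : b ∈ l := by
          by_contra hc
          exact hb0 (odometer_of_notMem hc)
        have hba := l1_le_of_adj 0 (mem_nbrs.1 hb).symm
        simp only [sub_zero] at hba
        obtain ⟨c, hc, hcj⟩ := ih b hbl j (by omega)
        exact ⟨c, List.mem_append_left _ hc, hcj⟩

theorem l1_lt_of_mem {n : ℕ} {H : ℤ} {l : List (Site d)} (hH : 1 - (d : ℤ) ≤ H)
    (hl : Legal (initial d n H) l) {a : Site d} (ha : a ∈ l) : l1 a < n := by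
  have h1 := card_toFinset_le hH hl
  have h2 : Finset.range (l1 a + 1) ⊆ l.toFinset.image l1 := by
    intro j hj
    obtain ⟨b, hb, hbj⟩ := exists_l1_eq (by omega) l hl a ha j
      (by simpa [Nat.lt_succ_iff] using hj)
    exact Finset.mem_image.2 ⟨b, List.mem_toFinset.2 hb, hbj⟩
  have h3 := (Finset.card_le_card h2).trans Finset.card_image_le
  rw [Finset.card_range] at h3
  omega

theorem finite_l1_le (z : Site d) (s : ℕ) : {x : Site d | l1 (x - z) ≤ s}.Finite := by
  refine (Set.finite_Icc (fun i => z i - (s : ℤ)) (fun i => z i + (s : ℤ))).subset ?_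
  intro x hx
  replace hx : l1 (x - z) ≤ s := hx
  constructor <;> intro i <;> have := natAbs_le_l1 (x - z) i <;>
    simp only [Pi.sub_apply] at this ⊢ <;> omega

/-- If `H ≥ 1 - d`, the sandpile stabilizes. -/
theorem exists_stable {n : ℕ} {H : ℤ} (hd : 0 < d) (hH : 1 - (d : ℤ) ≤ H) :
    ∃ l : List (Site d), Legal (initial d n H) l ∧ Stable (run (initial d n H) l) := by
  obtain ⟨l, hl, -, hst⟩ := exists_stable_on hd (initial d n H) (finite_l1_le 0 n).toFinset
  refine ⟨l, hl, fun x => ?_⟩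
  by_contra! hx
  -- A site left unstable outside the chosen ball could legally topple next, but legal topplings
  -- stay at `ℓ¹` distance less than `n`.
  have h1 := l1_lt_of_mem hH (legal_append.2 ⟨hl, hx, trivial⟩ : Legal _ (l ++ [x]))
    (List.mem_append_right _ (List.mem_singleton.2 rfl))
  have := hst x (by simpa using h1.le)
  omega

theorem exists_pow_lt (d : ℕ) {κ : ℝ} (hκ : 0 < κ) :
    ∃ R : ℕ, ((2 * R + 1 : ℕ) : ℝ) ^ d < (1 + κ) ^ R := by
  have h := tendsto_pow_const_div_const_pow_of_one_lt d (by linarith : 1 < 1 + κ)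
  have h3 : (0 : ℝ) < 1 / 3 ^ d := by positivity
  obtain ⟨R, hR, hR1⟩ := ((h.eventually (gt_mem_nhds h3)).and (Filter.eventually_ge_atTop 1)).exists
  refine ⟨R, ?_⟩
  rw [div_lt_div_iff₀ (by positivity) (by positivity), one_mul] at hR
  refine lt_of_le_of_lt ?_ hR
  rw [← mul_pow]
  have hR1' : (1 : ℝ) ≤ R := by exact_mod_cast hR1
  refine pow_le_pow_left₀ (by positivity) ?_ d
  push_cast
  linarith

theorem card_l1_le (A : Finset (Site d)) (y : Site d) (s : ℕ) (hA : ∀ a ∈ A, l1 (a - y) ≤ s) :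
    #A ≤ (2 * s + 1) ^ d := by
  have h : A ⊆ Fintype.piFinset fun i => Finset.Icc (y i - (s : ℤ)) (y i + s) := by
    intro a ha
    rw [Fintype.mem_piFinset]
    intro i
    have h1 := hA a ha
    have := natAbs_le_l1 (a - y) i
    simp only [Pi.sub_apply, Finset.mem_Icc] at this ⊢
    omega
  refine (Finset.card_le_card h).trans ?_
  rw [Fintype.card_piFinset]
  simp only [Int.card_Icc]
  rw [Finset.prod_congr rfl (g := fun _ => 2 * s + 1) fun i _ => by omega]
  simp

/-- In a region without the origin where the odometer is bounded, toppled sites cannot be far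
from the boundary of the region. -/
theorem exists_radius_notMem (hd : 0 < d) (M : ℝ) :
    ∃ R : ℕ, ∀ (n : ℕ) (H : ℤ) (l : List (Site d)) (y : Site d), 1 - (d : ℤ) ≤ H →
      Legal (initial d n H) l → (∀ x, l1 (x - y) ≤ R → x ≠ 0 ∧ odometer l x ≤ M) → y ∉ l := by
  set M' := max M 1
  have hM' : 1 ≤ M' := le_max_right _ _
  have hd' : (0 : ℝ) < d := by exact_mod_cast hd
  obtain ⟨R, hR⟩ := exists_pow_lt d (κ := 1 / (2 * d * M')) (by positivity)
  refine ⟨R, fun n H l y hH hl hM hy => ?_⟩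
  -- Toppled sites within `ℓ¹` distance `s` of `y`; their number is shown to grow geometrically,
  -- against the polynomial bound `card_l1_le`.
  set A : ℕ → Finset (Site d) := fun s => l.toFinset.filter fun x => l1 (x - y) ≤ s with hA
  have hH1 : (1 : ℝ) ≤ d + H := by
    have : (1 : ℤ) ≤ d + H := by omega
    exact_mod_cast this
  have hmono : ∀ s, A s ⊆ A (s + 1) := by
    intro s x hx
    simp only [hA, Finset.mem_filter] at hx ⊢
    exact ⟨hx.1, by omega⟩
  -- The set `A s` misses the origin, so its at least `#(A s)` grains come through the shell `A (s +
  -- 1) \ A s`, each site of which sends in at most `2d M'`.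
  have hstep : ∀ s < R, (1 + 1 / (2 * d * M')) * (#(A s) : ℝ) ≤ #(A (s + 1)) := by
    intro s hs
    have h1 := card_mul_le hl (A := A s) fun a ha =>
      List.mem_toFinset.1 (Finset.mem_filter.1 ha).1
    rw [if_neg, zero_add] at h1
    swap
    · intro h0
      exact (hM 0 (by have := (Finset.mem_filter.1 h0).2; omega)).1 rfl
    have h2 : ∑ a ∈ l.toFinset \ A s, odometer l a * degreeIn (A s) a ≤
        ∑ a ∈ A (s + 1) \ A s, M' * (2 * d) := by
      rw [← Finset.sum_subset (s₁ := A (s + 1) \ A s)]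
      · refine Finset.sum_le_sum fun a ha => ?_
        have ha' := (Finset.mem_filter.1 (Finset.mem_sdiff.1 ha).1).2
        exact mul_le_mul ((hM a (by omega)).2.trans (le_max_left _ _)) (degreeIn_le _ _)
          (degreeIn_nonneg _ _) (by linarith)
      · exact Finset.sdiff_subset_sdiff (Finset.filter_subset _ _) le_rfl
      · intro a ha ha'
        have : degreeIn (A s) a = 0 := by
          refine Finset.sum_eq_zero fun b hb => if_neg fun hab => ha' ?_
          have h3 := l1_le_of_adj y hab.symm
          have h4 := (Finset.mem_filter.1 hb).2
          rw [Finset.mem_sdiff] at ha ⊢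
          exact ⟨Finset.mem_filter.2 ⟨ha.1, by omega⟩, ha.2⟩
        rw [this, mul_zero]
    rw [Finset.sum_const, nsmul_eq_mul, Finset.cast_card_sdiff (hmono s)] at h2
    have h5 : (#(A s) : ℝ) ≤ (#(A (s + 1)) - #(A s)) * (M' * (2 * d)) := by
      refine le_trans ?_ (h1.trans h2)
      nlinarith [Nat.cast_nonneg (α := ℝ) #(A s)]
    have h6 : 1 / (2 * d * M') * (#(A s) : ℝ) ≤ #(A (s + 1)) - #(A s) := by
      rw [div_mul_eq_mul_div, one_mul, div_le_iff₀ (by positivity)]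
      linarith
    linarith
  have hgrow : ∀ s ≤ R, (1 + 1 / (2 * d * M')) ^ s ≤ (#(A s) : ℝ) := by
    intro s
    induction s with
    | zero =>
      intro _
      have : y ∈ A 0 := by simp [hA, hy, l1]
      have := Finset.card_pos.2 ⟨y, this⟩
      simpa using this
    | succ s ih =>
      intro hs
      refine le_trans ?_ (hstep s (by omega))
      rw [pow_succ, mul_comm]
      exact mul_le_mul_of_nonneg_left (ih (by omega)) (by positivity)
  have hcard : (#(A R) : ℝ) ≤ ((2 * R + 1 : ℕ) : ℝ) ^ d := by
    exact_mod_cast card_l1_le (A R) y R fun a ha => (Finset.mem_filter.1 ha).2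
  linarith [hgrow R le_rfl]

/-! ### Monotonicity in the number of grains -/

theorem Legal.mono {l : List (Site d)} : ∀ {η ξ : Config d}, (∀ x, η x ≤ ξ x) → Legal η l →
    Legal ξ l := by
  induction l with
  | nil => intro _ _ _ _; trivial
  | cons a l ih =>
    intro η ξ h hl
    refine ⟨hl.1.trans (h a), ih (fun x => ?_) hl.2⟩
    simp only [topple]
    linarith [h x]

/-- Extra grains keep a toppling sequence legal. This reduces the outer bound for small `n` to a
single larger value. -/
theorem visited_mono {m n : ℕ} {H : ℤ} (h : m ≤ n) : visited d m H ⊆ visited d n H := by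
  rintro x ⟨l, hl, hx⟩
  refine ⟨l, hl.mono fun y => ?_, ?_⟩
  · simp only [initial]
    split_ifs <;> omega
  · rcases hx with ⟨hx, hm⟩ | hx
    · exact Or.inl ⟨hx, by omega⟩
    · exact Or.inr hx

end Sandpile

namespace Sandpile

open Finset

variable {d : ℕ}

/-! ### Taylor expansion of negative powers -/

/-- The mean value inequality raises the order of an error bound by one. As the derivative of `(1 +
u) ^ (-p)` is `-p (1 + u) ^ (-(p + 1))`, each Taylor bound below for `p` follows from the preceding
one for `p + 1`. -/
theorem abs_le_of_hasDerivAt {g g' : ℝ → ℝ} {C : ℝ} {k : ℕ}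
    (hg : ∀ u, |u| ≤ 1 / 2 → HasDerivAt g (g' u) u) (hC : 0 ≤ C)
    (hb : ∀ u, |u| ≤ 1 / 2 → |g' u| ≤ C * |u| ^ k) (h0 : g 0 = 0) {u : ℝ} (hu : |u| ≤ 1 / 2) :
    |g u| ≤ C * |u| ^ (k + 1) := by
  have h := Convex.norm_image_sub_le_of_norm_hasDerivWithin_le (f := g) (f' := g')
    (s := Set.Icc (-|u|) |u|) (C := C * |u| ^ k) (x := 0) (y := u)
    (fun x hx => (hg x ((abs_le.2 hx).trans hu)).hasDerivWithinAt)
    (fun x hx => (hb x ((abs_le.2 hx).trans hu)).trans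
      (mul_le_mul_of_nonneg_left (pow_le_pow_left₀ (abs_nonneg _) (abs_le.2 hx) k) hC))
    (convex_Icc _ _) ⟨by simp, by simp⟩ ⟨neg_abs_le u, le_abs_self u⟩
  simpa [h0, pow_succ, mul_assoc] using h

theorem hasDerivAt_one_add_rpow (p : ℝ) {u : ℝ} (hu : |u| ≤ 1 / 2) :
    HasDerivAt (fun u : ℝ => (1 + u) ^ (-p)) (-p * (1 + u) ^ (-(p + 1))) u := by
  have h1 : 0 < 1 + u := by linarith [(abs_le.1 hu).1]
  have h2 := ((hasDerivAt_id u).const_add 1).rpow_const (p := -p) (Or.inl h1.ne')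
  refine HasDerivAt.congr_deriv h2 ?_
  rw [show -(p + 1) = -p - 1 by ring]
  simp

theorem one_add_rpow_bound {p : ℝ} (hp : 0 ≤ p) :
    ∃ C : ℝ, 0 ≤ C ∧ ∀ u : ℝ, |u| ≤ 1 / 2 → |(1 + u) ^ (-p)| ≤ C := by
  refine ⟨(1 / 2 : ℝ) ^ (-p), by positivity, fun u hu => ?_⟩
  have h1 : 1 / 2 ≤ 1 + u := by linarith [(abs_le.1 hu).1]
  rw [abs_of_nonneg (Real.rpow_nonneg (by linarith) _)]
  exact Real.rpow_le_rpow_of_nonpos (by norm_num) h1 (by linarith)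

theorem one_add_rpow_taylor_zero {p : ℝ} (hp : 0 ≤ p) :
    ∃ C : ℝ, 0 ≤ C ∧ ∀ u : ℝ, |u| ≤ 1 / 2 → |(1 + u) ^ (-p) - 1| ≤ C * |u| ^ 1 := by
  obtain ⟨C, hC, h⟩ := one_add_rpow_bound (p := p + 1) (by linarith)
  refine ⟨p * C, by positivity, fun u hu => ?_⟩
  refine abs_le_of_hasDerivAt (k := 0) (g := fun u => (1 + u) ^ (-p) - 1)
    (fun u hu => (hasDerivAt_one_add_rpow p hu).sub_const 1) (by positivity)
    (fun u hu => ?_) (by simp) hu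
  rw [abs_mul, abs_neg, abs_of_nonneg hp, pow_zero, mul_one]
  exact mul_le_mul_of_nonneg_left (h u hu) hp

theorem one_add_rpow_taylor_one {p : ℝ} (hp : 0 ≤ p) :
    ∃ C : ℝ, 0 ≤ C ∧ ∀ u : ℝ, |u| ≤ 1 / 2 → |(1 + u) ^ (-p) - (1 - p * u)| ≤ C * |u| ^ 2 := by
  obtain ⟨C, hC, h⟩ := one_add_rpow_taylor_zero (p := p + 1) (by linarith)
  refine ⟨p * C, by positivity, fun u hu => ?_⟩
  refine abs_le_of_hasDerivAt (k := 1) (g := fun u => (1 + u) ^ (-p) - (1 - p * u))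
    (g' := fun u => -p * ((1 + u) ^ (-(p + 1)) - 1))
    (fun u hu => ?_) (by positivity) (fun u hu => ?_) (by simp) hu
  · refine HasDerivAt.congr_deriv ((hasDerivAt_one_add_rpow p hu).sub
      (((hasDerivAt_id u).const_mul p).const_sub 1)) ?_
    ring
  · rw [abs_mul, abs_neg, abs_of_nonneg hp, mul_assoc]
    exact mul_le_mul_of_nonneg_left (h u hu) hp

theorem one_add_rpow_taylor_two {p : ℝ} (hp : 0 ≤ p) :
    ∃ C : ℝ, 0 ≤ C ∧ ∀ u : ℝ, |u| ≤ 1 / 2 →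
      |(1 + u) ^ (-p) - (1 - p * u + p * (p + 1) / 2 * u ^ 2)| ≤ C * |u| ^ 3 := by
  obtain ⟨C, hC, h⟩ := one_add_rpow_taylor_one (p := p + 1) (by linarith)
  refine ⟨p * C, by positivity, fun u hu => ?_⟩
  refine abs_le_of_hasDerivAt (k := 2)
    (g := fun u => (1 + u) ^ (-p) - (1 - p * u + p * (p + 1) / 2 * u ^ 2))
    (g' := fun u => -p * ((1 + u) ^ (-(p + 1)) - (1 - (p + 1) * u)))
    (fun u hu => ?_) (by positivity) (fun u hu => ?_) (by simp) hu
  · refine HasDerivAt.congr_deriv ((hasDerivAt_one_add_rpow p hu).sub ((((hasDerivAt_id u).const_mul p).const_sub 1).add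
      (((hasDerivAt_id u).pow 2).const_mul (p * (p + 1) / 2)))) ?_
    simp only [id]
    push_cast
    ring
  · rw [abs_mul, abs_neg, abs_of_nonneg hp, mul_assoc]
    exact mul_le_mul_of_nonneg_left (h u hu) hp

theorem one_add_rpow_taylor_three {p : ℝ} (hp : 0 ≤ p) :
    ∃ C : ℝ, 0 ≤ C ∧ ∀ u : ℝ, |u| ≤ 1 / 2 →
      |(1 + u) ^ (-p) - (1 - p * u + p * (p + 1) / 2 * u ^ 2
        - p * (p + 1) * (p + 2) / 6 * u ^ 3)| ≤ C * |u| ^ 4 := by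
  obtain ⟨C, hC, h⟩ := one_add_rpow_taylor_two (p := p + 1) (by linarith)
  refine ⟨p * C, by positivity, fun u hu => ?_⟩
  refine abs_le_of_hasDerivAt (k := 3)
    (g := fun u => (1 + u) ^ (-p) - (1 - p * u + p * (p + 1) / 2 * u ^ 2
      - p * (p + 1) * (p + 2) / 6 * u ^ 3))
    (g' := fun u => -p * ((1 + u) ^ (-(p + 1)) -
      (1 - (p + 1) * u + (p + 1) * (p + 1 + 1) / 2 * u ^ 2)))
    (fun u hu => ?_) (by positivity) (fun u hu => ?_) (by simp) hu
  · refine HasDerivAt.congr_deriv ((hasDerivAt_one_add_rpow p hu).sub (((((hasDerivAt_id u).const_mul p).const_sub 1).add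
      (((hasDerivAt_id u).pow 2).const_mul (p * (p + 1) / 2))).sub
      (((hasDerivAt_id u).pow 3).const_mul (p * (p + 1) * (p + 2) / 6)))) ?_
    simp only [id]
    push_cast
    ring
  · rw [abs_mul, abs_neg, abs_of_nonneg hp, mul_assoc]
    exact mul_le_mul_of_nonneg_left (h u hu) hp

/-- Here `s = |y|`, `b = y·t` and `τ = |t|²`, so that `|y ± t|² = s² (1 + (±2b + τ)/s²)`. The
condition `6B ≤ s` puts the increment in the range `[-1/2, 1/2]` of the Taylor bounds. -/
theorem abs_increment_le {B s b τ : ℝ} (hB : 1 ≤ B) (hs : 6 * B ≤ s) (hb : |b| ≤ B * s)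
    (hτ : 0 ≤ τ) (hτB : τ ≤ B ^ 2) : |(2 * b + τ) / s ^ 2| ≤ 3 * B / s := by
  have hs0 : 0 < s := by linarith
  rw [abs_div, abs_of_pos (by positivity : 0 < s ^ 2), div_le_div_iff₀ (by positivity) hs0]
  have h1 : |2 * b + τ| ≤ 2 * (B * s) + B ^ 2 := by
    refine (abs_add_le _ _).trans ?_
    rw [abs_mul, abs_of_nonneg hτ, abs_two]
    linarith
  have h2 : |2 * b + τ| ≤ 3 * B * s := by nlinarith
  nlinarith

theorem increment_le_half {B s : ℝ} (hB : 1 ≤ B) (hs : 6 * B ≤ s) : 3 * B / s ≤ 1 / 2 := by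
  rw [div_le_div_iff₀ (by linarith) (by norm_num)]
  linarith

/-- Even part of the second-order expansion of a power of `s² ± 2b + τ`. -/
theorem exists_abs_even_le {α B : ℝ} (hα : 0 ≤ α) (hB : 1 ≤ B) :
    ∃ C : ℝ, 0 ≤ C ∧ ∀ s b τ : ℝ, 6 * B ≤ s → |b| ≤ B * s → 0 ≤ τ → τ ≤ B ^ 2 →
      |(1 + (2 * b + τ) / s ^ 2) ^ (-α) + (1 + (-(2 * b) + τ) / s ^ 2) ^ (-α) - 2 -
        (-(2 * α * τ / s ^ 2) + 4 * α * (α + 1) * b ^ 2 / s ^ 4)| ≤ C / s ^ 4 := by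
  obtain ⟨C, hC, hT⟩ := one_add_rpow_taylor_three hα
  refine ⟨2 * (C * (3 * B) ^ 4) + α * (α + 1) * B ^ 4 +
    α * (α + 1) * (α + 2) / 6 * (26 * B ^ 4), by positivity, fun s b τ hs hb hτ hτB => ?_⟩
  have hs0 : 0 < s := by linarith
  have hsB : B ≤ s := by linarith
  have h1 := abs_increment_le hB hs hb hτ hτB
  have h2 := abs_increment_le hB hs (b := -b) (by rwa [abs_neg]) hτ hτB
  rw [mul_neg] at h2
  have hhalf := increment_le_half hB hs
  have t1 := hT _ (h1.trans hhalf)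
  have t2 := hT _ (h2.trans hhalf)
  have e1 := t1.trans (mul_le_mul_of_nonneg_left (pow_le_pow_left₀ (abs_nonneg _) h1 4) hC)
  have e2 := t2.trans (mul_le_mul_of_nonneg_left (pow_le_pow_left₀ (abs_nonneg _) h2 4) hC)
  set X := (1 + (2 * b + τ) / s ^ 2) ^ (-α)
  set Y := (1 + (-(2 * b) + τ) / s ^ 2) ^ (-α)
  set u := (2 * b + τ) / s ^ 2 with hu
  set w := (-(2 * b) + τ) / s ^ 2 with hw
  -- Odd powers of `b` cancel between the two signs. Apart from the Taylor remainders, what is left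
  -- contains only `τ²/s⁴` and `(b²τ, τ³)/s⁶`, all of order `s⁻⁴`.
  have hmain : X + Y - 2 - (-(2 * α * τ / s ^ 2) + 4 * α * (α + 1) * b ^ 2 / s ^ 4) =
      (X - (1 - α * u + α * (α + 1) / 2 * u ^ 2 - α * (α + 1) * (α + 2) / 6 * u ^ 3)) +
      (Y - (1 - α * w + α * (α + 1) / 2 * w ^ 2 - α * (α + 1) * (α + 2) / 6 * w ^ 3)) +
      α * (α + 1) * (τ ^ 2 / s ^ 4) -
      α * (α + 1) * (α + 2) / 6 * ((24 * b ^ 2 * τ + 2 * τ ^ 3) / s ^ 6) := by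
    rw [hu, hw]
    field_simp
    ring
  have e3 : |α * (α + 1) * (τ ^ 2 / s ^ 4)| ≤ α * (α + 1) * (B ^ 4 / s ^ 4) := by
    rw [abs_of_nonneg (by positivity)]
    have : τ ^ 2 ≤ B ^ 4 := by
      calc τ ^ 2 ≤ (B ^ 2) ^ 2 := pow_le_pow_left₀ hτ hτB 2
        _ = B ^ 4 := by ring
    gcongr
  have e4 : |α * (α + 1) * (α + 2) / 6 * ((24 * b ^ 2 * τ + 2 * τ ^ 3) / s ^ 6)| ≤
      α * (α + 1) * (α + 2) / 6 * (26 * B ^ 4 / s ^ 4) := by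
    rw [abs_of_nonneg (by positivity)]
    have hb2 : b ^ 2 ≤ (B * s) ^ 2 := by
      rw [← sq_abs]
      exact pow_le_pow_left₀ (abs_nonneg _) hb 2
    have h3 : b ^ 2 * τ ≤ (B * s) ^ 2 * B ^ 2 := mul_le_mul hb2 hτB hτ (by positivity)
    have h4 : τ ^ 3 ≤ B ^ 4 * s ^ 2 := by
      calc τ ^ 3 ≤ (B ^ 2) ^ 3 := pow_le_pow_left₀ hτ hτB 3
        _ = B ^ 4 * B ^ 2 := by ring
        _ ≤ B ^ 4 * s ^ 2 := by gcongr
    have h5 : (24 * b ^ 2 * τ + 2 * τ ^ 3) / s ^ 6 ≤ 26 * B ^ 4 / s ^ 4 := by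
      rw [div_le_div_iff₀ (by positivity) (by positivity)]
      have : 24 * b ^ 2 * τ + 2 * τ ^ 3 ≤ 26 * B ^ 4 * s ^ 2 := by nlinarith
      calc (24 * b ^ 2 * τ + 2 * τ ^ 3) * s ^ 4 ≤ 26 * B ^ 4 * s ^ 2 * s ^ 4 := by gcongr
        _ = 26 * B ^ 4 * s ^ 6 := by ring
    gcongr
  rw [hmain]
  refine (abs_sub _ _).trans ?_
  refine (add_le_add ((abs_add_le _ _).trans (add_le_add ((abs_add_le _ _).trans
    (add_le_add e1 e2)) e3)) e4).trans (le_of_eq ?_)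
  field_simp
  ring

/-- Odd part of the first-order expansion of a power of `s² ± 2b + τ`. -/
theorem exists_abs_odd_le {α B : ℝ} (hα : 0 ≤ α) (hB : 1 ≤ B) :
    ∃ C : ℝ, 0 ≤ C ∧ ∀ s b τ : ℝ, 6 * B ≤ s → |b| ≤ B * s → 0 ≤ τ → τ ≤ B ^ 2 →
      |(1 + (2 * b + τ) / s ^ 2) ^ (-α) - (1 + (-(2 * b) + τ) / s ^ 2) ^ (-α) -
        (-(4 * α * b / s ^ 2))| ≤ C / s ^ 3 := by
  obtain ⟨C, hC, hT⟩ := one_add_rpow_taylor_two hα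
  refine ⟨2 * (C * (3 * B) ^ 3) + α * (α + 1) * (4 * B ^ 3), by positivity,
    fun s b τ hs hb hτ hτB => ?_⟩
  have hs0 : 0 < s := by linarith
  have h1 := abs_increment_le hB hs hb hτ hτB
  have h2 := abs_increment_le hB hs (b := -b) (by rwa [abs_neg]) hτ hτB
  rw [mul_neg] at h2
  have hhalf := increment_le_half hB hs
  have t1 := hT _ (h1.trans hhalf)
  have t2 := hT _ (h2.trans hhalf)
  have e1 := t1.trans (mul_le_mul_of_nonneg_left (pow_le_pow_left₀ (abs_nonneg _) h1 3) hC)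
  have e2 := t2.trans (mul_le_mul_of_nonneg_left (pow_le_pow_left₀ (abs_nonneg _) h2 3) hC)
  set X := (1 + (2 * b + τ) / s ^ 2) ^ (-α)
  set Y := (1 + (-(2 * b) + τ) / s ^ 2) ^ (-α)
  set u := (2 * b + τ) / s ^ 2 with hu
  set w := (-(2 * b) + τ) / s ^ 2 with hw
  have hmain : X - Y - (-(4 * α * b / s ^ 2)) =
      (X - (1 - α * u + α * (α + 1) / 2 * u ^ 2)) -
      (Y - (1 - α * w + α * (α + 1) / 2 * w ^ 2)) +
      α * (α + 1) * (4 * b * τ / s ^ 4) := by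
    rw [hu, hw]
    field_simp
    ring
  have e3 : |α * (α + 1) * (4 * b * τ / s ^ 4)| ≤ α * (α + 1) * (4 * B ^ 3 / s ^ 3) := by
    rw [abs_mul, abs_of_nonneg (by positivity : 0 ≤ α * (α + 1)), abs_div, abs_mul, abs_mul,
      abs_of_nonneg hτ, abs_of_pos (by positivity : (0 : ℝ) < s ^ 4),
      abs_of_pos (by norm_num : (0 : ℝ) < 4)]
    have h3 : |b| * τ ≤ B * s * B ^ 2 := mul_le_mul hb hτB hτ (by positivity)
    have h5 : 4 * |b| * τ / s ^ 4 ≤ 4 * B ^ 3 / s ^ 3 := by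
      rw [div_le_div_iff₀ (by positivity) (by positivity)]
      calc 4 * |b| * τ * s ^ 3 = 4 * (|b| * τ) * s ^ 3 := by ring
        _ ≤ 4 * (B * s * B ^ 2) * s ^ 3 := by gcongr
        _ = 4 * B ^ 3 * s ^ 4 := by ring
    gcongr
  rw [hmain]
  refine (abs_add_le _ _).trans ?_
  refine (add_le_add ((abs_sub _ _).trans (add_le_add e1 e2)) e3).trans (le_of_eq ?_)
  field_simp
  ring

/-! ### Powers of the Euclidean norm -/

/-- The Euclidean inner product on `ℝ^d`. -/
def dot (x y : Fin d → ℝ) : ℝ := ∑ i, x i * y i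

/-- The squared Euclidean norm on `ℝ^d`. -/
def nsq (x : Fin d → ℝ) : ℝ := ∑ i, x i ^ 2

/-- The Euclidean norm on `ℝ^d`. -/
noncomputable def enorm2 (x : Fin d → ℝ) : ℝ := √(nsq x)

theorem nsq_nonneg (x : Fin d → ℝ) : 0 ≤ nsq x := Finset.sum_nonneg fun _ _ => sq_nonneg _

theorem enorm2_nonneg (x : Fin d → ℝ) : 0 ≤ enorm2 x := Real.sqrt_nonneg _

theorem enorm2_sq (x : Fin d → ℝ) : enorm2 x ^ 2 = nsq x := Real.sq_sqrt (nsq_nonneg x)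

theorem nsq_add (x y : Fin d → ℝ) : nsq (x + y) = nsq x + 2 * dot x y + nsq y := by
  simp only [nsq, dot, Pi.add_apply, Finset.mul_sum, ← Finset.sum_add_distrib]
  exact Finset.sum_congr rfl fun i _ => by ring

theorem nsq_neg (x : Fin d → ℝ) : nsq (-x) = nsq x := by simp [nsq]

theorem dot_add (x y z : Fin d → ℝ) : dot x (y + z) = dot x y + dot x z := by
  simp [dot, mul_add, Finset.sum_add_distrib]

theorem dot_sub (x y z : Fin d → ℝ) : dot x (y - z) = dot x y - dot x z := by
  simp [dot, mul_sub, Finset.sum_sub_distrib]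

theorem abs_dot_le (x y : Fin d → ℝ) : |dot x y| ≤ enorm2 x * enorm2 y := by
  refine abs_le_of_sq_le_sq ?_ (mul_nonneg (enorm2_nonneg _) (enorm2_nonneg _))
  rw [mul_pow, enorm2_sq, enorm2_sq]
  exact Finset.sum_mul_sq_le_sq_mul_sq _ _ _

theorem enorm2_neg (x : Fin d → ℝ) : enorm2 (-x) = enorm2 x := by simp [enorm2, nsq_neg]

theorem enorm2_add_le (x y : Fin d → ℝ) : enorm2 (x + y) ≤ enorm2 x + enorm2 y := by
  refine abs_le_of_sq_le_sq' ?_ (add_nonneg (enorm2_nonneg _) (enorm2_nonneg _)) |>.2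
  rw [enorm2_sq, nsq_add, add_sq, enorm2_sq, enorm2_sq]
  have := (abs_le.1 (abs_dot_le x y)).2
  nlinarith

theorem enorm2_sub_le (x y : Fin d → ℝ) : enorm2 (x - y) ≤ enorm2 x + enorm2 y := by
  simpa [sub_eq_add_neg, enorm2_neg] using enorm2_add_le x (-y)

/-- The power `|y| ^ (-2α)` of the Euclidean norm. -/
noncomputable def normPow (α : ℝ) (y : Fin d → ℝ) : ℝ := nsq y ^ (-α)

theorem normPow_nonneg (α : ℝ) (y : Fin d → ℝ) : 0 ≤ normPow α y :=
  Real.rpow_nonneg (nsq_nonneg y) _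

theorem normPow_add {α : ℝ} {y t : Fin d → ℝ} (hy : 0 < nsq y)  :
    normPow α (y + t) = normPow α y * (1 + (2 * dot y t + nsq t) / enorm2 y ^ 2) ^ (-α) := by
  have h : nsq (y + t) = nsq y * (1 + (2 * dot y t + nsq t) / enorm2 y ^ 2) := by
    rw [enorm2_sq, nsq_add]
    field_simp
    ring
  have h2 : 0 ≤ 1 + (2 * dot y t + nsq t) / enorm2 y ^ 2 := by
    have := nsq_nonneg (y + t)
    rw [h] at this
    exact nonneg_of_mul_nonneg_right this hy
  rw [normPow, h, Real.mul_rpow hy.le h2, normPow]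

theorem normPow_sub {α : ℝ} {y t : Fin d → ℝ} (hy : 0 < nsq y) :
    normPow α (y - t) = normPow α y * (1 + (-(2 * dot y t) + nsq t) / enorm2 y ^ 2) ^ (-α) := by
  have hdot : dot y (-t) = -dot y t := by simp [dot]
  rw [sub_eq_add_neg, normPow_add hy, nsq_neg, hdot, mul_neg]

/-- The symmetric second difference. -/
def secDiff (F : (Fin d → ℝ) → ℝ) (y t : Fin d → ℝ) : ℝ := F (y + t) + F (y - t) - 2 * F y

/-- The main term is the Hessian of `|y|^(-2α)` evaluated at `(t, t)`; by symmetry the third-order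
term drops out, so the error gains four powers of `|y|`. -/
theorem exists_secDiff_normPow {α B : ℝ} (hα : 0 ≤ α) (hB : 1 ≤ B) :
    ∃ C : ℝ, 0 ≤ C ∧ ∀ y t : Fin d → ℝ, 6 * B ≤ enorm2 y → enorm2 t ≤ B →
      |secDiff (normPow α) y t - normPow α y *
        (-(2 * α * nsq t / enorm2 y ^ 2) + 4 * α * (α + 1) * dot y t ^ 2 / enorm2 y ^ 4)| ≤
      C * (normPow α y / enorm2 y ^ 4) := by
  obtain ⟨C, hC, h⟩ := exists_abs_even_le hα hB
  refine ⟨C, hC, fun y t hy ht => ?_⟩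
  have hpos : 0 < nsq y := by
    rw [← enorm2_sq]
    have : 0 < enorm2 y := by linarith
    positivity
  have h1 := h (enorm2 y) (dot y t) (nsq t) hy
    ((abs_dot_le y t).trans (by rw [mul_comm]; gcongr; exact enorm2_nonneg _)) (nsq_nonneg t)
    (by rw [← enorm2_sq]; exact pow_le_pow_left₀ (enorm2_nonneg _) ht 2)
  rw [secDiff, normPow_add hpos, normPow_sub hpos]
  have h2 := mul_le_mul_of_nonneg_left h1 (normPow_nonneg α y)
  rw [← abs_of_nonneg (normPow_nonneg α y), ← abs_mul, abs_of_nonneg (normPow_nonneg α y)] at h2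
  refine le_trans (le_of_eq ?_) (h2.trans (le_of_eq ?_))
  · congr 1; ring
  · ring

/-- A discrete product rule: the second difference of the product is `q·y` times the even part of
the power plus `q·t` times its odd part. -/
theorem exists_secDiff_dot_mul_normPow {α B : ℝ} (hα : 0 ≤ α) (hB : 1 ≤ B) :
    ∃ C : ℝ, 0 ≤ C ∧ ∀ q y t : Fin d → ℝ, enorm2 q ≤ 1 → 6 * B ≤ enorm2 y → enorm2 t ≤ B →
      |secDiff (fun y => dot q y * normPow α y) y t - normPow α y *
        (dot q y * (-(2 * α * nsq t / enorm2 y ^ 2) +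
          4 * α * (α + 1) * dot y t ^ 2 / enorm2 y ^ 4) -
          4 * α * dot q t * dot y t / enorm2 y ^ 2)| ≤
      C * (normPow α y / enorm2 y ^ 3) := by
  obtain ⟨C₁, hC₁, h₁⟩ := exists_secDiff_normPow (d := d) hα hB
  obtain ⟨C₂, hC₂, h₂⟩ := exists_abs_odd_le hα hB
  refine ⟨C₁ + B * C₂, by positivity, fun q y t hq hy ht => ?_⟩
  have hy0 : 0 < enorm2 y := by linarith
  have hpos : 0 < nsq y := by
    rw [← enorm2_sq]
    positivity
  have e1 := h₁ y t hy ht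
  have e2 := h₂ (enorm2 y) (dot y t) (nsq t) hy
    ((abs_dot_le y t).trans (by rw [mul_comm]; gcongr)) (nsq_nonneg t)
    (by rw [← enorm2_sq]; exact pow_le_pow_left₀ (enorm2_nonneg _) ht 2)
  have e2' := mul_le_mul_of_nonneg_left e2 (normPow_nonneg α y)
  rw [← abs_of_nonneg (normPow_nonneg α y), ← abs_mul, abs_of_nonneg (normPow_nonneg α y),
    mul_sub, mul_sub, ← normPow_add hpos, ← normPow_sub hpos] at e2'
  have hqy : |dot q y| ≤ enorm2 y :=
    (abs_dot_le q y).trans (mul_le_of_le_one_left hy0.le hq)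
  have hqt : |dot q t| ≤ B :=
    (abs_dot_le q t).trans ((mul_le_of_le_one_left (enorm2_nonneg _) hq).trans ht)
  set E := -(2 * α * nsq t / enorm2 y ^ 2) + 4 * α * (α + 1) * dot y t ^ 2 / enorm2 y ^ 4
  have key : secDiff (fun y => dot q y * normPow α y) y t - normPow α y *
      (dot q y * E - 4 * α * dot q t * dot y t / enorm2 y ^ 2) =
      dot q y * (secDiff (normPow α) y t - normPow α y * E) +
      dot q t * (normPow α (y + t) - normPow α (y - t) -
        normPow α y * -(4 * α * dot y t / enorm2 y ^ 2)) := by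
    simp only [secDiff, dot_add, dot_sub]
    ring
  rw [key]
  refine (abs_add_le _ _).trans ?_
  rw [abs_mul, abs_mul]
  refine (add_le_add (mul_le_mul hqy e1 (abs_nonneg _) hy0.le)
    (mul_le_mul hqt e2' (abs_nonneg _) (by linarith))).trans (le_of_eq ?_)
  field_simp

/-- The embedding of `ℤ^d` into `ℝ^d`. -/
def toR (x : Site d) : Fin d → ℝ := fun i => x i

theorem toR_add (x y : Site d) : toR (x + y) = toR x + toR y := by
  ext i; simp [toR]

theorem toR_sub (x y : Site d) : toR (x - y) = toR x - toR y := by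
  ext i; simp [toR]

theorem toR_unitVec (i : Fin d) : toR (unitVec i) = Pi.single i (1 : ℝ) := by
  ext j
  by_cases h : j = i
  · subst h; simp [toR, unitVec]
  · simp [toR, unitVec, h]

theorem nsq_single (i : Fin d) : nsq (Pi.single i (1 : ℝ)) = 1 := by
  unfold nsq
  rw [Finset.sum_eq_single i]
  · simp
  · intro j _ hj; simp [hj]
  · simp

theorem enorm2_single (i : Fin d) : enorm2 (Pi.single i (1 : ℝ)) = 1 := by
  rw [enorm2, nsq_single, Real.sqrt_one]

theorem dot_single (y : Fin d → ℝ) (i : Fin d) : dot y (Pi.single i (1 : ℝ)) = y i := by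
  simp [dot, Pi.single_apply]

theorem lap_comp_toR (F : (Fin d → ℝ) → ℝ) (x : Site d) :
    lap (fun x => F (toR x)) x = ∑ i, secDiff F (toR x) (Pi.single i 1) := by
  simp only [lap, secDiff, toR_add, toR_sub, toR_unitVec]

end Sandpile

/-! ### Discrete second differences of the Poisson kernel. -/

namespace Sandpile

open Finset

variable {d : ℕ}

theorem secDiff_add (F G : (Fin d → ℝ) → ℝ) (y t : Fin d → ℝ) :
    secDiff (fun y => F y + G y) y t = secDiff F y t + secDiff G y t := by
  simp only [secDiff]; ring

theorem secDiff_const_mul (c : ℝ) (F : (Fin d → ℝ) → ℝ) (y t : Fin d → ℝ) :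
    secDiff (fun y => c * F y) y t = c * secDiff F y t := by
  simp only [secDiff]; ring

theorem abs_sum_secDiff_sub_le {F : (Fin d → ℝ) → ℝ} {m : Fin d → ℝ} {y : Fin d → ℝ} {c : ℝ}
    (h : ∀ i, |secDiff F y (Pi.single i 1) - m i| ≤ c) :
    |∑ i, secDiff F y (Pi.single i 1) - ∑ i, m i| ≤ d * c := by
  rw [← Finset.sum_sub_distrib]
  refine (Finset.abs_sum_le_sum_abs _ _).trans ((Finset.sum_le_sum fun i _ => h i).trans ?_)
  simp

/-- The sum of the second differences of `|y| ^ (-2α)` in the coordinate directions. -/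
theorem exists_sum_secDiff_normPow {α : ℝ} (hα : 0 ≤ α) :
    ∃ C : ℝ, 0 ≤ C ∧ ∀ y : Fin d → ℝ, 6 ≤ enorm2 y →
      |∑ i, secDiff (normPow α) y (Pi.single i 1) -
        2 * α * (2 * α + 2 - d) * (normPow α y / enorm2 y ^ 2)| ≤
      C * (normPow α y / enorm2 y ^ 4) := by
  obtain ⟨C, hC, h⟩ := exists_secDiff_normPow (d := d) hα le_rfl
  refine ⟨d * C, by positivity, fun y hy => ?_⟩
  have h1 := abs_sum_secDiff_sub_le fun i => h y (Pi.single i 1) (by linarith)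
    (enorm2_single i).le
  have h2 : ∑ i : Fin d, normPow α y *
      (-(2 * α * nsq (Pi.single i (1 : ℝ)) / enorm2 y ^ 2) +
        4 * α * (α + 1) * dot y (Pi.single i 1) ^ 2 / enorm2 y ^ 4) =
      2 * α * (2 * α + 2 - d) * (normPow α y / enorm2 y ^ 2) := by
    simp only [nsq_single, dot_single, mul_one]
    rw [← Finset.mul_sum, Finset.sum_add_distrib, ← Finset.sum_div, ← Finset.mul_sum]
    have : ∑ i, y i ^ 2 = enorm2 y ^ 2 := (enorm2_sq y).symm
    rw [this]
    simp only [Finset.sum_const, Finset.card_univ, Fintype.card_fin, nsmul_eq_mul]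
    have : enorm2 y ≠ 0 := by linarith
    field_simp
    ring
  rw [h2] at h1
  refine h1.trans (le_of_eq (by ring))

/-- The function `q·y |y|^(-d)` is a derivative of the fundamental solution, hence harmonic; the
main terms sum to zero and only the discretization error remains. -/
theorem exists_sum_secDiff_dot_mul_normPow (d : ℕ) :
    ∃ C : ℝ, 0 ≤ C ∧ ∀ q y : Fin d → ℝ, enorm2 q ≤ 1 → 6 ≤ enorm2 y →
      |∑ i, secDiff (fun y => dot q y * normPow (d / 2) y) y (Pi.single i 1)| ≤
      C * (normPow (d / 2) y / enorm2 y ^ 3) := by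
  obtain ⟨C, hC, h⟩ := exists_secDiff_dot_mul_normPow (d := d) (α := d / 2) (by positivity) le_rfl
  refine ⟨d * C, by positivity, fun q y hq hy => ?_⟩
  have h1 := abs_sum_secDiff_sub_le fun i => h q y (Pi.single i 1) hq (by linarith)
    (enorm2_single i).le
  have h2 : ∑ i : Fin d, normPow (d / 2) y *
      (dot q y * (-(2 * ((d : ℝ) / 2) * nsq (Pi.single i (1 : ℝ)) / enorm2 y ^ 2) +
          4 * ((d : ℝ) / 2) * ((d : ℝ) / 2 + 1) * dot y (Pi.single i 1) ^ 2 / enorm2 y ^ 4) -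
          4 * ((d : ℝ) / 2) * dot q (Pi.single i 1) * dot y (Pi.single i 1) / enorm2 y ^ 2) =
      0 := by
    simp only [nsq_single, dot_single, mul_one]
    rw [← Finset.mul_sum, Finset.sum_sub_distrib, ← Finset.mul_sum, Finset.sum_add_distrib,
      ← Finset.sum_div, ← Finset.mul_sum, ← Finset.sum_div]
    have h3 : ∑ i, y i ^ 2 = enorm2 y ^ 2 := (enorm2_sq y).symm
    have h4 : ∑ i, 4 * ((d : ℝ) / 2) * q i * y i = 4 * ((d : ℝ) / 2) * dot q y := by
      rw [dot, Finset.mul_sum]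
      exact Finset.sum_congr rfl fun i _ => by ring
    rw [h3, h4]
    simp only [Finset.sum_const, Finset.card_univ, Fintype.card_fin, nsmul_eq_mul]
    have : enorm2 y ≠ 0 := by linarith
    field_simp
    ring
  rw [h2, sub_zero] at h1
  refine h1.trans (le_of_eq (by ring))

theorem normPow_sub_one {α : ℝ} {y : Fin d → ℝ} (hy : 0 < enorm2 y) :
    normPow (α - 1) y = normPow α y * enorm2 y ^ 2 := by
  have h : 0 < nsq y := by rw [← enorm2_sq]; positivity
  rw [normPow, normPow, enorm2_sq, show -(α - 1) = -α + 1 by ring, Real.rpow_add h, Real.rpow_one]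

theorem normPow_add_half {α : ℝ} {y : Fin d → ℝ} (hy : 0 < enorm2 y) :
    normPow (α + 1 / 2) y = normPow α y / enorm2 y := by
  have h : 0 < nsq y := by rw [← enorm2_sq]; positivity
  rw [normPow, normPow, enorm2, show -(α + 1 / 2) = -α - 1 / 2 by ring, Real.rpow_sub h,
    Real.sqrt_eq_rpow]

theorem normPow_half (y : Fin d → ℝ) : normPow (d / 2) y = (enorm2 y ^ d)⁻¹ := by
  rw [normPow, Real.rpow_neg (nsq_nonneg y), enorm2, Real.sqrt_eq_rpow, ← Real.rpow_natCast,
    ← Real.rpow_mul (nsq_nonneg y)]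
  congr 2
  ring

/-- The Poisson kernel of the ball of radius `ρ` centred at `-ρ q`, with pole at the point `0` of
the sphere. -/
noncomputable def poissonKernel (ρ : ℝ) (q y : Fin d → ℝ) : ℝ :=
  -(1 / ρ) * normPow (d / 2 - 1) y + -2 * (dot q y * normPow (d / 2) y)

/-- With `y = x - ρq` this is the familiar form `(ρ² - |x|²) / (ρ |x - ρq|^d)`, which shows the
sign. The definition splits the kernel into the two harmonic pieces covered by the expansions. -/
theorem poissonKernel_eq {ρ : ℝ} {q y : Fin d → ℝ} (hρ : ρ ≠ 0) (hq : enorm2 q = 1)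
    (hy : 0 < enorm2 y) :
    poissonKernel ρ q y = normPow (d / 2) y * ((ρ ^ 2 - nsq (y + ρ • q)) / ρ) := by
  have h1 : nsq (y + ρ • q) = enorm2 y ^ 2 + 2 * ρ * dot q y + ρ ^ 2 := by
    have h2 : dot y (ρ • q) = ρ * dot q y := by
      simp only [dot, Finset.mul_sum, Pi.smul_apply, smul_eq_mul]
      exact Finset.sum_congr rfl fun i _ => by ring
    have h3 : nsq (ρ • q) = ρ ^ 2 := by
      have : nsq (ρ • q) = ρ ^ 2 * nsq q := by
        simp only [nsq, Finset.mul_sum, Pi.smul_apply, smul_eq_mul, mul_pow]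
      rw [this, ← enorm2_sq, hq]; ring
    rw [nsq_add, h2, h3, enorm2_sq]; ring
  rw [poissonKernel, normPow_sub_one hy, h1]
  field_simp
  ring

/-- Both pieces are harmonic in the continuum. The error `|y|^(-d-2)/ρ` of the first matches that of
the second thanks to `|y| ≤ 3ρ`. -/
theorem exists_sum_secDiff_poissonKernel (hd : 2 ≤ d) :
    ∃ C : ℝ, 0 ≤ C ∧ ∀ (ρ : ℝ) (q y : Fin d → ℝ), enorm2 q ≤ 1 → 6 ≤ enorm2 y →
      enorm2 y ≤ 3 * ρ →
      |∑ i, secDiff (poissonKernel ρ q) y (Pi.single i 1)| ≤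
      C * (normPow (d / 2) y / enorm2 y ^ 3) := by
  have hd' : (2 : ℝ) ≤ d := by exact_mod_cast hd
  obtain ⟨C₁, hC₁, h₁⟩ := exists_sum_secDiff_normPow (d := d) (α := d / 2 - 1) (by linarith)
  obtain ⟨C₂, hC₂, h₂⟩ := exists_sum_secDiff_dot_mul_normPow d
  refine ⟨3 * C₁ + 2 * C₂, by positivity, fun ρ q y hq hy hyρ => ?_⟩
  have hs : 0 < enorm2 y := by linarith
  have hρ : 0 < ρ := by linarith
  have e1 := h₁ y hy
  have e2 := h₂ q y hq hy
  have hz : 2 * ((d : ℝ) / 2 - 1) * (2 * ((d : ℝ) / 2 - 1) + 2 - d) = 0 := by ring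
  rw [hz, zero_mul, sub_zero, normPow_sub_one hs] at e1
  unfold poissonKernel
  simp only [secDiff_add, secDiff_const_mul, Finset.sum_add_distrib, ← Finset.mul_sum]
  refine (abs_add_le _ _).trans ?_
  rw [abs_mul, abs_mul, abs_neg, abs_neg, abs_two, abs_of_pos (by positivity : 0 < 1 / ρ)]
  have e3 : 1 / ρ ≤ 3 / enorm2 y := by
    rw [div_le_div_iff₀ hρ hs]; linarith
  refine (add_le_add (mul_le_mul e3 e1 (abs_nonneg _) (by positivity))
    (mul_le_mul_of_nonneg_left e2 (by norm_num))).trans (le_of_eq ?_)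
  field_simp

/-- A subharmonic perturbation of the Poisson kernel. -/
noncomputable def subPoisson (a ρ : ℝ) (q y : Fin d → ℝ) : ℝ :=
  poissonKernel ρ q y + a * normPow (d / 2 + 1 / 2) y

/-- The continuum Laplacian of `|y|^(-d-1)` is `3(d+1) |y|^(-d-3)`, positive and of exactly the
order of the discretization error, so a fixed multiple absorbs that error. -/
theorem exists_subPoisson_subharmonic (hd : 2 ≤ d) :
    ∃ a A : ℝ, 0 ≤ a ∧ 6 ≤ A ∧ a ≤ A ∧ ∀ (ρ : ℝ) (q y : Fin d → ℝ), enorm2 q ≤ 1 →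
      A ≤ enorm2 y → enorm2 y ≤ 3 * ρ →
      0 ≤ ∑ i, secDiff (subPoisson a ρ q) y (Pi.single i 1) := by
  have hd' : (2 : ℝ) ≤ d := by exact_mod_cast hd
  obtain ⟨C₁, hC₁, h₁⟩ := exists_sum_secDiff_poissonKernel hd
  obtain ⟨C₂, hC₂, h₂⟩ := exists_sum_secDiff_normPow (d := d) (α := d / 2 + 1 / 2) (by linarith)
  refine ⟨C₁, 6 + C₁ + C₂, hC₁, by linarith, by linarith, fun ρ q y hq hy hyρ => ?_⟩
  have hs : 0 < enorm2 y := by linarith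
  have e1 := (abs_le.1 (h₁ ρ q y hq (by linarith) hyρ)).1
  have e2 := (abs_le.1 (h₂ y (by linarith))).1
  rw [normPow_add_half hs] at e2
  have hcoef : 2 * ((d : ℝ) / 2 + 1 / 2) * (2 * ((d : ℝ) / 2 + 1 / 2) + 2 - d) = 3 * (d + 1) := by
    ring
  rw [hcoef] at e2
  unfold subPoisson
  simp only [secDiff_add, secDiff_const_mul, Finset.sum_add_distrib, ← Finset.mul_sum]
  set N := normPow ((d : ℝ) / 2) y
  have hN : 0 ≤ N := normPow_nonneg _ _
  set s := enorm2 y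
  have e3 : C₂ * (N / s / s ^ 4) ≤ N / s ^ 3 := by
    have : C₂ ≤ s ^ 2 := by nlinarith
    calc C₂ * (N / s / s ^ 4) ≤ s ^ 2 * (N / s / s ^ 4) := by gcongr
      _ = N / s ^ 3 := by field_simp
  have e4 : 3 * ((d : ℝ) + 1) * (N / s / s ^ 2) ≥ 2 * (N / s ^ 3) := by
    have : N / s / s ^ 2 = N / s ^ 3 := by field_simp
    rw [this]
    have : 0 ≤ N / s ^ 3 := by positivity
    nlinarith
  have e5 : N / s ^ 3 ≤ ∑ i, secDiff (normPow ((d : ℝ) / 2 + 1 / 2)) y (Pi.single i 1) := by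
    linarith
  have := mul_le_mul_of_nonneg_left e5 hC₁
  linarith

/-- The second differences of the Poisson kernel are bounded below. -/
theorem exists_secDiff_poissonKernel_ge (hd : 2 ≤ d) {B : ℝ} (hB : 1 ≤ B) :
    ∃ C : ℝ, 0 ≤ C ∧ ∀ (ρ : ℝ) (q y t : Fin d → ℝ), enorm2 q ≤ 1 → 6 * B ≤ enorm2 y →
      enorm2 y ≤ 3 * ρ → enorm2 t ≤ B →
      -(C * (normPow (d / 2) y / enorm2 y)) ≤ secDiff (poissonKernel ρ q) y t := by
  have hd' : (2 : ℝ) ≤ d := by exact_mod_cast hd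
  obtain ⟨C₁, hC₁, h₁⟩ := exists_secDiff_normPow (d := d) (α := d / 2 - 1) (by linarith) hB
  obtain ⟨C₂, hC₂, h₂⟩ := exists_secDiff_dot_mul_normPow (d := d) (α := d / 2) (by linarith) hB
  set α : ℝ := (d : ℝ) / 2 with hα
  refine ⟨3 * (C₁ + 2 * α * B ^ 2 + 4 * α * α * B ^ 2) +
    2 * (C₂ + 2 * α * B ^ 2 + 4 * α * (α + 1) * B ^ 2 + 4 * α * B ^ 2), by positivity,
    fun ρ q y t hq hy hyρ ht => ?_⟩
  have hs : 0 < enorm2 y := by linarith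
  have hρ : 0 < ρ := by linarith
  have e1 := h₁ y t hy ht
  have e2 := h₂ q y t hq hy ht
  rw [normPow_sub_one hs] at e1
  have hN : 0 ≤ normPow α y := normPow_nonneg _ _
  have hqy : |dot q y| ≤ enorm2 y :=
    (abs_dot_le q y).trans (mul_le_of_le_one_left hs.le hq)
  have hqt : |dot q t| ≤ B :=
    (abs_dot_le q t).trans ((mul_le_of_le_one_left (enorm2_nonneg _) hq).trans ht)
  have hyt : |dot y t| ≤ B * enorm2 y :=
    (abs_dot_le y t).trans (by rw [mul_comm]; gcongr)
  have hyt2 : dot y t ^ 2 ≤ (B * enorm2 y) ^ 2 := by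
    rw [← sq_abs]; exact pow_le_pow_left₀ (abs_nonneg _) hyt 2
  have htt : nsq t ≤ B ^ 2 := by
    rw [← enorm2_sq]; exact pow_le_pow_left₀ (enorm2_nonneg _) ht 2
  have htt0 := nsq_nonneg t
  set N := normPow α y
  set s := enorm2 y
  have hs1 : 1 ≤ s := by linarith
  have hE : ∀ β : ℝ, 0 ≤ β → |-(2 * β * nsq t / s ^ 2) + 4 * β * (β + 1) * dot y t ^ 2 / s ^ 4| ≤
      (2 * β * B ^ 2 + 4 * β * (β + 1) * B ^ 2) / s ^ 2 := by
    intro β hβ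
    refine (abs_add_le _ _).trans ?_
    rw [abs_neg, abs_of_nonneg (by positivity : 0 ≤ 2 * β * nsq t / s ^ 2),
      abs_of_nonneg (by positivity : 0 ≤ 4 * β * (β + 1) * dot y t ^ 2 / s ^ 4), add_div]
    refine add_le_add (by gcongr) ?_
    calc 4 * β * (β + 1) * dot y t ^ 2 / s ^ 4 ≤ 4 * β * (β + 1) * (B * s) ^ 2 / s ^ 4 := by gcongr
      _ = _ := by field_simp
  have f1 : |secDiff (normPow (α - 1)) y t| ≤ (C₁ + 2 * α * B ^ 2 + 4 * α * α * B ^ 2) * N := by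
    have h3 := abs_le.1 (hE (α - 1) (by linarith))
    have h4 := abs_le.1 e1
    have h5 : |N * s ^ 2 * (-(2 * (α - 1) * nsq t / s ^ 2) +
        4 * (α - 1) * (α - 1 + 1) * dot y t ^ 2 / s ^ 4)| ≤
        (2 * α * B ^ 2 + 4 * α * α * B ^ 2) * N := by
      rw [abs_mul, abs_of_nonneg (by positivity : 0 ≤ N * s ^ 2)]
      refine (mul_le_mul_of_nonneg_left (hE (α - 1) (by linarith)) (by positivity)).trans ?_
      have : N * s ^ 2 * ((2 * (α - 1) * B ^ 2 + 4 * (α - 1) * (α - 1 + 1) * B ^ 2) / s ^ 2) =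
          (2 * (α - 1) * B ^ 2 + 4 * (α - 1) * α * B ^ 2) * N := by
        field_simp
        ring
      rw [this]
      have : 0 ≤ α := by linarith
      gcongr <;> linarith
    have h6 : C₁ * (N * s ^ 2 / s ^ 4) ≤ C₁ * N := by
      refine mul_le_mul_of_nonneg_left ?_ hC₁
      rw [div_le_iff₀ (by positivity)]
      have : s ^ 2 ≤ s ^ 4 := pow_le_pow_right₀ hs1 (by norm_num)
      gcongr
    have h7 := abs_le.1 h5
    rw [abs_le]
    constructor <;> linarith
  have f2 : |secDiff (fun y => dot q y * normPow α y) y t| ≤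
      (C₂ + 2 * α * B ^ 2 + 4 * α * (α + 1) * B ^ 2 + 4 * α * B ^ 2) * (N / s) := by
    have h5 : |N * (dot q y * (-(2 * α * nsq t / s ^ 2) +
        4 * α * (α + 1) * dot y t ^ 2 / s ^ 4) - 4 * α * dot q t * dot y t / s ^ 2)| ≤
        (2 * α * B ^ 2 + 4 * α * (α + 1) * B ^ 2 + 4 * α * B ^ 2) * (N / s) := by
      rw [abs_mul, abs_of_nonneg hN]
      have h8 : |4 * α * dot q t * dot y t / s ^ 2| ≤ 4 * α * B * (B * s) / s ^ 2 := by
        rw [abs_div, abs_mul, abs_mul, abs_of_nonneg (by positivity : 0 ≤ 4 * α),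
          abs_of_pos (by positivity : 0 < s ^ 2)]
        gcongr
      have h10 : |dot q y * (-(2 * α * nsq t / s ^ 2) +
          4 * α * (α + 1) * dot y t ^ 2 / s ^ 4)| ≤
          s * ((2 * α * B ^ 2 + 4 * α * (α + 1) * B ^ 2) / s ^ 2) := by
        rw [abs_mul]
        exact mul_le_mul hqy (hE α (by positivity)) (abs_nonneg _) hs.le
      have h9 := (abs_sub _ _).trans (add_le_add h10 h8)
      refine (mul_le_mul_of_nonneg_left h9 hN).trans (le_of_eq ?_)
      field_simp
    have h6 : C₂ * (N / s ^ 3) ≤ C₂ * (N / s) := by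
      refine mul_le_mul_of_nonneg_left ?_ hC₂
      exact div_le_div_of_nonneg_left hN hs (by
        calc s = s ^ 1 := (pow_one s).symm
          _ ≤ s ^ 3 := pow_le_pow_right₀ hs1 (by norm_num))
    have h7 := abs_le.1 h5
    have h4 := abs_le.1 e2
    rw [abs_le]
    constructor <;> linarith
  have e3 : 1 / ρ ≤ 3 / s := by
    rw [div_le_div_iff₀ hρ hs]; linarith
  have f3 : |secDiff (poissonKernel ρ q) y t| ≤
      3 / s * ((C₁ + 2 * α * B ^ 2 + 4 * α * α * B ^ 2) * N) +
      2 * ((C₂ + 2 * α * B ^ 2 + 4 * α * (α + 1) * B ^ 2 + 4 * α * B ^ 2) * (N / s)) := by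
    unfold poissonKernel
    simp only [secDiff_add, secDiff_const_mul]
    refine (abs_add_le _ _).trans ?_
    rw [abs_mul, abs_mul, abs_neg, abs_neg, abs_two, abs_of_pos (by positivity : 0 < 1 / ρ)]
    exact add_le_add (mul_le_mul e3 f1 (abs_nonneg _) (by positivity))
      (mul_le_mul_of_nonneg_left f2 (by norm_num))
  refine le_trans ?_ (abs_le.1 f3).1
  rw [neg_le_neg_iff]
  refine le_of_eq ?_
  field_simp

end Sandpile

namespace Sandpile

open Finset MeasureTheory

variable {d : ℕ}

/-! ### The mean value property for balls -/

theorem continuous_nsq : Continuous (nsq : (Fin d → ℝ) → ℝ) := by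
  unfold nsq; fun_prop

theorem continuous_enorm2 : Continuous (enorm2 : (Fin d → ℝ) → ℝ) :=
  continuous_nsq.sqrt

/-- The open Euclidean ball of radius `R`. -/
def ball2 (d : ℕ) (R : ℝ) : Set (Fin d → ℝ) := {x | enorm2 x < R}

theorem isOpen_ball2 (R : ℝ) : IsOpen (ball2 d R) := isOpen_lt continuous_enorm2 continuous_const

theorem abs_apply_le_enorm2 (x : Fin d → ℝ) (i : Fin d) : |x i| ≤ enorm2 x := by
  refine Real.abs_le_sqrt ?_
  exact Finset.single_le_sum (f := fun i => x i ^ 2) (fun _ _ => sq_nonneg _) (Finset.mem_univ i)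

theorem norm_le_enorm2 (x : Fin d → ℝ) : ‖x‖ ≤ enorm2 x :=
  (pi_norm_le_iff_of_nonneg (enorm2_nonneg x)).2 fun i => abs_apply_le_enorm2 x i

theorem isCompact_closedBall2 (R : ℝ) : IsCompact {x : Fin d → ℝ | enorm2 x ≤ R} := by
  refine Metric.isCompact_of_isClosed_isBounded
    (isClosed_le continuous_enorm2 continuous_const) ?_
  refine (Metric.isBounded_closedBall (x := (0 : Fin d → ℝ)) (r := R)).subset ?_
  intro x hx
  simpa using (norm_le_enorm2 x).trans hx

theorem enorm2_smul (c : ℝ) (x : Fin d → ℝ) : enorm2 (c • x) = |c| * enorm2 x := by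
  have : nsq (c • x) = c ^ 2 * nsq x := by
    simp only [nsq, Finset.mul_sum, Pi.smul_apply, smul_eq_mul, mul_pow]
  rw [enorm2, this, Real.sqrt_mul (sq_nonneg c), Real.sqrt_sq_eq_abs, enorm2]

/-- The function `(R² - |x|²)₊`. -/
noncomputable def paraboloid (R : ℝ) (x : Fin d → ℝ) : ℝ := max (R ^ 2 - nsq x) 0

theorem paraboloid_nonneg (R : ℝ) (x : Fin d → ℝ) : 0 ≤ paraboloid R x := le_max_right _ _

theorem continuous_paraboloid (R : ℝ) : Continuous (paraboloid R : (Fin d → ℝ) → ℝ) :=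
  (continuous_const.sub continuous_nsq).max continuous_const

theorem enorm2_le_iff {R : ℝ} (hR : 0 ≤ R) (x : Fin d → ℝ) : enorm2 x ≤ R ↔ nsq x ≤ R ^ 2 :=
  Real.sqrt_le_left hR

theorem paraboloid_eq_zero {R : ℝ} (hR : 0 ≤ R) {x : Fin d → ℝ} (hx : R ≤ enorm2 x) :
    paraboloid R x = 0 := by
  refine max_eq_right ?_
  rw [← enorm2_sq]
  have := pow_le_pow_left₀ hR hx 2
  linarith

theorem tsupport_mul_paraboloid_subset {R : ℝ} (hR : 0 ≤ R) (h : (Fin d → ℝ) → ℝ) :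
    tsupport (fun x => paraboloid R x * h x) ⊆ {x | enorm2 x ≤ R} := by
  refine closure_minimal ?_ (isClosed_le continuous_enorm2 continuous_const)
  intro x hx
  by_contra hc
  exact hx (by simp [paraboloid_eq_zero hR (not_le.1 hc).le])

theorem continuous_paraboloid_mul {R : ℝ} (hR : 0 ≤ R) {U : Set (Fin d → ℝ)} (hU : IsOpen U)
    (hKU : {x | enorm2 x ≤ R} ⊆ U) {h : (Fin d → ℝ) → ℝ} (hh : ContinuousOn h U) :
    Continuous fun x => paraboloid R x * h x := by
  rw [continuous_iff_continuousAt]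
  intro x
  by_cases hx : enorm2 x ≤ R
  · exact (continuous_paraboloid R).continuousAt.mul (hh.continuousAt (hU.mem_nhds (hKU hx)))
  · have hop : IsOpen {x : Fin d → ℝ | R < enorm2 x} := isOpen_lt continuous_const continuous_enorm2
    have : (fun x => paraboloid R x * h x) =ᶠ[nhds x] fun _ => 0 := by
      filter_upwards [hop.mem_nhds (not_le.1 hx)] with y hy
      rw [paraboloid_eq_zero hR (le_of_lt hy), zero_mul]
    exact continuousAt_const.congr this.symm

theorem integrable_paraboloid_mul {R : ℝ} (hR : 0 ≤ R) {U : Set (Fin d → ℝ)} (hU : IsOpen U)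
    (hKU : {x | enorm2 x ≤ R} ⊆ U) {h : (Fin d → ℝ) → ℝ} (hh : ContinuousOn h U) :
    Integrable fun x => paraboloid R x * h x :=
  (continuous_paraboloid_mul hR hU hKU hh).integrable_of_hasCompactSupport
    ((isCompact_closedBall2 R).of_isClosed_subset (isClosed_tsupport _)
      (tsupport_mul_paraboloid_subset hR h))

/-- The square of the positive part is differentiable also at `0`. With the squared paraboloid as
weight, integration by parts needs no boundary terms on the sphere. -/
theorem hasDerivAt_max_sq (s : ℝ) : HasDerivAt (fun s : ℝ => max s 0 ^ 2) (2 * max s 0) s := by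
  rcases lt_trichotomy s 0 with h | rfl | h
  · rw [max_eq_right h.le, mul_zero]
    refine (hasDerivAt_const s (0 : ℝ)).congr_of_eventuallyEq ?_
    filter_upwards [gt_mem_nhds h] with y hy
    rw [max_eq_right hy.le]; norm_num
  · rw [hasDerivAt_iff_isLittleO_nhds_zero]
    simp only [zero_add, max_self, mul_zero, smul_zero, sub_zero]
    refine Asymptotics.IsBigO.trans_isLittleO (g := fun h : ℝ => h ^ 2) ?_
      (Asymptotics.isLittleO_pow_id (by norm_num))
    refine Asymptotics.isBigO_of_le _ fun h => ?_
    rw [zero_pow (by norm_num), sub_zero, norm_pow, norm_pow]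
    refine pow_le_pow_left₀ (norm_nonneg _) ?_ 2
    rw [Real.norm_eq_abs, Real.norm_eq_abs, abs_of_nonneg (le_max_right _ _)]
    exact max_le (le_abs_self h) (abs_nonneg h)
  · rw [max_eq_left h.le]
    have h1 : HasDerivAt (fun s : ℝ => s ^ 2) (2 * s) s := by
      simpa using hasDerivAt_pow 2 s
    refine h1.congr_of_eventuallyEq ?_
    filter_upwards [lt_mem_nhds h] with y hy
    rw [max_eq_left hy.le]

theorem hasDerivAt_nsq_line (x : Fin d → ℝ) (i : Fin d) :
    HasDerivAt (fun t : ℝ => nsq (x + t • Pi.single i (1 : ℝ))) (2 * x i) 0 := by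
  have : (fun t : ℝ => nsq (x + t • Pi.single i (1 : ℝ))) =
      fun t => nsq x + 2 * x i * t + t ^ 2 := by
    funext t
    have h1 : dot x (t • Pi.single i (1 : ℝ)) = t * x i := by
      simp [dot, Pi.single_apply, mul_comm]
    have h2 : nsq (t • Pi.single i (1 : ℝ)) = t ^ 2 := by
      rw [← enorm2_sq, enorm2_smul, enorm2_single, mul_one, sq_abs]
    rw [nsq_add, h1, h2]; ring
  rw [this]
  have h := (((hasDerivAt_id (0 : ℝ)).const_mul (2 * x i)).const_add (nsq x)).add
    (hasDerivAt_pow 2 (0 : ℝ))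
  refine HasDerivAt.congr_deriv h ?_
  simp

theorem hasLineDerivAt_paraboloid_sq (R : ℝ) (x : Fin d → ℝ) (i : Fin d) :
    HasLineDerivAt ℝ (fun x => paraboloid R x ^ 2) (-(4 * x i * paraboloid R x)) x
      (Pi.single i 1) := by
  have h1 := (hasDerivAt_nsq_line x i).const_sub (R ^ 2)
  have h2 := hasDerivAt_max_sq (R ^ 2 - nsq (x + (0 : ℝ) • Pi.single i (1 : ℝ)))
  have h3 := h2.comp (0 : ℝ) h1
  refine HasDerivAt.congr_deriv h3 ?_
  simp only [zero_smul, add_zero, paraboloid]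
  ring

/-- Integration by parts against the square of the paraboloid. -/
theorem integral_paraboloid_mul_coord {R : ℝ} (hR : 0 ≤ R) {U : Set (Fin d → ℝ)} (hU : IsOpen U)
    (hKU : {x | enorm2 x ≤ R} ⊆ U) {h h' : (Fin d → ℝ) → ℝ} (i : Fin d)
    (hh : ContinuousOn h U) (hh' : ContinuousOn h' U)
    (hd : ∀ x ∈ U, HasLineDerivAt ℝ h (h' x) x (Pi.single i 1)) :
    ∫ x, paraboloid R x * (4 * x i * h x) = ∫ x, paraboloid R x * (paraboloid R x * h' x) := by
  have hw : ContinuousOn (paraboloid R : (Fin d → ℝ) → ℝ) U := (continuous_paraboloid R).continuousOn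
  have hx : ContinuousOn (fun x : Fin d → ℝ => x i) U := (continuous_apply i).continuousOn
  have key := integral_bilinear_hasLineDerivAt_right_eq_neg_left_of_integrable
    (μ := (volume : Measure (Fin d → ℝ))) (f := fun x => paraboloid R x ^ 2)
    (f' := fun x => -(4 * x i * paraboloid R x)) (g := h) (g' := h') (v := Pi.single i 1)
    (B := ContinuousLinearMap.mul ℝ ℝ) ?_ ?_ ?_
    (fun x _ => hasLineDerivAt_paraboloid_sq R x i)
    (fun x hx => hd x (hKU (by
      have := tsupport_mul_paraboloid_subset (d := d) hR (paraboloid R)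
      simp only [← pow_two] at this
      exact this hx)))
  · simp only [ContinuousLinearMap.mul_apply'] at key
    rw [← integral_neg] at key
    calc ∫ x, paraboloid R x * (4 * x i * h x)
        = ∫ x, -(-(4 * x i * paraboloid R x) * h x) := by congr 1; funext x; ring
      _ = ∫ x, paraboloid R x ^ 2 * h' x := key.symm
      _ = _ := by congr 1; funext x; ring
  · refine (integrable_paraboloid_mul hR hU hKU
      (((continuousOn_const (c := (-4 : ℝ))).mul hx).mul hh)).congr ?_
    exact Filter.Eventually.of_forall fun x => by
      simp only [ContinuousLinearMap.mul_apply', Pi.mul_apply]; ring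
  · refine (integrable_paraboloid_mul hR hU hKU (hw.mul hh')).congr ?_
    exact Filter.Eventually.of_forall fun x => by
      simp only [ContinuousLinearMap.mul_apply', Pi.mul_apply]; ring
  · refine (integrable_paraboloid_mul hR hU hKU (hw.mul hh)).congr ?_
    exact Filter.Eventually.of_forall fun x => by
      simp only [ContinuousLinearMap.mul_apply', Pi.mul_apply]; ring

/-- A function with first and second partial derivatives `u'` and `u''`, harmonic on `U`. -/
structure IsHarmonicOn (u : (Fin d → ℝ) → ℝ) (u' u'' : Fin d → (Fin d → ℝ) → ℝ)
    (U : Set (Fin d → ℝ)) : Prop where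
  hasFDerivAt : ∀ x ∈ U, HasFDerivAt u
    (∑ i, u' i x • ContinuousLinearMap.proj (R := ℝ) (φ := fun _ : Fin d => ℝ) i) x
  hasLineDerivAt : ∀ i, ∀ x ∈ U, HasLineDerivAt ℝ (u' i) (u'' i x) x (Pi.single i 1)
  continuousOn' : ∀ i, ContinuousOn (u' i) U
  continuousOn'' : ∀ i, ContinuousOn (u'' i) U
  sum_eq_zero : ∀ x ∈ U, ∑ i, u'' i x = 0

theorem IsHarmonicOn.continuousOn {u : (Fin d → ℝ) → ℝ} {u' u'' : Fin d → (Fin d → ℝ) → ℝ}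
    {U : Set (Fin d → ℝ)} (h : IsHarmonicOn u u' u'' U) : ContinuousOn u U := fun x hx =>
  (h.hasFDerivAt x hx).continuousAt.continuousWithinAt

theorem smul_mem_ball2 {ρ lam : ℝ} (h0 : 0 ≤ lam) (h1 : lam ≤ 1) {x : Fin d → ℝ}
    (hx : x ∈ ball2 d ρ) : lam • x ∈ ball2 d ρ := by
  change enorm2 (lam • x) < ρ
  rw [enorm2_smul, abs_of_nonneg h0]
  exact (mul_le_of_le_one_left (enorm2_nonneg x) h1).trans_lt hx

/-- The radial derivative of a harmonic function has weighted mean zero. -/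
theorem IsHarmonicOn.integral_radial_eq_zero {u : (Fin d → ℝ) → ℝ}
    {u' u'' : Fin d → (Fin d → ℝ) → ℝ} {ρ R : ℝ} (h : IsHarmonicOn u u' u'' (ball2 d ρ))
    (hR : 0 ≤ R) (hRρ : R < ρ) {lam : ℝ} (h0 : 0 ≤ lam) (h1 : lam ≤ 1) :
    ∫ x, paraboloid R x * (∑ i, x i * u' i (lam • x)) = 0 := by
  have hKU : {x : Fin d → ℝ | enorm2 x ≤ R} ⊆ ball2 d ρ := fun x hx => lt_of_le_of_lt hx hRρ
  have hmaps : Set.MapsTo (fun x : Fin d → ℝ => lam • x) (ball2 d ρ) (ball2 d ρ) :=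
    fun x hx => smul_mem_ball2 h0 h1 hx
  have hsm : ContinuousOn (fun x : Fin d → ℝ => lam • x) (ball2 d ρ) :=
    (continuous_const_smul lam).continuousOn
  have hc' : ∀ i, ContinuousOn (fun x => u' i (lam • x)) (ball2 d ρ) := fun i =>
    (h.continuousOn' i).comp hsm hmaps
  have hc'' : ∀ i, ContinuousOn (fun x => lam * u'' i (lam • x)) (ball2 d ρ) := fun i =>
    continuousOn_const.mul ((h.continuousOn'' i).comp hsm hmaps)
  have hld : ∀ i, ∀ x ∈ ball2 d ρ, HasLineDerivAt ℝ (fun x => u' i (lam • x))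
      (lam * u'' i (lam • x)) x (Pi.single i 1) := by
    intro i x hx
    have h2 : HasDerivAt (fun t : ℝ => u' i (lam • x + t • Pi.single i (1 : ℝ)))
        (u'' i (lam • x)) (lam * 0) := by
      rw [mul_zero]; exact h.hasLineDerivAt i (lam • x) (hmaps hx)
    have h3 := h2.comp (0 : ℝ) ((hasDerivAt_id (0 : ℝ)).const_mul lam)
    have h4 : HasDerivAt (fun t : ℝ => u' i (lam • (x + t • Pi.single i (1 : ℝ))))
        (u'' i (lam • x) * (lam * 1)) 0 := by
      refine h3.congr_of_eventuallyEq (Filter.Eventually.of_forall fun t => ?_)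
      simp [smul_add, smul_smul]
    refine HasDerivAt.congr_deriv h4 (by ring)
  have hibp := fun i => integral_paraboloid_mul_coord hR (isOpen_ball2 ρ) hKU i (hc' i) (hc'' i)
    (hld i)
  have hx : ∀ i : Fin d, ContinuousOn (fun x : Fin d → ℝ => x i) (ball2 d ρ) := fun i =>
    (continuous_apply i).continuousOn
  have hw : ContinuousOn (paraboloid R : (Fin d → ℝ) → ℝ) (ball2 d ρ) :=
    (continuous_paraboloid R).continuousOn
  -- With `w` the paraboloid, `∇(w²) = -4 w x`. Hence `4 ∫ w x·∇u(λx) = λ ∫ w² Δu(λx) = 0`.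
  have e1 : 4 * ∫ x, paraboloid R x * (∑ i, x i * u' i (lam • x)) =
      ∑ i, ∫ x, paraboloid R x * (4 * x i * u' i (lam • x)) := by
    rw [← integral_const_mul, ← integral_finsetSum]
    · congr 1; funext x
      simp only [Finset.mul_sum]
      exact Finset.sum_congr rfl fun i _ => by ring
    · intro i _
      exact integrable_paraboloid_mul hR (isOpen_ball2 ρ) hKU
        ((continuousOn_const.mul (hx i)).mul (hc' i))
  have e2 : ∑ i, ∫ x, paraboloid R x * (paraboloid R x * (lam * u'' i (lam • x))) = 0 := by
    rw [← integral_finsetSum]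
    · rw [← integral_zero (α := Fin d → ℝ) (μ := volume) (G := ℝ)]
      congr 1; funext x
      by_cases hxR : R ≤ enorm2 x
      · simp [paraboloid_eq_zero hR hxR]
      · have := h.sum_eq_zero (lam • x) (hmaps (lt_trans (not_le.1 hxR) hRρ))
        simp only [← Finset.mul_sum, this, mul_zero]
    · intro i _
      exact integrable_paraboloid_mul hR (isOpen_ball2 ρ) hKU (hw.mul (hc'' i))
  simp only [hibp] at e1
  rw [e2] at e1
  linarith

/-- Weighted mean value property. -/
theorem IsHarmonicOn.integral_paraboloid_mul {u : (Fin d → ℝ) → ℝ}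
    {u' u'' : Fin d → (Fin d → ℝ) → ℝ} {ρ R : ℝ} (h : IsHarmonicOn u u' u'' (ball2 d ρ))
    (hR : 0 ≤ R) (hRρ : R < ρ) :
    ∫ x, paraboloid R x * u x = u 0 * ∫ x : Fin d → ℝ, paraboloid R x := by
  set K := {x : Fin d → ℝ | enorm2 x ≤ R} with hK
  have hKU : K ⊆ ball2 d ρ := fun x hx => lt_of_le_of_lt hx hRρ
  have hKc : IsCompact K := isCompact_closedBall2 R
  have hsmK : ∀ lam : ℝ, 0 ≤ lam → lam ≤ 1 → ∀ x ∈ K, lam • x ∈ K := by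
    intro lam h0 h1 x hx
    change enorm2 (lam • x) ≤ R
    rw [enorm2_smul, abs_of_nonneg h0]
    exact (mul_le_of_le_one_left (enorm2_nonneg x) h1).trans hx
  have hmaps : ∀ lam : ℝ, 0 ≤ lam → lam ≤ 1 →
      Set.MapsTo (fun x : Fin d → ℝ => lam • x) (ball2 d ρ) (ball2 d ρ) :=
    fun lam h0 h1 x hx => smul_mem_ball2 h0 h1 hx
  have hsm : ∀ lam : ℝ, ContinuousOn (fun x : Fin d → ℝ => lam • x) (ball2 d ρ) := fun lam =>
    (continuous_const_smul lam).continuousOn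
  obtain ⟨M, hM⟩ := hKc.exists_bound_of_continuousOn (h.continuousOn.mono hKU)
  choose M' hM' using fun i => hKc.exists_bound_of_continuousOn ((h.continuousOn' i).mono hKU)
  have hcu : ∀ lam : ℝ, 0 ≤ lam → lam ≤ 1 → ContinuousOn (fun x => u (lam • x)) (ball2 d ρ) :=
    fun lam h0 h1 => h.continuousOn.comp (hsm lam) (hmaps lam h0 h1)
  have hcu' : ∀ lam : ℝ, 0 ≤ lam → lam ≤ 1 →
      ContinuousOn (fun x => ∑ i, x i * u' i (lam • x)) (ball2 d ρ) := fun lam h0 h1 =>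
    continuousOn_finsetSum _ fun i _ => (continuous_apply i).continuousOn.mul
      ((h.continuousOn' i).comp (hsm lam) (hmaps lam h0 h1))
  -- The weighted mean of `u(λx)` is constant in `λ`, its derivative being the radial integral just
  -- shown to vanish. Comparing `λ = 0` with `λ = 1` gives the mean value property.
  set F : ℝ → (Fin d → ℝ) → ℝ := fun lam x => paraboloid R x * u (lam • x) with hF
  set F' : ℝ → (Fin d → ℝ) → ℝ := fun lam x => paraboloid R x * (∑ i, x i * u' i (lam • x)) with hF'
  have hFint : ∀ lam : ℝ, 0 ≤ lam → lam ≤ 1 → Integrable (F lam) := fun lam h0 h1 =>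
    integrable_paraboloid_mul hR (isOpen_ball2 ρ) hKU (hcu lam h0 h1)
  have hF'int : ∀ lam : ℝ, 0 ≤ lam → lam ≤ 1 → Integrable (F' lam) := fun lam h0 h1 =>
    integrable_paraboloid_mul hR (isOpen_ball2 ρ) hKU (hcu' lam h0 h1)
  have hbd : Integrable fun x : Fin d → ℝ => paraboloid R x * M :=
    integrable_paraboloid_mul hR (isOpen_ball2 ρ) hKU continuousOn_const
  have hbd' : Integrable fun x : Fin d → ℝ => paraboloid R x * ∑ i, |x i| * M' i :=
    integrable_paraboloid_mul hR (isOpen_ball2 ρ) hKU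
      (by fun_prop)
  have hderx : ∀ x ∈ ball2 d ρ, ∀ lam : ℝ, 0 ≤ lam → lam ≤ 1 →
      HasDerivAt (fun lam : ℝ => u (lam • x)) (∑ i, x i * u' i (lam • x)) lam := by
    intro x hx lam h0 h1
    have e1 := h.hasFDerivAt (lam • x) (smul_mem_ball2 h0 h1 hx)
    have e2 : HasDerivAt (fun lam : ℝ => lam • x) ((1 : ℝ) • x) lam :=
      (hasDerivAt_id lam).smul_const x
    refine (e1.comp_hasDerivAt lam e2).congr_deriv ?_
    simp [mul_comm]
  have hcont : ContinuousOn (fun lam => ∫ x, F lam x) (Set.Icc 0 1) := by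
    refine continuousOn_of_dominated (bound := fun x => paraboloid R x * M)
      (fun lam hl => (hFint lam hl.1 hl.2).aestronglyMeasurable) (fun lam hl => ?_) hbd ?_
    · refine Filter.Eventually.of_forall fun x => ?_
      rw [norm_mul, Real.norm_of_nonneg (paraboloid_nonneg R x)]
      by_cases hx : x ∈ K
      · exact mul_le_mul_of_nonneg_left (hM _ (hsmK lam hl.1 hl.2 x hx)) (paraboloid_nonneg R x)
      · simp [paraboloid_eq_zero hR (not_le.1 hx).le]
    · refine Filter.Eventually.of_forall fun x => ?_
      by_cases hx : x ∈ K
      · exact continuousOn_const.mul fun lam hl =>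
          (hderx x (hKU hx) lam hl.1 hl.2).continuousAt.continuousWithinAt
      · simp only [hF, paraboloid_eq_zero hR (not_le.1 hx).le, zero_mul]
        exact continuousOn_const
  have hder : ∀ lam ∈ Set.Ioo (0 : ℝ) 1, HasDerivAt (fun lam => ∫ x, F lam x) 0 lam := by
    intro lam hl
    have e := hasDerivAt_integral_of_dominated_loc_of_deriv_le (μ := volume) (F := F) (F' := F')
      (x₀ := lam) (s := Set.Ioo 0 1) (bound := fun x => paraboloid R x * ∑ i, |x i| * M' i)
      (Ioo_mem_nhds hl.1 hl.2) ?_ (hFint lam hl.1.le hl.2.le)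
      (hF'int lam hl.1.le hl.2.le).aestronglyMeasurable ?_ hbd' ?_
    · refine e.2.congr_deriv ?_
      exact h.integral_radial_eq_zero hR hRρ hl.1.le hl.2.le
    · filter_upwards [Ioo_mem_nhds hl.1 hl.2] with a ha
      exact (hFint a ha.1.le ha.2.le).aestronglyMeasurable
    · refine Filter.Eventually.of_forall fun x a ha => ?_
      rw [norm_mul, Real.norm_of_nonneg (paraboloid_nonneg R x)]
      by_cases hx : x ∈ K
      · refine mul_le_mul_of_nonneg_left ?_ (paraboloid_nonneg R x)
        refine (norm_sum_le _ _).trans (Finset.sum_le_sum fun i _ => ?_)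
        rw [norm_mul, Real.norm_eq_abs]
        exact mul_le_mul_of_nonneg_left (hM' i _ (hsmK a ha.1.le ha.2.le x hx)) (abs_nonneg _)
      · simp [paraboloid_eq_zero hR (not_le.1 hx).le]
    · refine Filter.Eventually.of_forall fun x a ha => ?_
      by_cases hx : x ∈ K
      · exact (hderx x (hKU hx) a ha.1.le ha.2.le).const_mul _
      · simp only [hF, hF', paraboloid_eq_zero hR (not_le.1 hx).le, zero_mul]
        exact hasDerivAt_const _ _
  obtain ⟨c, -, hc⟩ := exists_hasDerivAt_eq_slope (fun lam => ∫ x, F lam x) (fun _ => 0)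
    zero_lt_one hcont hder
  simp only [hF, one_smul, zero_smul, sub_zero, div_one] at hc
  rw [integral_mul_const] at hc
  linarith

/-- Upper bound for the integral of a nonnegative harmonic function over a ball. -/
theorem IsHarmonicOn.setIntegral_ball_le {u : (Fin d → ℝ) → ℝ}
    {u' u'' : Fin d → (Fin d → ℝ) → ℝ} {ρ : ℝ} (h : IsHarmonicOn u u' u'' (ball2 d ρ))
    (hu : ∀ x ∈ ball2 d ρ, 0 ≤ u x) {r R : ℝ} (hr : 0 ≤ r) (hrR : r < R) (hRρ : R < ρ) :
    ∫ x in ball2 d r, u x ≤ u 0 * volume.real (ball2 d R) := by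
  have hR : 0 ≤ R := by linarith
  have hu0 : 0 ≤ u 0 := hu 0 (by
    change enorm2 (0 : Fin d → ℝ) < ρ
    simp only [enorm2, nsq, Pi.zero_apply]
    simp
    linarith)
  have h1 := h.integral_paraboloid_mul hR hRρ
  have h2 := h.integral_paraboloid_mul hr (hrR.trans hRρ)
  have hKR : {x : Fin d → ℝ | enorm2 x ≤ R} ⊆ ball2 d ρ := fun x hx => lt_of_le_of_lt hx hRρ
  have hKr : {x : Fin d → ℝ | enorm2 x ≤ r} ⊆ ball2 d ρ :=
    fun x hx => lt_of_le_of_lt hx (hrR.trans hRρ)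
  have i1 := integrable_paraboloid_mul hR (isOpen_ball2 ρ) hKR h.continuousOn
  have i2 := integrable_paraboloid_mul hr (isOpen_ball2 ρ) hKr h.continuousOn
  have j1 : Integrable (paraboloid R : (Fin d → ℝ) → ℝ) := by
    simpa using integrable_paraboloid_mul hR (isOpen_ball2 ρ) hKR
      (continuousOn_const (c := (1 : ℝ)))
  have j2 : Integrable (paraboloid r : (Fin d → ℝ) → ℝ) := by
    simpa using integrable_paraboloid_mul hr (isOpen_ball2 ρ) hKr
      (continuousOn_const (c := (1 : ℝ)))
  have hfin : volume (ball2 d R) ≠ ⊤ := by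
    refine ((isCompact_closedBall2 (d := d) R).measure_lt_top.trans_le' (measure_mono ?_)).ne
    intro x hx
    exact (show enorm2 x < R from hx).le
  have hsq : r ^ 2 ≤ R ^ 2 := pow_le_pow_left₀ hr hrR.le 2
  have hsq' : 0 < R ^ 2 - r ^ 2 := by nlinarith
  have hW1 : ∀ x : Fin d → ℝ, paraboloid r x ≤ paraboloid R x := fun x =>
    max_le_max (by linarith) le_rfl
  -- The difference of the paraboloids of radii `R` and `r` equals `R² - r²` on the small ball and
  -- lies between `0` and `R² - r²` on the large one. The weighted mean value property applied to
  -- both thus bounds the unweighted integral.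
  have hlower : (R ^ 2 - r ^ 2) * ∫ x in ball2 d r, u x ≤
      ∫ x, (paraboloid R x * u x - paraboloid r x * u x) := by
    rw [← integral_const_mul, ← integral_indicator (isOpen_ball2 r).measurableSet]
    have hu1 : ContinuousOn u {x : Fin d → ℝ | enorm2 x ≤ r} := h.continuousOn.mono hKr
    refine integral_mono ?_ (i1.sub i2) fun x => ?_
    · rw [integrable_indicator_iff (isOpen_ball2 r).measurableSet]
      refine (IntegrableOn.mono_set (hu1.integrableOn_compact (isCompact_closedBall2 r)) ?_).const_mul _
      intro x hx
      exact (show enorm2 x < r from hx).le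
    · by_cases hx : x ∈ ball2 d r
      · rw [Set.indicator_of_mem hx]
        have hn : nsq x ≤ r ^ 2 := (enorm2_le_iff hr x).1 (le_of_lt hx)
        simp only [paraboloid]
        rw [max_eq_left (by linarith), max_eq_left (by linarith)]
        exact le_of_eq (by ring)
      · rw [Set.indicator_of_notMem hx]
        by_cases hxR : R ≤ enorm2 x
        · simp [paraboloid_eq_zero hR hxR, paraboloid_eq_zero hr (hrR.le.trans hxR)]
        · have := hu x (lt_trans (not_le.1 hxR) hRρ)
          change 0 ≤ paraboloid R x * u x - paraboloid r x * u x
          rw [← sub_mul]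
          exact mul_nonneg (sub_nonneg.2 (hW1 x)) this
  have hupper : ∫ x : Fin d → ℝ, (paraboloid R x - paraboloid r x) ≤
      (R ^ 2 - r ^ 2) * volume.real (ball2 d R) := by
    have : (R ^ 2 - r ^ 2) * volume.real (ball2 d R) = ∫ x in ball2 d R, (R ^ 2 - r ^ 2) := by
      rw [setIntegral_const, smul_eq_mul, mul_comm]
    rw [this, ← integral_indicator (isOpen_ball2 R).measurableSet]
    refine integral_mono (j1.sub j2) ?_ fun x => ?_
    · rw [integrable_indicator_iff (isOpen_ball2 R).measurableSet]
      exact integrableOn_const hfin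
    · by_cases hx : x ∈ ball2 d R
      · rw [Set.indicator_of_mem hx]
        have hn : nsq x ≤ R ^ 2 := (enorm2_le_iff hR x).1 (le_of_lt hx)
        change max (R ^ 2 - nsq x) 0 - max (r ^ 2 - nsq x) 0 ≤ _
        rw [max_eq_left (by linarith)]
        linarith [le_max_left (r ^ 2 - nsq x) 0]
      · have hx' : R ≤ enorm2 x := not_lt.1 hx
        rw [Set.indicator_of_notMem hx]
        simp [paraboloid_eq_zero hR hx', paraboloid_eq_zero hr (hrR.le.trans hx')]
  rw [integral_sub i1 i2, h1, h2, ← mul_sub, ← integral_sub j1 j2] at hlower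
  have := mul_le_mul_of_nonneg_left hupper hu0
  have h3 : (R ^ 2 - r ^ 2) * ∫ x in ball2 d r, u x ≤
      (R ^ 2 - r ^ 2) * (u 0 * volume.real (ball2 d R)) := by linarith
  exact le_of_mul_le_mul_left h3 hsq'

theorem volume_ball2 (hd : 0 < d) {R : ℝ} (hR : 0 ≤ R) :
    volume.real (ball2 d R) = unitBallVolume d * R ^ d := by
  have : Nonempty (Fin d) := ⟨⟨0, hd⟩⟩
  have h1 : volume (ball2 d R) = volume (Metric.ball (0 : EuclideanSpace ℝ (Fin d)) R) := by
    rw [← (PiLp.volume_preserving_toLp (Fin d)).measure_preimage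
      Metric.isOpen_ball.measurableSet.nullMeasurableSet]
    congr 1
    ext x
    simp [ball2, enorm2, nsq, EuclideanSpace.norm_eq]
  rw [Measure.real, h1, Measure.addHaar_ball _ _ hR, finrank_euclideanSpace, Fintype.card_fin,
    ENNReal.toReal_mul, ENNReal.toReal_ofReal (by positivity), unitBallVolume, mul_comm]

theorem unitBallVolume_pos (d : ℕ) : 0 < unitBallVolume d :=
  ENNReal.toReal_pos (Metric.measure_ball_pos _ _ zero_lt_one).ne' measure_ball_lt_top.ne

end Sandpile

namespace Sandpile

open Finset MeasureTheory

variable {d : ℕ}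

/-! ### Harmonicity of the Poisson kernel -/

theorem hasLineDerivAt_normPow (β : ℝ) {y : Fin d → ℝ} (hy : 0 < nsq y) (i : Fin d) :
    HasLineDerivAt ℝ (normPow β) (-(2 * β) * (y i * normPow (β + 1) y)) y (Pi.single i 1) := by
  have h := (hasDerivAt_nsq_line y i).rpow_const (p := -β) (Or.inl (by simpa using hy.ne'))
  refine HasDerivAt.congr_deriv h ?_
  simp only [zero_smul, add_zero, normPow]
  rw [show -(β + 1) = -β - 1 by ring]
  ring

theorem hasLineDerivAt_apply (y : Fin d → ℝ) (i : Fin d) :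
    HasLineDerivAt ℝ (fun y : Fin d → ℝ => y i) 1 y (Pi.single i 1) := by
  have h : HasDerivAt (fun t : ℝ => y i + t) 1 0 := (hasDerivAt_id (0 : ℝ)).const_add (y i)
  refine h.congr_of_eventuallyEq (Filter.Eventually.of_forall fun t => ?_)
  simp

theorem hasLineDerivAt_dot (q y : Fin d → ℝ) (i : Fin d) :
    HasLineDerivAt ℝ (dot q) (q i) y (Pi.single i 1) := by
  have h : HasDerivAt (fun t : ℝ => dot q y + t * q i) (q i) 0 := by
    simpa using ((hasDerivAt_id (0 : ℝ)).mul_const (q i)).const_add (dot q y)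
  refine h.congr_of_eventuallyEq (Filter.Eventually.of_forall fun t => ?_)
  simp only [dot_add]
  congr 1
  simp [dot, Pi.single_apply, mul_comm]

theorem hasFDerivAt_nsq (y : Fin d → ℝ) : HasFDerivAt (nsq : (Fin d → ℝ) → ℝ)
    (∑ i, (2 * y i) • ContinuousLinearMap.proj (R := ℝ) (φ := fun _ : Fin d => ℝ) i) y := by
  unfold nsq
  refine HasFDerivAt.fun_sum fun i _ => ?_
  refine ((hasFDerivAt_apply i y).pow 2).congr_fderiv ?_
  simp

theorem hasFDerivAt_dot (q y : Fin d → ℝ) : HasFDerivAt (dot q)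
    (∑ i, q i • ContinuousLinearMap.proj (R := ℝ) (φ := fun _ : Fin d => ℝ) i) y := by
  unfold dot
  exact HasFDerivAt.fun_sum fun i _ => (hasFDerivAt_apply i y).const_mul (q i)

theorem hasFDerivAt_normPow (β : ℝ) {y : Fin d → ℝ} (hy : 0 < nsq y) :
    HasFDerivAt (normPow β) (∑ i, (-(2 * β) * (y i * normPow (β + 1) y)) •
      ContinuousLinearMap.proj (R := ℝ) (φ := fun _ : Fin d => ℝ) i) y := by
  have h := (hasFDerivAt_nsq y).rpow_const (p := -β) (Or.inl hy.ne')
  refine HasFDerivAt.congr_fderiv h ?_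
  rw [Finset.smul_sum]
  refine Finset.sum_congr rfl fun i _ => ?_
  rw [smul_smul, normPow, show -(β + 1) = -β - 1 by ring]
  congr 1
  ring

theorem continuousOn_normPow (β : ℝ) {U : Set (Fin d → ℝ)} (hU : ∀ y ∈ U, 0 < nsq y) :
    ContinuousOn (normPow β) U :=
  continuous_nsq.continuousOn.rpow_const fun y hy => Or.inl (hU y hy).ne'

theorem nsq_mul_normPow_add_one (β : ℝ) {y : Fin d → ℝ} (hy : 0 < nsq y) :
    nsq y * normPow (β + 1) y = normPow β y := by
  rw [normPow, normPow, show -(β + 1) = -β - 1 by ring, Real.rpow_sub hy, Real.rpow_one]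
  field_simp

theorem continuous_dot (q : Fin d → ℝ) : Continuous (dot q) := by
  unfold dot; fun_prop

/-- The partial derivatives of the Poisson kernel. -/
noncomputable def poissonKernel' (ρ : ℝ) (q : Fin d → ℝ) (i : Fin d) (y : Fin d → ℝ) : ℝ :=
  (d - 2) / ρ * (y i * normPow (d / 2) y) + (-2 * q i) * normPow (d / 2) y +
    2 * d * (dot q y * (y i * normPow (d / 2 + 1) y))

/-- The pure second partial derivatives of the Poisson kernel. -/
noncomputable def poissonKernel'' (ρ : ℝ) (q : Fin d → ℝ) (i : Fin d) (y : Fin d → ℝ) : ℝ :=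
  (d - 2) / ρ * (normPow (d / 2) y - d * (y i ^ 2 * normPow (d / 2 + 1) y)) +
    2 * d * (q i * (y i * normPow (d / 2 + 1) y)) +
    2 * d * (q i * (y i * normPow (d / 2 + 1) y) +
      dot q y * (normPow (d / 2 + 1) y - (d + 2) * (y i ^ 2 * normPow (d / 2 + 1 + 1) y)))

theorem hasFDerivAt_poissonKernel (ρ : ℝ) (q : Fin d → ℝ) {y : Fin d → ℝ} (hy : 0 < nsq y) :
    HasFDerivAt (poissonKernel ρ q) (∑ i, poissonKernel' ρ q i y •
      ContinuousLinearMap.proj (R := ℝ) (φ := fun _ : Fin d => ℝ) i) y := by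
  have h1 := hasFDerivAt_normPow (d / 2 - 1) hy
  have h2 := hasFDerivAt_normPow (d / 2) hy
  have h := (h1.const_mul (-(1 / ρ))).add (((hasFDerivAt_dot q y).mul h2).const_mul (-2))
  refine HasFDerivAt.congr_fderiv h ?_
  simp only [Finset.smul_sum, smul_add, smul_smul, ← Finset.sum_add_distrib]
  refine Finset.sum_congr rfl fun i _ => ?_
  rw [← add_smul, ← add_smul]
  congr 1
  simp only [poissonKernel', sub_add_cancel]
  ring

theorem hasLineDerivAt_poissonKernel' (ρ : ℝ) (q : Fin d → ℝ) {y : Fin d → ℝ} (hy : 0 < nsq y)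
    (i : Fin d) : HasLineDerivAt ℝ (poissonKernel' ρ q i) (poissonKernel'' ρ q i y) y
      (Pi.single i 1) := by
  have h1 : HasDerivAt _ _ _ := hasLineDerivAt_normPow (d / 2) hy i
  have h2 : HasDerivAt _ _ _ := hasLineDerivAt_normPow (d / 2 + 1) hy i
  have hx : HasDerivAt _ _ _ := hasLineDerivAt_apply y i
  have hq : HasDerivAt _ _ _ := hasLineDerivAt_dot q y i
  have h := (((hx.mul h1).const_mul ((d - 2) / ρ)).add (h1.const_mul (-2 * q i))).add
    ((hq.mul (hx.mul h2)).const_mul (2 * (d : ℝ)))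
  refine HasDerivAt.congr_deriv h ?_
  simp only [zero_smul, add_zero, poissonKernel'', Pi.mul_apply]
  ring

theorem sum_poissonKernel'' (ρ : ℝ) (q : Fin d → ℝ) {y : Fin d → ℝ} (hy : 0 < nsq y) :
    ∑ i, poissonKernel'' ρ q i y = 0 := by
  have e1 : ∑ i, y i ^ 2 * normPow (d / 2 + 1) y = normPow (d / 2) y := by
    rw [← Finset.sum_mul]; exact nsq_mul_normPow_add_one _ hy
  have e2 : ∑ i, y i ^ 2 * normPow (d / 2 + 1 + 1) y = normPow (d / 2 + 1) y := by
    rw [← Finset.sum_mul]; exact nsq_mul_normPow_add_one _ hy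
  have e3 : ∑ i, q i * (y i * normPow (d / 2 + 1) y) = dot q y * normPow (d / 2 + 1) y := by
    simp only [dot, ← mul_assoc, ← Finset.sum_mul]
  simp only [poissonKernel'', Finset.sum_add_distrib, ← Finset.mul_sum, Finset.sum_sub_distrib,
    e1, e2, e3, Finset.sum_const, Finset.card_univ, Fintype.card_fin, nsmul_eq_mul]
  ring

theorem nsq_sub_pos {ρ : ℝ} (hρ : 0 ≤ ρ) {q x : Fin d → ℝ} (hq : enorm2 q = 1)
    (hx : x ∈ ball2 d ρ) : 0 < nsq (x - ρ • q) := by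
  have h1 := enorm2_sub_le x (x - ρ • q)
  rw [sub_sub_cancel, enorm2_smul, hq, mul_one, abs_of_nonneg hρ] at h1
  have h2 : enorm2 x < ρ := hx
  have h3 : 0 < enorm2 (x - ρ • q) := by linarith
  rw [← enorm2_sq]
  positivity

theorem isHarmonicOn_poissonKernel {ρ : ℝ} (hρ : 0 ≤ ρ) {q : Fin d → ℝ} (hq : enorm2 q = 1) :
    IsHarmonicOn (fun x => poissonKernel ρ q (x - ρ • q))
      (fun i x => poissonKernel' ρ q i (x - ρ • q))
      (fun i x => poissonKernel'' ρ q i (x - ρ • q)) (ball2 d ρ) := by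
  have hpos : ∀ x ∈ ball2 d ρ, 0 < nsq (x - ρ • q) := fun x hx => nsq_sub_pos hρ hq hx
  have hmaps : Set.MapsTo (fun x => x - ρ • q) (ball2 d ρ) {y | 0 < nsq y} := hpos
  have hsub : ContinuousOn (fun x : Fin d → ℝ => x - ρ • q) (ball2 d ρ) :=
    (continuous_id.sub continuous_const).continuousOn
  have hN : ∀ β : ℝ, ContinuousOn (normPow β) {y : Fin d → ℝ | 0 < nsq y} := fun β =>
    continuousOn_normPow β fun y hy => hy
  have hi : ∀ i : Fin d, ContinuousOn (fun y : Fin d → ℝ => y i) {y | 0 < nsq y} := fun i =>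
    (continuous_apply i).continuousOn
  have hdot : ContinuousOn (dot q) {y : Fin d → ℝ | 0 < nsq y} := (continuous_dot q).continuousOn
  refine ⟨fun x hx => ?_, fun i x hx => ?_, fun i => ?_, fun i => ?_, fun x hx => ?_⟩
  · have h := (hasFDerivAt_poissonKernel ρ q (hpos x hx)).comp x
      ((hasFDerivAt_id x).sub_const (ρ • q))
    exact HasFDerivAt.congr_fderiv h (ContinuousLinearMap.comp_id _)
  · have h : HasDerivAt _ _ _ := hasLineDerivAt_poissonKernel' ρ q (hpos x hx) i
    refine h.congr_of_eventuallyEq (Filter.Eventually.of_forall fun t => ?_)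
    simp only [add_sub_right_comm]
  · refine ContinuousOn.comp (t := {y | 0 < nsq y}) (g := poissonKernel' ρ q i) ?_ hsub hmaps
    exact ((continuousOn_const.mul ((hi i).mul (hN _))).add (continuousOn_const.mul (hN _))).add
      (continuousOn_const.mul (hdot.mul ((hi i).mul (hN _))))
  · refine ContinuousOn.comp (t := {y | 0 < nsq y}) (g := poissonKernel'' ρ q i) ?_ hsub hmaps
    exact ((continuousOn_const.mul ((hN _).sub
      (continuousOn_const.mul (((hi i).pow 2).mul (hN _))))).add
      (continuousOn_const.mul (continuousOn_const.mul ((hi i).mul (hN _))))).add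
      (continuousOn_const.mul ((continuousOn_const.mul ((hi i).mul (hN _))).add
        (hdot.mul ((hN _).sub (continuousOn_const.mul (((hi i).pow 2).mul (hN _)))))))
  · exact sum_poissonKernel'' ρ q (hpos x hx)

theorem poissonKernel_sub_eq {ρ : ℝ} (hρ : 0 < ρ) {q x : Fin d → ℝ} (hq : enorm2 q = 1)
    (hx : 0 < enorm2 (x - ρ • q)) :
    poissonKernel ρ q (x - ρ • q) =
      normPow (d / 2) (x - ρ • q) * ((ρ ^ 2 - enorm2 x ^ 2) / ρ) := by
  rw [poissonKernel_eq hρ.ne' hq hx, sub_add_cancel, enorm2_sq]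

/-- The value at the centre is `ρ^(1-d)` and the volume is at most `ω ρ^d`. Smaller balls are used
to stay away from the pole on the sphere. -/
theorem setIntegral_poissonKernel_le (hd : 0 < d) {ρ r : ℝ} (hr : 0 ≤ r) (hrρ : r < ρ)
    {q : Fin d → ℝ} (hq : enorm2 q = 1) :
    ∫ x in ball2 d r, poissonKernel ρ q (x - ρ • q) ≤ unitBallVolume d * ρ := by
  have hρ : 0 < ρ := by linarith
  obtain ⟨R, hrR, hRρ⟩ := exists_between hrρ
  have h := (isHarmonicOn_poissonKernel hρ.le hq).setIntegral_ball_le (fun x hx => ?_) hr hrR hRρ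
  · refine h.trans ?_
    have hnorm : enorm2 ((0 : Fin d → ℝ) - ρ • q) = ρ := by
      rw [zero_sub, enorm2_neg, enorm2_smul, hq, mul_one, abs_of_pos hρ]
    have h0 : enorm2 (0 : Fin d → ℝ) = 0 := by simp [enorm2, nsq]
    rw [volume_ball2 hd (by linarith), poissonKernel_sub_eq hρ hq (by rw [hnorm]; exact hρ),
      normPow_half, hnorm, h0]
    have hRd : R ^ d ≤ ρ ^ d := pow_le_pow_left₀ (by linarith) hRρ.le d
    have hω := unitBallVolume_pos d
    calc (ρ ^ d)⁻¹ * ((ρ ^ 2 - 0 ^ 2) / ρ) * (unitBallVolume d * R ^ d)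
        ≤ (ρ ^ d)⁻¹ * ((ρ ^ 2 - 0 ^ 2) / ρ) * (unitBallVolume d * ρ ^ d) := by
          have : 0 ≤ (ρ ^ d)⁻¹ * ((ρ ^ 2 - 0 ^ 2) / ρ) := by
            rw [zero_pow two_ne_zero, sub_zero]; positivity
          gcongr
      _ = unitBallVolume d * ρ := by
          field_simp
          ring
  · have hpos : 0 < enorm2 (x - ρ • q) := Real.sqrt_pos.2 (nsq_sub_pos hρ.le hq hx)
    rw [poissonKernel_sub_eq hρ hq hpos]
    have hx' : enorm2 x < ρ := hx
    have : enorm2 x ^ 2 ≤ ρ ^ 2 := pow_le_pow_left₀ (enorm2_nonneg x) hx'.le 2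
    exact mul_nonneg (normPow_nonneg _ _) (div_nonneg (by linarith) hρ.le)

/-! ### Summation over the lattice -/

/-- The exponent `d + 1` exceeds the rank of the lattice. This sum absorbs both the midpoint error
and the correction term in `subPoisson`. -/
theorem exists_sum_enorm2_pow_le (d : ℕ) :
    ∃ C : ℝ, 0 ≤ C ∧ ∀ F : Finset (Site d), (∀ y ∈ F, y ≠ 0) →
      ∑ y ∈ F, (enorm2 (toR y) ^ (d + 1))⁻¹ ≤ C := by
  set L := Submodule.span ℤ (Set.range (Pi.basisFun ℝ (Fin d))) with hL
  have hfin : Module.finrank ℤ L < d + 1 := by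
    rw [ZLattice.rank ℝ L]; simp
  have hs := ZLattice.summable_norm_pow_inv L (d + 1) hfin
  have hmem : ∀ y : Site d, toR y ∈ L := by
    intro y
    rw [hL, Module.Basis.mem_span_iff_repr_mem]
    intro i
    exact ⟨y i, by simp [toR]⟩
  set φ : Site d → L := fun y => ⟨toR y, hmem y⟩ with hφ
  have hinj : Function.Injective φ := by
    intro x y h
    have : toR x = toR y := congrArg Subtype.val h
    ext i
    simpa [toR] using congrFun this i
  have hs' := hs.comp_injective hinj
  refine ⟨∑' y, ((fun z : L => ‖z‖⁻¹ ^ (d + 1)) ∘ φ) y, tsum_nonneg fun y => by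
    simp only [Function.comp]; positivity, fun F hF => ?_⟩
  refine le_trans (Finset.sum_le_sum fun y hy => ?_) (hs'.sum_le_tsum F fun y _ => by
    simp only [Function.comp]; positivity)
  have hpos : 0 < ‖toR y‖ := by
    rw [norm_pos_iff]
    intro h
    apply hF y hy
    ext i
    have := congrFun h i
    simpa [toR] using this
  change _ ≤ ‖toR y‖⁻¹ ^ (d + 1)
  rw [inv_pow]
  gcongr
  exact norm_le_enorm2 _

end Sandpile

/-! ### Unit cubes and the lattice sum of the Poisson kernel. -/

namespace Sandpile

open Finset MeasureTheory

variable {d : ℕ}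

/-- The open unit cube centred at the origin. -/
def unitCube (d : ℕ) : Set (Fin d → ℝ) := Set.pi Set.univ fun _ => Set.Ioo (-(1 / 2)) (1 / 2)

theorem isOpen_unitCube : IsOpen (unitCube d) :=
  isOpen_set_pi Set.finite_univ fun _ _ => isOpen_Ioo

theorem volume_unitCube : volume (unitCube d) = 1 := by
  rw [unitCube, Real.volume_pi_Ioo]
  norm_num

theorem mem_unitCube {t : Fin d → ℝ} : t ∈ unitCube d ↔ ∀ i, |t i| < 1 / 2 := by
  simp only [unitCube, Set.mem_pi, Set.mem_univ, true_imp_iff, Set.mem_Ioo, abs_lt]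

theorem neg_mem_unitCube {t : Fin d → ℝ} : -t ∈ unitCube d ↔ t ∈ unitCube d := by
  simp [mem_unitCube]

theorem enorm2_le_of_mem_unitCube {t : Fin d → ℝ} (ht : t ∈ unitCube d) : enorm2 t ≤ d := by
  rw [enorm2_le_iff (Nat.cast_nonneg d)]
  have h1 : nsq t ≤ ∑ _i : Fin d, (1 : ℝ) := by
    refine Finset.sum_le_sum fun i _ => ?_
    have := mem_unitCube.1 ht i
    rw [← sq_abs]
    have := abs_nonneg (t i)
    nlinarith
  have h2 : (d : ℝ) ≤ (d : ℝ) ^ 2 := by exact_mod_cast Nat.le_self_pow two_ne_zero d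
  refine h1.trans ?_
  simpa using h2

/-- The unit cube centred at a lattice site. -/
def cubeAt (x : Site d) : Set (Fin d → ℝ) := {w | w - toR x ∈ unitCube d}

theorem isOpen_cubeAt (x : Site d) : IsOpen (cubeAt x) :=
  isOpen_unitCube.preimage (continuous_id.sub continuous_const)

theorem disjoint_cubeAt {x y : Site d} (h : x ≠ y) : Disjoint (cubeAt x) (cubeAt y) := by
  rw [Set.disjoint_left]
  intro w hx hy
  apply h
  ext i
  have h1 := abs_lt.1 (mem_unitCube.1 hx i)
  have h2 := abs_lt.1 (mem_unitCube.1 hy i)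
  simp only [Pi.sub_apply, toR] at h1 h2
  have h3 : (x i : ℝ) < y i + 1 := by linarith
  have h4 : (y i : ℝ) < x i + 1 := by linarith
  have h3' : x i < y i + 1 := by exact_mod_cast h3
  have h4' : y i < x i + 1 := by exact_mod_cast h4
  omega

theorem volume_cubeAt (x : Site d) : volume (cubeAt x) = 1 := by
  have : cubeAt x = (fun w => w + -toR x) ⁻¹' unitCube d := by
    ext w; simp [cubeAt, sub_eq_add_neg]
  rw [this, measure_preimage_add_right, volume_unitCube]

theorem setIntegral_cubeAt (f : (Fin d → ℝ) → ℝ) (x : Site d) :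
    ∫ w in cubeAt x, f w = ∫ t in unitCube d, f (toR x + t) := by
  rw [← integral_indicator (isOpen_cubeAt x).measurableSet,
    ← integral_indicator isOpen_unitCube.measurableSet,
    ← integral_add_left_eq_self _ (toR x)]
  congr 1
  funext t
  by_cases ht : t ∈ unitCube d
  · rw [Set.indicator_of_mem ht, Set.indicator_of_mem]
    simpa [cubeAt] using ht
  · rw [Set.indicator_of_notMem ht, Set.indicator_of_notMem]
    simpa [cubeAt] using ht

theorem setIntegral_unitCube_neg (f : (Fin d → ℝ) → ℝ) :
    ∫ t in unitCube d, f (-t) = ∫ t in unitCube d, f t := by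
  rw [← integral_indicator isOpen_unitCube.measurableSet,
    ← integral_indicator isOpen_unitCube.measurableSet, ← integral_neg_eq_self]
  congr 1
  funext t
  by_cases ht : t ∈ unitCube d
  · rw [Set.indicator_of_mem (neg_mem_unitCube.2 ht), Set.indicator_of_mem ht, neg_neg]
  · rw [Set.indicator_of_notMem (fun h => ht (neg_mem_unitCube.1 h)), Set.indicator_of_notMem ht]

theorem integrableOn_unitCube {f : (Fin d → ℝ) → ℝ} {x : Site d}
    (hf : IntegrableOn f (cubeAt x)) : IntegrableOn (fun t => f (toR x + t)) (unitCube d) := by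
  rw [← integrable_indicator_iff isOpen_unitCube.measurableSet]
  rw [← integrable_indicator_iff (isOpen_cubeAt x).measurableSet] at hf
  refine (hf.comp_add_left (toR x)).congr (Filter.Eventually.of_forall fun t => ?_)
  beta_reduce
  by_cases ht : t ∈ unitCube d
  · rw [Set.indicator_of_mem ht, Set.indicator_of_mem]
    simpa [cubeAt] using ht
  · rw [Set.indicator_of_notMem ht, Set.indicator_of_notMem]
    simpa [cubeAt] using ht

/-- Midpoint rule: a lower bound for symmetric second differences gives an upper bound for the
value at the centre of the cube. -/
theorem le_setIntegral_cubeAt {f : (Fin d → ℝ) → ℝ} {x : Site d} {c : ℝ}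
    (hf : IntegrableOn f (cubeAt x))
    (h : ∀ t ∈ unitCube d, 2 * c ≤ f (toR x + t) + f (toR x - t)) :
    c ≤ ∫ w in cubeAt x, f w := by
  rw [setIntegral_cubeAt]
  have h1 := integrableOn_unitCube hf
  have h2 : IntegrableOn (fun t => f (toR x - t)) (unitCube d) := by
    rw [← integrable_indicator_iff isOpen_unitCube.measurableSet] at h1 ⊢
    refine h1.comp_neg.congr (Filter.Eventually.of_forall fun t => ?_)
    beta_reduce
    by_cases ht : t ∈ unitCube d
    · rw [Set.indicator_of_mem (neg_mem_unitCube.2 ht), Set.indicator_of_mem ht, sub_eq_add_neg]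
    · rw [Set.indicator_of_notMem (fun h => ht (neg_mem_unitCube.1 h)),
        Set.indicator_of_notMem ht]
  have h3 : ∫ t in unitCube d, f (toR x - t) = ∫ t in unitCube d, f (toR x + t) := by
    rw [← setIntegral_unitCube_neg]
    simp [sub_eq_add_neg]
  have h4 : ∫ _t in unitCube d, 2 * c ≤
      ∫ t in unitCube d, (f (toR x + t) + f (toR x - t)) := by
    refine setIntegral_mono_on (integrableOn_const (by rw [volume_unitCube]; simp)) (h1.add h2)
      isOpen_unitCube.measurableSet h
  rw [integral_add h1 h2, h3, setIntegral_const, Measure.real, volume_unitCube] at h4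
  simp at h4
  linarith

/-- The sum of the Poisson kernel over the lattice points of the ball, away from the pole. -/
theorem exists_sum_poissonKernel_le (hd : 2 ≤ d) :
    ∃ C : ℝ, 0 ≤ C ∧ ∀ (ρ : ℝ) (q : Fin d → ℝ) (z : Site d) (F : Finset (Site d)), 0 < ρ →
      enorm2 q = 1 → toR z = ρ • q →
      (∀ x ∈ F, enorm2 (toR x) < ρ ∧ 6 * (d : ℝ) ≤ enorm2 (toR x - toR z)) →
      ∑ x ∈ F, poissonKernel ρ q (toR x - toR z) ≤ unitBallVolume d * ρ + C := by
  have hd' : (2 : ℝ) ≤ d := by exact_mod_cast hd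
  obtain ⟨C₁, hC₁, h₁⟩ := exists_secDiff_poissonKernel_ge hd (B := d) (by linarith)
  obtain ⟨C₂, hC₂, h₂⟩ := exists_sum_enorm2_pow_le d
  refine ⟨C₁ * C₂, by positivity, fun ρ q z F hρ hq hz hF => ?_⟩
  -- Cubes centred in the ball may stick out of it, where the kernel is nonpositive. The positive
  -- part vanishes there and still dominates the kernel in the midpoint rule.
  set u : (Fin d → ℝ) → ℝ := fun w => max (poissonKernel ρ q (w - toR z)) 0 with hu
  set V : Set (Fin d → ℝ) := ⋃ x ∈ F, cubeAt x with hV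
  have hVm : MeasurableSet V :=
    Finset.measurableSet_biUnion F fun x _ => (isOpen_cubeAt x).measurableSet
  have hfar : ∀ w ∈ V, 1 ≤ enorm2 (w - toR z) := by
    intro w hw
    obtain ⟨x, hx, hwx⟩ := Set.mem_iUnion₂.1 hw
    have h1 := enorm2_le_of_mem_unitCube hwx
    have h2 := enorm2_sub_le (w - toR z) (w - toR x)
    rw [sub_sub_sub_cancel_left] at h2
    have := (hF x hx).2
    linarith
  set G : Set (Fin d → ℝ) := {w | 1 ≤ enorm2 (w - toR z)} with hG
  have hcont : ContinuousOn u G := by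
    have hpos : ∀ w ∈ G, 0 < nsq (w - toR z) := by
      intro w hw
      rw [← enorm2_sq]
      have : (1 : ℝ) ≤ enorm2 (w - toR z) := hw
      positivity
    have hN : ∀ β : ℝ, ContinuousOn (fun w => normPow β (w - toR z)) G := fun β =>
      ContinuousOn.comp (t := {y | 0 < nsq y}) (continuousOn_normPow β fun y hy => hy)
        (continuous_id.sub continuous_const).continuousOn hpos
    have hdot : ContinuousOn (fun w => dot q (w - toR z)) G :=
      ((continuous_dot q).comp (continuous_id.sub continuous_const)).continuousOn
    have hP : ContinuousOn (fun w => poissonKernel ρ q (w - toR z)) G :=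
      (continuousOn_const.mul (hN _)).add (continuousOn_const.mul (hdot.mul (hN _)))
    exact hP.sup continuousOn_const
  have hGcl : IsClosed G :=
    isClosed_le continuous_const (continuous_enorm2.comp (continuous_id.sub continuous_const))
  have hbig : ∀ S : ℝ, IntegrableOn u (G ∩ {w | enorm2 w ≤ S}) := fun S =>
    (hcont.mono Set.inter_subset_left).integrableOn_compact
      ((isCompact_closedBall2 S).inter_left hGcl)
  have hVint : IntegrableOn u V := by
    refine (hbig (ρ + d)).mono_set fun w hw => ⟨hfar w hw, ?_⟩
    obtain ⟨x, hx, hwx⟩ := Set.mem_iUnion₂.1 hw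
    have h1 := enorm2_le_of_mem_unitCube hwx
    have h2 := enorm2_add_le (toR x) (w - toR x)
    rw [add_sub_cancel] at h2
    have := (hF x hx).1
    change enorm2 w ≤ ρ + d
    linarith
  have hzero : ∀ w ∈ G, ρ ≤ enorm2 w → u w = 0 := by
    intro w hw hρw
    have hpos : 0 < enorm2 (w - ρ • q) := by
      have : 1 ≤ enorm2 (w - toR z) := hw
      rw [hz] at this
      linarith
    simp only [hu]
    rw [hz, poissonKernel_sub_eq hρ hq hpos]
    refine max_eq_right (mul_nonpos_of_nonneg_of_nonpos (normPow_nonneg _ _) ?_)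
    have := pow_le_pow_left₀ hρ.le hρw 2
    exact div_nonpos_of_nonpos_of_nonneg (by linarith) hρ.le
  have hball : ∀ r, 0 ≤ r → r < ρ → ∫ w in V ∩ ball2 d r, u w ≤ unitBallVolume d * ρ := by
    intro r hr hrρ
    refine le_trans ?_ (setIntegral_poissonKernel_le (by omega) hr hrρ hq)
    have hint : IntegrableOn (fun x => poissonKernel ρ q (x - ρ • q)) (ball2 d r) := by
      refine IntegrableOn.mono_set (t := {x : Fin d → ℝ | enorm2 x ≤ r})
        (((isHarmonicOn_poissonKernel hρ.le hq).continuousOn.mono ?_).integrableOn_compact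
        (isCompact_closedBall2 r)) ?_
      · intro x hx
        exact lt_of_le_of_lt hx hrρ
      · intro x hx
        exact (show enorm2 x < r from hx).le
    have hnn : ∀ x ∈ ball2 d r, 0 ≤ poissonKernel ρ q (x - ρ • q) := by
      intro x hx
      have hx' : enorm2 x < r := hx
      have hpos : 0 < enorm2 (x - ρ • q) :=
        Real.sqrt_pos.2 (nsq_sub_pos hρ.le hq (hx'.trans hrρ))
      rw [poissonKernel_sub_eq hρ hq hpos]
      have : enorm2 x ^ 2 ≤ ρ ^ 2 := pow_le_pow_left₀ (enorm2_nonneg x) (hx'.trans hrρ).le 2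
      exact mul_nonneg (normPow_nonneg _ _) (div_nonneg (by linarith) hρ.le)
    have heq : ∫ w in V ∩ ball2 d r, u w =
        ∫ w in V ∩ ball2 d r, poissonKernel ρ q (w - ρ • q) := by
      refine setIntegral_congr_fun (hVm.inter (isOpen_ball2 r).measurableSet) fun w hw => ?_
      simp only [hu]
      rw [hz]
      exact max_eq_left (hnn w hw.2)
    rw [heq]
    refine setIntegral_mono_set hint ?_ (Filter.Eventually.of_forall Set.inter_subset_right)
    filter_upwards [ae_restrict_mem (isOpen_ball2 r).measurableSet] with x hx
    exact hnn x hx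
  -- The bound is available for radii below `ρ` only; exhaust the open ball by radii `ρ (1 -
  -- 1/(k+1))`.
  have hVle : ∫ w in V, u w ≤ unitBallVolume d * ρ := by
    set r : ℕ → ℝ := fun k => ρ * (1 - 1 / ((k : ℝ) + 1)) with hr
    have hk1 : ∀ k : ℕ, 1 / ((k : ℝ) + 1) ≤ 1 := fun k => by
      rw [div_le_one (by positivity)]
      linarith [Nat.cast_nonneg (α := ℝ) k]
    have hr0 : ∀ k, 0 ≤ r k := fun k => mul_nonneg hρ.le (by linarith [hk1 k])
    have hrρ : ∀ k, r k < ρ := fun k => by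
      have : 0 < 1 / ((k : ℝ) + 1) := by positivity
      simp only [hr]
      nlinarith
    have hmono : Monotone fun k => V ∩ ball2 d (r k) := by
      intro k m hkm
      refine Set.inter_subset_inter_right _ fun x hx => ?_
      have hx' : enorm2 x < r k := hx
      refine hx'.trans_le (mul_le_mul_of_nonneg_left ?_ hρ.le)
      have : 1 / ((m : ℝ) + 1) ≤ 1 / ((k : ℝ) + 1) := by
        have : (k : ℝ) ≤ m := by exact_mod_cast hkm
        gcongr
      linarith
    have hunion : ⋃ k, V ∩ ball2 d (r k) = V ∩ ball2 d ρ := by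
      rw [← Set.inter_iUnion]
      congr 1
      ext x
      simp only [Set.mem_iUnion]
      constructor
      · rintro ⟨k, hk⟩
        exact lt_trans hk (hrρ k)
      · intro hx
        have hx' : enorm2 x < ρ := hx
        obtain ⟨k, hk⟩ := exists_nat_one_div_lt (show 0 < (ρ - enorm2 x) / ρ from
          div_pos (by linarith) hρ)
        refine ⟨k, ?_⟩
        rw [lt_div_iff₀ hρ] at hk
        change enorm2 x < ρ * (1 - 1 / ((k : ℝ) + 1))
        linarith
    have htend := tendsto_setIntegral_of_monotone (f := u) (μ := volume)
      (fun k => hVm.inter (isOpen_ball2 (r k)).measurableSet) hmono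
      (hVint.mono_set (by rw [hunion]; exact Set.inter_subset_left))
    rw [hunion] at htend
    have hle := le_of_tendsto' htend fun k => hball (r k) (hr0 k) (hrρ k)
    refine le_trans (le_of_eq ?_) hle
    refine setIntegral_eq_of_subset_of_forall_sdiff_eq_zero hVm Set.inter_subset_left ?_
    intro w hw
    refine hzero w (hfar w hw.1) (not_lt.1 fun h => hw.2 ⟨hw.1, h⟩)
  have hsumcube : ∑ x ∈ F, ∫ w in cubeAt x, u w = ∫ w in V, u w := by
    rw [hV, integral_biUnion_finset]
    · intro x _
      exact (isOpen_cubeAt x).measurableSet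
    · intro x _ y _ hxy
      exact disjoint_cubeAt hxy
    · intro x hx
      exact hVint.mono_set (Set.subset_biUnion_of_mem (u := cubeAt) hx)
  have hpt : ∀ x ∈ F, poissonKernel ρ q (toR x - toR z) ≤ (∫ w in cubeAt x, u w) +
      C₁ * (enorm2 (toR (x - z)) ^ (d + 1))⁻¹ := by
    intro x hx
    have hxF := hF x hx
    have hs : 0 < enorm2 (toR x - toR z) := by linarith
    have hs3 : enorm2 (toR x - toR z) ≤ 3 * ρ := by
      have h1 := enorm2_sub_le (toR x) (toR z)
      have h2 : enorm2 (toR z) = ρ := by rw [hz, enorm2_smul, hq, mul_one, abs_of_pos hρ]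
      linarith
    have hNs : normPow (d / 2) (toR x - toR z) / enorm2 (toR x - toR z) =
        (enorm2 (toR (x - z)) ^ (d + 1))⁻¹ := by
      rw [toR_sub, normPow_half, pow_succ, mul_inv, div_eq_mul_inv]
    have hcube := le_setIntegral_cubeAt (f := u) (x := x)
      (c := poissonKernel ρ q (toR x - toR z) - C₁ * (enorm2 (toR (x - z)) ^ (d + 1))⁻¹)
      (hVint.mono_set (Set.subset_biUnion_of_mem (u := cubeAt) hx)) (by
        intro t ht
        have h3 := h₁ ρ q (toR x - toR z) t hq.le hxF.2 hs3 (enorm2_le_of_mem_unitCube ht)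
        rw [hNs, secDiff] at h3
        have h4 : poissonKernel ρ q (toR x - toR z + t) ≤ u (toR x + t) := by
          rw [sub_add_eq_add_sub]; exact le_max_left _ _
        have h5 : poissonKernel ρ q (toR x - toR z - t) ≤ u (toR x - t) := by
          rw [sub_right_comm]; exact le_max_left _ _
        have h6 : 0 ≤ C₁ * (enorm2 (toR (x - z)) ^ (d + 1))⁻¹ := by
          have := enorm2_nonneg (toR (x - z))
          positivity
        linarith)
    linarith
  refine (Finset.sum_le_sum hpt).trans ?_
  rw [Finset.sum_add_distrib, hsumcube, ← Finset.mul_sum]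
  refine add_le_add hVle (mul_le_mul_of_nonneg_left ?_ hC₁)
  have h6 := h₂ (F.image fun x => x - z) (by
    intro y hy h0
    obtain ⟨x, hx, rfl⟩ := Finset.mem_image.1 hy
    have h7 := (hF x hx).2
    rw [← toR_sub, h0] at h7
    have : enorm2 (toR (0 : Site d)) = 0 := by simp [enorm2, nsq, toR]
    linarith)
  rw [Finset.sum_image fun x _ y _ h => by simpa using h] at h6
  exact h6

end Sandpile

namespace Sandpile

open Finset

variable {d : ℕ}

/-! ### The inner bound -/

theorem finite_enorm2_le (d : ℕ) (r : ℝ) : {x : Site d | enorm2 (toR x) ≤ r}.Finite := by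
  refine (Set.finite_Icc (fun _ => -⌈r⌉ : Site d) (fun _ => ⌈r⌉)).subset fun x hx => ?_
  have h : ∀ i, |(x i : ℝ)| ≤ ⌈r⌉ := fun i =>
    (abs_apply_le_enorm2 (toR x) i).trans (le_trans hx (Int.le_ceil r))
  constructor <;> intro i <;> have := abs_le.1 (h i)
  · exact_mod_cast this.1
  · exact_mod_cast this.2

theorem l1_le_mul_enorm2 (x : Site d) : (l1 x : ℝ) ≤ d * enorm2 (toR x) := by
  have h : (l1 x : ℝ) ≤ ∑ _i : Fin d, enorm2 (toR x) := by
    unfold l1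
    push_cast
    refine Finset.sum_le_sum fun i _ => ?_
    have := abs_apply_le_enorm2 (toR x) i
    rw [Nat.cast_natAbs]
    push_cast
    exact this
  simpa using h

theorem enorm2_le_l1 (x : Site d) : enorm2 (toR x) ≤ l1 x := by
  rw [enorm2_le_iff (Nat.cast_nonneg _)]
  have h : ∑ i, (x i).natAbs ^ 2 ≤ (∑ i, (x i).natAbs) ^ 2 :=
    Finset.sum_sq_le_sq_sum_of_nonneg fun _ _ => Nat.zero_le _
  have h2 : nsq (toR x) = ((∑ i, (x i).natAbs ^ 2 : ℕ) : ℝ) := by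
    push_cast
    refine Finset.sum_congr rfl fun i _ => ?_
    rw [Nat.cast_natAbs]
    push_cast
    rw [sq_abs]
    rfl
  rw [h2]
  exact_mod_cast h

theorem enorm2_toR_sub_of_adj {x y : Site d} (h : Adj x y) : enorm2 (toR x - toR y) ≤ 1 := by
  have := enorm2_le_l1 (x - y)
  rw [l1_sub_of_adj h, toR_sub] at this
  simpa using this

theorem enorm2_toR_le_of_adj {x y : Site d} (z : Fin d → ℝ) (h : Adj x y) :
    enorm2 (toR y - z) ≤ enorm2 (toR x - z) + 1 := by
  have h1 := enorm2_toR_sub_of_adj h.symm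
  have h2 := enorm2_add_le (toR y - toR x) (toR x - z)
  rw [sub_add_sub_cancel] at h2
  linarith

/-- A crude bound, needed only in the thin shell around the pole where the test function is cut off.
-/
theorem poissonKernel_le {ρ : ℝ} {q y : Fin d → ℝ} (hρ : 1 ≤ ρ) (hq : enorm2 q = 1)
    (hy : 1 ≤ enorm2 y) : poissonKernel ρ q y ≤ 2 * enorm2 y := by
  have hs : 0 < enorm2 y := by linarith
  have hN1 : normPow (d / 2) y ≤ 1 := by
    rw [normPow_half]
    exact inv_le_one_of_one_le₀ (one_le_pow₀ hy)
  have hN0 : 0 ≤ normPow (d / 2) y := normPow_nonneg _ _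
  have hdot := (abs_le.1 (abs_dot_le q y)).1
  rw [hq, one_mul] at hdot
  have h1 : 0 ≤ 1 / ρ * normPow (d / 2 - 1) y :=
    mul_nonneg (by positivity) (normPow_nonneg _ _)
  unfold poissonKernel
  have h2 : -(2 * (dot q y * normPow (d / 2) y)) ≤ 2 * enorm2 y := by
    nlinarith
  linarith

set_option maxHeartbeats 1000000 in
/-- The comparison of the number of grains with the volume of the ball up to an untoppled site. -/
theorem exists_card_mul_le (hd : 2 ≤ d) :
    ∃ A C : ℝ, 1 ≤ A ∧ 0 ≤ C ∧ ∀ (n : ℕ) (H : ℤ) (l : List (Site d)) (z : Site d),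
      2 - 2 * (d : ℤ) ≤ H → Legal (initial d n H) l → z ∉ l → A ≤ enorm2 (toR z) →
      (∀ x, enorm2 (toR x) ≤ enorm2 (toR z) + A → run (initial d n H) l x < 2 * (d : ℤ)) →
      n * (enorm2 (toR z) / enorm2 (toR z) ^ d) ≤
        (2 * d - 1 + H) * (unitBallVolume d * enorm2 (toR z) + C) := by
  have hd' : (2 : ℝ) ≤ d := by exact_mod_cast hd
  obtain ⟨a, A₀, ha0, hA₀, haA, hsub⟩ := exists_subPoisson_subharmonic hd
  obtain ⟨C₁, hC₁, hsum⟩ := exists_sum_poissonKernel_le hd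
  obtain ⟨C₂, hC₂, hpow⟩ := exists_sum_enorm2_pow_le d
  set A : ℝ := max A₀ (6 * d) with hA
  have hA₀A : A₀ ≤ A := le_max_left _ _
  have hdA : 6 * (d : ℝ) ≤ A := le_max_right _ _
  -- An `ℓ¹` radius that contains the Euclidean ball of radius `A + 1`. The values `b`, `m`, `c`
  -- bound, on the cut-off shell, the odometer divided by `K`, the test function, and the number of
  -- sites.
  set j : ℕ := ⌈(d : ℝ) * (A + 1)⌉₊ with hj
  set b : ℝ := (2 * d + 1) ^ j with hb
  have hb1 : 1 ≤ b := one_le_pow₀ (by linarith)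
  set m : ℝ := 2 * (A + 1) + a with hm
  set c : ℝ := ((2 * j + 1 : ℕ) : ℝ) ^ d with hc
  refine ⟨j + 2, C₁ + a * C₂ + c * (b * (2 * d * m)), by
    linarith [Nat.cast_nonneg (α := ℝ) j], by positivity, fun n H l z hH hl hz hAz hst => ?_⟩
  have hjA : (d : ℝ) * (A + 1) ≤ j := Nat.le_ceil _
  have hjA' : A + 1 ≤ j := by nlinarith
  set ρ := enorm2 (toR z) with hρdef
  have hρ : A ≤ ρ := by linarith
  have hρ1 : 1 ≤ ρ := by linarith
  have hρ0 : 0 < ρ := by linarith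
  set K : ℝ := 2 * d - 1 + H with hK
  have hK1 : 1 ≤ K := by
    have : (1 : ℤ) ≤ 2 * d - 1 + H := by omega
    rw [hK]
    exact_mod_cast this
  set q : Fin d → ℝ := ρ⁻¹ • toR z with hqdef
  have hz' : toR z = ρ • q := by rw [hqdef, smul_smul, mul_inv_cancel₀ hρ0.ne', one_smul]
  have hq : enorm2 q = 1 := by
    rw [hqdef, enorm2_smul, abs_of_pos (by positivity), ← hρdef, inv_mul_cancel₀ hρ0.ne']
  set ψ : Site d → ℝ := fun x => subPoisson a ρ q (toR x - toR z) with hψ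
  set s : Site d → ℝ := fun x => enorm2 (toR x - toR z) with hs
  -- The test function: positive part of the corrected kernel, set to zero within distance `A` of
  -- the pole.
  set f : Site d → ℝ := fun x => if A ≤ s x then max (ψ x) 0 else 0 with hf
  have hf0 : ∀ x, 0 ≤ f x := by
    intro x
    simp only [hf]
    split_ifs
    · exact le_max_right _ _
    · exact le_rfl
  have hψeq : ∀ x, A ≤ s x → ψ x = normPow (d / 2) (toR x - toR z) *
      ((ρ ^ 2 - enorm2 (toR x) ^ 2) / ρ + a / s x) := by
    intro x hx
    have hpos : 0 < enorm2 (toR x - toR z) := by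
      change A ≤ enorm2 (toR x - toR z) at hx
      linarith
    simp only [hψ, subPoisson]
    rw [normPow_add_half hpos]
    rw [hz'] at hpos ⊢
    rw [poissonKernel_sub_eq hρ0 hq hpos, ← hz']
    ring
  -- If `|x| ≥ ρ + 1`, the kernel contributes at most `-2` and the correction at most `1`, relative
  -- to `|x - z|^(-d)`. So `f` has finite support.
  have hψpos : ∀ x, A ≤ s x → 0 < ψ x → enorm2 (toR x) < ρ + 1 := by
    intro x hx hpos
    by_contra! hc
    rw [hψeq x hx] at hpos
    have h1 : (ρ ^ 2 - enorm2 (toR x) ^ 2) / ρ ≤ -2 := by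
      rw [div_le_iff₀ hρ0]
      nlinarith
    have h2 : a / s x ≤ 1 := by
      rw [div_le_one (by linarith)]
      linarith
    exact absurd hpos (not_lt.2 (mul_nonpos_of_nonneg_of_nonpos (normPow_nonneg _ _)
      (by linarith)))
  have hs3 : ∀ x, enorm2 (toR x) < ρ + 1 → s x ≤ 3 * ρ := by
    intro x hx
    have := enorm2_sub_le (toR x) (toR z)
    simp only [hs]
    linarith
  have hlapψ : ∀ x, A ≤ s x → 0 < ψ x → 0 ≤ lap ψ x := by
    intro x hx hpos
    have h1 := lap_comp_toR (fun w => subPoisson a ρ q (w - toR z)) x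
    have h2 := hsub ρ q (toR x - toR z) hq.le (hA₀A.trans hx) (hs3 x (hψpos x hx hpos))
    change lap ψ x = _ at h1
    rw [h1]
    refine h2.trans (le_of_eq (Finset.sum_congr rfl fun i _ => ?_))
    simp only [secDiff]
    rw [sub_add_eq_add_sub, sub_right_comm]
  -- Taking a maximum with `0` preserves subharmonicity; this can fail only at sites that may have a
  -- neighbour where `f` was cut off.
  have hlapf : ∀ x, ¬ (A ≤ s x ∧ s x < A + 1) → 0 ≤ lap f x := by
    intro x hx
    have hzero : f x = 0 → 0 ≤ lap f x := by
      intro h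
      rw [lap_eq, h, mul_zero, sub_zero, ← sum_nbrs]
      exact Finset.sum_nonneg fun y _ => hf0 y
    by_cases h1 : A ≤ s x
    · have h2 : A + 1 ≤ s x := by
        by_contra! h
        exact hx ⟨h1, h⟩
      by_cases h3 : 0 < ψ x
      · refine (hlapψ x h1 h3).trans (lap_mono (fun y hy => ?_) ?_)
        · have h4 : A ≤ s y := by
            have : s x ≤ s y + 1 := enorm2_toR_le_of_adj (toR z) hy.symm
            linarith
          simp only [hf, if_pos h4]
          exact le_max_left _ _
        · simp only [hf, if_pos h1]
          rw [max_eq_left h3.le]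
      · refine hzero ?_
        simp only [hf, if_pos h1]
        exact max_eq_right (not_lt.1 h3)
    · exact hzero (by simp only [hf, if_neg h1])
  set F : Finset (Site d) := (finite_enorm2_le d (ρ + 1)).toFinset with hF
  have hmemF : ∀ x, x ∈ F ↔ enorm2 (toR x) ≤ ρ + 1 := by
    intro x
    rw [hF, Set.Finite.mem_toFinset]
    rfl
  have hfF : ∀ x, x ∉ F → f x = 0 := by
    intro x hx
    simp only [hf]
    split_ifs with h
    · refine max_eq_right ?_
      by_contra! hc
      exact hx ((hmemF x).2 (hψpos x h hc).le)
    · rfl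
  have hgreen := sum_mul_run f F l (initial d n H) fun a _ y _ hy => hfF y hy
  have hrun : ∑ x ∈ F, f x * (run (initial d n H) l x : ℝ) ≤ ∑ x ∈ F, f x * (2 * d - 1) := by
    refine Finset.sum_le_sum fun x hx => mul_le_mul_of_nonneg_left ?_ (hf0 x)
    have h1 := hst x (((hmemF x).1 hx).trans (by linarith [Nat.cast_nonneg (α := ℝ) j]))
    have h2 : run (initial d n H) l x ≤ 2 * (d : ℤ) - 1 := by omega
    exact_mod_cast h2
  have h0F : (0 : Site d) ∈ F := by
    rw [hmemF]
    have : enorm2 (toR (0 : Site d)) = 0 := by simp [enorm2, nsq, toR]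
    linarith
  have hinit : ∑ x ∈ F, f x * (initial d n H x : ℝ) = n * f 0 - H * ∑ x ∈ F, f x := by
    have h2 : ∀ x : Site d, f x * ((initial d n H x : ℤ) : ℝ) =
        (if x = 0 then n * f x else 0) - H * f x := by
      intro x
      simp only [initial]
      split_ifs <;> push_cast <;> ring
    simp only [h2, Finset.sum_sub_distrib, Finset.sum_ite_eq', if_pos h0F, Finset.mul_sum]
  -- Only the cut-off shell contributes negatively. It has boundedly many sites, and the odometer
  -- there is at most `K b` because `z` does not topple.
  have hlist : -(c * (b * (2 * d * m)) * K) ≤ (l.map (lap f)).sum := by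
    rw [Finset.sum_list_map_count]
    set E := l.toFinset.filter fun x => A ≤ s x ∧ s x < A + 1 with hE
    have hEcard : (#E : ℝ) ≤ c := by
      have := card_l1_le E z j (fun x hx => by
        have h1 := (Finset.mem_filter.1 hx).2.2
        have h2 := l1_le_mul_enorm2 (x - z)
        rw [toR_sub] at h2
        have h3 : (l1 (x - z) : ℝ) ≤ j := by
          refine h2.trans (le_trans ?_ hjA)
          exact mul_le_mul_of_nonneg_left h1.le (by linarith)
        exact_mod_cast h3)
      rw [hc]
      exact_mod_cast this
    have hterm : ∀ x ∈ l.toFinset, x ∈ E → -(K * (b * (2 * d * m))) ≤ l.count x • lap f x := by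
      intro x _ hx
      have hx2 := (Finset.mem_filter.1 hx).2
      have hlx : (l1 (x - z) : ℝ) ≤ j := by
        have h2 := l1_le_mul_enorm2 (x - z)
        rw [toR_sub] at h2
        exact (h2.trans (mul_le_mul_of_nonneg_left hx2.2.le (by linarith))).trans hjA
      have hv : odometer l x ≤ K * b := by
        have h1 := odometer_le_of_notMem (by omega) (by linarith) hz (j := j) (fun y hy => by
          refine hst y ?_
          have h1 := enorm2_le_l1 (y - z)
          rw [toR_sub] at h1
          have h2 := enorm2_add_le (toR y - toR z) (toR z)
          rw [sub_add_cancel] at h2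
          have h3 : (l1 (y - z) : ℝ) ≤ j := by exact_mod_cast hy
          linarith) x (by exact_mod_cast hlx)
        refine h1.trans (mul_le_mul_of_nonneg_left ?_ (by linarith))
        linarith
      have hfx : f x ≤ m := by
        simp only [hf, if_pos hx2.1]
        refine max_le ?_ (by positivity)
        have hs1 : 1 ≤ s x := by linarith
        have h1 := poissonKernel_le (q := q) (y := toR x - toR z) hρ1 hq hs1
        have h2 : normPow (d / 2 + 1 / 2) (toR x - toR z) ≤ 1 := by
          rw [normPow_add_half (by linarith : 0 < s x), normPow_half]
          rw [div_le_one (by linarith : 0 < s x)]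
          exact (inv_le_one_of_one_le₀ (one_le_pow₀ hs1)).trans hs1
        have h3 := mul_le_mul_of_nonneg_left h2 ha0
        simp only [hψ, subPoisson]
        have : 2 * s x ≤ 2 * (A + 1) := by linarith [hx2.2]
        linarith
      have hlap : -(2 * d * m) ≤ lap f x := by
        rw [lap_eq, ← sum_nbrs]
        have : 0 ≤ ∑ y ∈ nbrs x, f y := Finset.sum_nonneg fun y _ => hf0 y
        nlinarith
      rw [nsmul_eq_mul]
      change _ ≤ odometer l x * lap f x
      have hv0 := odometer_nonneg l x
      have hm0 : 0 ≤ 2 * d * m := by positivity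
      nlinarith
    calc -(c * (b * (2 * d * m)) * K) ≤ ∑ x ∈ E, -(K * (b * (2 * d * m))) := by
          rw [Finset.sum_const, nsmul_eq_mul]
          have : 0 ≤ K * (b * (2 * d * m)) := by positivity
          nlinarith
      _ ≤ ∑ x ∈ E, l.count x • lap f x :=
          Finset.sum_le_sum fun x hx => hterm x (Finset.filter_subset _ _ hx) hx
      _ ≤ ∑ x ∈ l.toFinset, l.count x • lap f x := by
          refine Finset.sum_le_sum_of_subset_of_nonneg (Finset.filter_subset _ _) ?_
          intro x hx hxE
          rw [nsmul_eq_mul]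
          refine mul_nonneg (Nat.cast_nonneg _) (hlapf x fun h => hxE ?_)
          exact Finset.mem_filter.2 ⟨hx, h⟩
  have hf0val : ρ / ρ ^ d ≤ f 0 := by
    have h0 : toR (0 : Site d) = 0 := by ext i; simp [toR]
    have hs0 : s 0 = ρ := by
      simp only [hs, h0, zero_sub, enorm2_neg]
      rfl
    have h2 : enorm2 (0 : Fin d → ℝ) = 0 := by simp [enorm2, nsq]
    simp only [hf, hs0, if_pos hρ]
    refine le_trans ?_ (le_max_left _ _)
    rw [hψeq 0 (by rw [hs0]; exact hρ), hs0, normPow_half]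
    change _ ≤ (s 0 ^ d)⁻¹ * _
    rw [hs0, h0, h2]
    have h3 : ρ ≤ (ρ ^ 2 - 0 ^ 2) / ρ + a / ρ := by
      have : (ρ ^ 2 - 0 ^ 2) / ρ = ρ := by field_simp; ring
      rw [this]
      have : 0 ≤ a / ρ := by positivity
      linarith
    calc ρ / ρ ^ d = (ρ ^ d)⁻¹ * ρ := by rw [div_eq_mul_inv, mul_comm]
      _ ≤ _ := by gcongr
  -- Outside the ball the kernel is nonpositive, so there the positive part is at most the
  -- correction term, which is summable over the lattice.
  have hsumf : ∑ x ∈ F, f x ≤ unitBallVolume d * ρ + C₁ + a * C₂ := by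
    set F₁ := F.filter fun x => A ≤ s x with hF₁
    set F₂ := F₁.filter fun x => enorm2 (toR x) < ρ with hF₂
    have e1 : ∑ x ∈ F, f x = ∑ x ∈ F₁, max (ψ x) 0 := by
      rw [hF₁, Finset.sum_filter]
    have e2 : ∀ x ∈ F₁, max (ψ x) 0 ≤
        (if enorm2 (toR x) < ρ then poissonKernel ρ q (toR x - toR z) else 0) +
          a * (enorm2 (toR (x - z)) ^ (d + 1))⁻¹ := by
      intro x hx
      have hx2 := (Finset.mem_filter.1 hx).2
      have hpos : 0 < enorm2 (toR x - toR z) := by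
        change A ≤ enorm2 (toR x - toR z) at hx2
        linarith
      have h1 : normPow (d / 2 + 1 / 2) (toR x - toR z) = (enorm2 (toR (x - z)) ^ (d + 1))⁻¹ := by
        rw [normPow_add_half hpos, toR_sub, normPow_half, pow_succ, mul_inv, div_eq_mul_inv]
      have h2 : 0 ≤ a * (enorm2 (toR (x - z)) ^ (d + 1))⁻¹ := by
        have := enorm2_nonneg (toR (x - z))
        positivity
      have hpk : poissonKernel ρ q (toR x - toR z) =
          normPow (d / 2) (toR x - toR z) * ((ρ ^ 2 - enorm2 (toR x) ^ 2) / ρ) := by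
        rw [hz'] at hpos ⊢
        exact poissonKernel_sub_eq hρ0 hq hpos
      have h3 : ψ x = poissonKernel ρ q (toR x - toR z) + a * (enorm2 (toR (x - z)) ^ (d + 1))⁻¹ := by
        simp only [hψ, subPoisson, h1]
      rw [h3]
      split_ifs with h4
      · refine max_le le_rfl (add_nonneg ?_ h2)
        rw [hpk]
        have := pow_le_pow_left₀ (enorm2_nonneg (toR x)) h4.le 2
        exact mul_nonneg (normPow_nonneg _ _) (div_nonneg (by linarith) hρ0.le)
      · refine max_le (add_le_add ?_ le_rfl) (by linarith)
        rw [hpk]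
        have := pow_le_pow_left₀ hρ0.le (not_lt.1 h4) 2
        exact mul_nonpos_of_nonneg_of_nonpos (normPow_nonneg _ _)
          (div_nonpos_of_nonpos_of_nonneg (by linarith) hρ0.le)
    rw [e1]
    refine (Finset.sum_le_sum e2).trans ?_
    rw [Finset.sum_add_distrib, ← Finset.sum_filter, ← Finset.mul_sum]
    have h5 := hsum ρ q z F₂ hρ0 hq hz' (by
      intro x hx
      have hx1 := Finset.mem_filter.1 hx
      exact ⟨hx1.2, hdA.trans (Finset.mem_filter.1 hx1.1).2⟩)
    have h6 := hpow (F₁.image fun x => x - z) (by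
      intro y hy h0
      obtain ⟨x, hx, rfl⟩ := Finset.mem_image.1 hy
      have h7 : A ≤ enorm2 (toR x - toR z) := (Finset.mem_filter.1 hx).2
      rw [← toR_sub, h0] at h7
      have : enorm2 (toR (0 : Site d)) = 0 := by simp [enorm2, nsq, toR]
      linarith)
    rw [Finset.sum_image fun x _ y _ h => by simpa using h] at h6
    have h7 := mul_le_mul_of_nonneg_left h6 ha0
    linarith
  have e1 : n * f 0 ≤ K * ∑ x ∈ F, f x + c * (b * (2 * d * m)) * K := by
    rw [← Finset.sum_mul] at hrun
    have : K * ∑ x ∈ F, f x = (∑ x ∈ F, f x) * (2 * d - 1) + H * ∑ x ∈ F, f x := by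
      rw [hK]; ring
    linarith
  have e2 := mul_le_mul_of_nonneg_left hf0val (Nat.cast_nonneg (α := ℝ) n)
  have e3 := mul_le_mul_of_nonneg_left hsumf (by linarith : 0 ≤ K)
  calc (n : ℝ) * (ρ / ρ ^ d) ≤ n * f 0 := e2
    _ ≤ K * (unitBallVolume d * ρ + C₁ + a * C₂) + c * (b * (2 * d * m)) * K := by linarith
    _ = _ := by ring

end Sandpile

/-! ### Conclusion of the inner bound. -/

namespace Sandpile

open Finset

variable {d : ℕ}

theorem mem_latticeBall {x : Site d} {ρ : ℝ} : x ∈ latticeBall d ρ ↔ enorm2 (toR x) < ρ := by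
  have h : ‖(WithLp.toLp 2 (fun i => (x i : ℝ)) : EuclideanSpace ℝ (Fin d))‖ = enorm2 (toR x) := by
    simp [EuclideanSpace.norm_eq, enorm2, nsq, toR]
  rw [← h]
  rfl

theorem rpow_neg_inv_mul_pow (hd : 0 < d) {K r : ℝ} (hK : 0 < K) :
    K * (K ^ (-(1 / (d : ℝ))) * r) ^ d = r ^ d := by
  have hd' : (d : ℝ) ≠ 0 := by exact_mod_cast hd.ne'
  rw [mul_pow, ← Real.rpow_natCast (K ^ _), ← Real.rpow_mul hK.le]
  have : -(1 / (d : ℝ)) * d = -1 := by field_simp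
  rw [this, Real.rpow_neg_one]
  field_simp

/-- All sites well inside the ball topple. -/
theorem exists_latticeBall_subset_visited (hd : 2 ≤ d) :
    ∃ c : ℝ, ∀ (H : ℤ) (n : ℕ) (R : ℝ), 2 - 2 * (d : ℤ) ≤ H → 0 ≤ R →
      (n : ℝ) = (2 * d - 1 + H) * (unitBallVolume d * R ^ d) →
      latticeBall d (R - c) ⊆ visited d n H := by
  have hd' : (2 : ℝ) ≤ d := by exact_mod_cast hd
  have hω := unitBallVolume_pos d
  obtain ⟨A, C, hA, hC, hmain⟩ := exists_card_mul_le hd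
  set ω := unitBallVolume d
  set j : ℕ := ⌈(d : ℝ) * A⌉₊ with hj
  have hjA : (d : ℝ) * A ≤ j := Nat.le_ceil _
  set b : ℝ := (2 * d + 1) ^ j with hb
  have hb1 : 1 ≤ b := one_le_pow₀ (by linarith)
  -- The `1` pays for passing from `x` to the neighbour `y`, `C / ω` for the Poisson comparison, and
  -- the last term for the case of `y` within distance `A` of the origin.
  refine ⟨1 + A + C / ω + (1 + 2 * d * b) / ω, fun H n R hH hR hn x hx => ?_⟩
  have hc1 : 0 ≤ C / ω := by positivity
  have hc2 : 0 ≤ (1 + 2 * d * b) / ω := by positivity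
  rw [mem_latticeBall] at hx
  set K : ℝ := 2 * d - 1 + H with hK
  have hK1 : 1 ≤ K := by
    have : (1 : ℤ) ≤ 2 * d - 1 + H := by omega
    rw [hK]
    exact_mod_cast this
  have hxn := enorm2_nonneg (toR x)
  set y : Site d := x + unitVec ⟨0, by omega⟩ with hy
  have hadj : Adj x y := adj_add_unitVec x _
  have hyx := enorm2_toR_le_of_adj 0 hadj
  simp only [sub_zero] at hyx
  set ρ := enorm2 (toR y) with hρ
  -- For `H < 1 - d` full stabilization may be impossible; stabilizing inside a large enough ball is
  -- all the argument needs. It remains to see that the neighbour `y` of `x` topples.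
  obtain ⟨l, hl, -, hst⟩ := exists_stable_on (by omega) (initial d n H)
    (finite_enorm2_le d (ρ + A + j)).toFinset
  have hst' : ∀ w, enorm2 (toR w) ≤ ρ + A + j → run (initial d n H) l w < 2 * (d : ℤ) := by
    intro w hw
    exact hst w ((Set.Finite.mem_toFinset _).2 hw)
  refine ⟨l, hl, Or.inr ⟨y, ?_, hadj.symm⟩⟩
  by_contra hyl
  rcases le_or_gt A ρ with hAρ | hAρ
  · have h := hmain n H l y hH hl hyl hAρ fun w hw => hst' w (by
      have := Nat.cast_nonneg (α := ℝ) j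
      linarith)
    rw [hn, mul_assoc] at h
    have h1 := le_of_mul_le_mul_left h (by linarith)
    have hρ0 : 0 < ρ := by linarith
    have hρR : ρ ≤ R := by linarith
    have h2 : ω * R ≤ ω * R ^ d * (ρ / ρ ^ d) := by
      obtain ⟨k, hk⟩ : ∃ k, d = k + 1 := ⟨d - 1, by omega⟩
      have h3 : ρ / ρ ^ d = (ρ ^ k)⁻¹ := by
        rw [hk, pow_succ]; field_simp
      have h4 : R ^ d = R * R ^ k := by rw [hk, pow_succ, mul_comm]
      rw [h3, h4]
      have h5 : 1 ≤ R ^ k * (ρ ^ k)⁻¹ := by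
        rw [← div_eq_mul_inv, one_le_div (by positivity)]
        exact pow_le_pow_left₀ hρ0.le hρR k
      calc ω * R = ω * R * 1 := (mul_one _).symm
        _ ≤ ω * R * (R ^ k * (ρ ^ k)⁻¹) := by gcongr
        _ = _ := by ring
    have h6 : R ≤ ρ + C / ω := by
      have : ω * R ≤ ω * (ρ + C / ω) := by
        rw [mul_add, mul_div_cancel₀ _ hω.ne']
        linarith
      exact le_of_mul_le_mul_left this hω
    linarith
  -- Here `y` is close to the origin, so the odometer at the origin is `O(K)`. Stability there then
  -- bounds `n` by a multiple of `K`, too small for the given `R`.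
  · have h0 : ((l1 (0 - y) : ℕ) : ℝ) ≤ j := by
      rw [zero_sub, l1_neg]
      exact (l1_le_mul_enorm2 y).trans
        ((mul_le_mul_of_nonneg_left hAρ.le (by linarith)).trans hjA)
    have h1 := odometer_le_of_notMem (by omega) (by linarith) hyl (j := j) (fun w hw => by
      refine hst' w ?_
      have h2 := enorm2_le_l1 (w - y)
      rw [toR_sub] at h2
      have h3 := enorm2_add_le (toR w - toR y) (toR y)
      rw [sub_add_cancel] at h3
      have h4 : ((l1 (w - y) : ℕ) : ℝ) ≤ j := by exact_mod_cast hw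
      linarith) 0 (by exact_mod_cast h0)
    have h2 := lap_odometer_le (hst' 0 (by
      have : enorm2 (toR (0 : Site d)) = 0 := by simp [enorm2, nsq, toR]
      have := Nat.cast_nonneg (α := ℝ) j
      have := enorm2_nonneg (toR y)
      linarith))
    rw [if_pos rfl, lap_eq, ← sum_nbrs] at h2
    have h3 : 0 ≤ ∑ w ∈ nbrs (0 : Site d), odometer l w :=
      Finset.sum_nonneg fun w _ => odometer_nonneg l w
    have h4 : (n : ℝ) ≤ K + 2 * d * (K * (b - 1)) := by
      have := mul_le_mul_of_nonneg_left h1 (by linarith : (0 : ℝ) ≤ 2 * d)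
      linarith
    have hR1 : 1 ≤ R := by linarith
    have h5 : R ≤ R ^ d := le_self_pow₀ hR1 (by omega)
    rw [hn] at h4
    have h6 : K * (ω * R) ≤ K * (1 + 2 * d * b) := by
      calc K * (ω * R) ≤ K * (ω * R ^ d) := by gcongr
        _ ≤ K + 2 * d * (K * (b - 1)) := h4
        _ ≤ K * (1 + 2 * d * b) := by nlinarith
    have h7 := le_of_mul_le_mul_left h6 (by linarith)
    have h8 : R ≤ (1 + 2 * d * b) / ω := by
      rw [le_div_iff₀ hω]
      linarith
    linarith

/-! ### Lattice points in balls -/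

/-- The lattice sites at distance at most `r` from the origin. -/
noncomputable def closedBallFinset (d : ℕ) (r : ℝ) : Finset (Site d) :=
  (finite_enorm2_le d r).toFinset

theorem mem_closedBallFinset {r : ℝ} {x : Site d} :
    x ∈ closedBallFinset d r ↔ enorm2 (toR x) ≤ r := by
  rw [closedBallFinset, Set.Finite.mem_toFinset]
  rfl

theorem card_closedBallFinset_le (hd : 0 < d) {r : ℝ} (hr : 0 ≤ r) :
    (#(closedBallFinset d r) : ℝ) ≤ unitBallVolume d * (r + 2 * d) ^ d := by
  have hd' : (1 : ℝ) ≤ d := by exact_mod_cast hd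
  rw [← volume_ball2 hd (by linarith)]
  have hsub : ⋃ x ∈ closedBallFinset d r, cubeAt x ⊆ ball2 d (r + 2 * d) := by
    refine Set.iUnion₂_subset fun x hx w hw => ?_
    have h1 := enorm2_le_of_mem_unitCube hw
    have h2 := enorm2_add_le (toR x) (w - toR x)
    rw [add_sub_cancel] at h2
    have h3 := mem_closedBallFinset.1 hx
    change enorm2 w < r + 2 * d
    linarith
  have hfin : MeasureTheory.volume (ball2 d (r + 2 * d)) ≠ ⊤ := by
    refine ((isCompact_closedBall2 (d := d) (r + 2 * d)).measure_lt_top.trans_le'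
      (MeasureTheory.measure_mono ?_)).ne
    intro x hx
    exact (show enorm2 x < _ from hx).le
  have h := MeasureTheory.measureReal_mono hsub hfin
  rw [MeasureTheory.Measure.real, MeasureTheory.measure_biUnion_finset] at h
  · simpa [volume_cubeAt] using h
  · intro x _ y _ hxy
    exact disjoint_cubeAt hxy
  · intro x _
    exact (isOpen_cubeAt x).measurableSet

theorem le_card_closedBallFinset (hd : 0 < d) {r : ℝ} (hr : (d : ℝ) ≤ r) :
    unitBallVolume d * (r - d) ^ d ≤ #(closedBallFinset d r) := by
  rw [← volume_ball2 hd (by linarith)]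
  set Q : Site d → Set (Fin d → ℝ) := fun x =>
    Set.Icc (fun i => (x i : ℝ) - 1 / 2) (fun i => (x i : ℝ) + 1 / 2)
  have hQ : ∀ x, MeasureTheory.volume (Q x) = 1 := by
    intro x
    rw [Real.volume_Icc_pi]
    norm_num
  have hsub : ball2 d (r - d) ⊆ ⋃ x ∈ closedBallFinset d r, Q x := by
    intro w hw
    have hw' : enorm2 w < r - d := hw
    refine Set.mem_iUnion₂.2 ⟨fun i => round (w i), ?_, ?_⟩
    · rw [mem_closedBallFinset]
      have h1 : enorm2 (toR (fun i => round (w i)) - w) ≤ d := by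
        rw [enorm2_le_iff (Nat.cast_nonneg d)]
        have h2 : nsq (toR (fun i => round (w i)) - w) ≤ ∑ _i : Fin d, (1 : ℝ) := by
          refine Finset.sum_le_sum fun i _ => ?_
          have h3 := abs_sub_round (w i)
          rw [abs_sub_comm] at h3
          rw [← sq_abs]
          have h4 := abs_nonneg ((round (w i) : ℝ) - w i)
          change |(round (w i) : ℝ) - w i| ^ 2 ≤ 1
          nlinarith
        have h5 : (d : ℝ) ≤ (d : ℝ) ^ 2 := by exact_mod_cast Nat.le_self_pow two_ne_zero d
        refine h2.trans ?_
        simpa using h5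
      have h2 := enorm2_add_le (toR (fun i => round (w i)) - w) w
      rw [sub_add_cancel] at h2
      linarith
    · constructor <;> intro i <;> have := abs_le.1 (abs_sub_round (w i)) <;> simp only <;> linarith
  have h := (MeasureTheory.measure_mono (μ := MeasureTheory.volume) hsub).trans
    (MeasureTheory.measure_biUnion_finset_le _ _)
  simp only [hQ, Finset.sum_const, nsmul_eq_mul, mul_one] at h
  have := ENNReal.toReal_mono (by simp) h
  simpa [MeasureTheory.Measure.real] using this

end Sandpile

namespace Sandpile

open Finset

variable {d : ℕ}

/-! ### A primitive of a negative power -/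

/-- For `p = d/2` the function `x ↦ Ψ(|x|²)` is, up to constants, the fundamental solution of the
Laplacian; working with a primitive treats the logarithm of `d = 2` together with the powers. -/
theorem exists_primitive_rpow_neg (p : ℝ) :
    ∃ Ψ : ℝ → ℝ, ∀ W : ℝ, 0 < W → HasDerivAt Ψ (W ^ (-p)) W := by
  by_cases hp : p = 1
  · refine ⟨Real.log, fun W hW => ?_⟩
    rw [hp, Real.rpow_neg_one]
    exact Real.hasDerivAt_log hW.ne'
  · have hp' : 1 - p ≠ 0 := fun h => hp (by linarith)
    refine ⟨fun W => W ^ (1 - p) / (1 - p), fun W hW => ?_⟩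
    refine ((Real.hasDerivAt_rpow_const (p := 1 - p) (Or.inl hW.ne')).div_const (1 - p)).congr_deriv ?_
    rw [mul_div_cancel_left₀ _ hp']
    congr 1
    ring

section Primitive

variable {p : ℝ} {Ψ : ℝ → ℝ}

/-- Concavity: the derivative `W ^ (-p)` is nonincreasing. -/
theorem primitive_le_tangent (hΨ : ∀ W : ℝ, 0 < W → HasDerivAt Ψ (W ^ (-p)) W) (hp : 0 ≤ p)
    {V W : ℝ} (hV : 0 < V) (hW : 0 < W) : Ψ V ≤ Ψ W + (V - W) * W ^ (-p) := by
  rcases lt_trichotomy V W with h | rfl | h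
  · obtain ⟨c, hc, hc'⟩ := exists_hasDerivAt_eq_slope Ψ (fun σ => σ ^ (-p)) h
      (fun σ hσ => (hΨ σ (hV.trans_le hσ.1)).continuousAt.continuousWithinAt)
      (fun σ hσ => hΨ σ (hV.trans hσ.1))
    rw [eq_div_iff (sub_pos.2 h).ne'] at hc'
    have h1 : W ^ (-p) ≤ c ^ (-p) :=
      Real.rpow_le_rpow_of_nonpos (hV.trans hc.1) hc.2.le (by linarith)
    have h2 := mul_le_mul_of_nonneg_right h1 (sub_pos.2 h).le
    linarith
  · simp
  · obtain ⟨c, hc, hc'⟩ := exists_hasDerivAt_eq_slope Ψ (fun σ => σ ^ (-p)) h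
      (fun σ hσ => (hΨ σ (hW.trans_le hσ.1)).continuousAt.continuousWithinAt)
      (fun σ hσ => hΨ σ (hW.trans hσ.1))
    rw [eq_div_iff (sub_pos.2 h).ne'] at hc'
    have h1 : c ^ (-p) ≤ W ^ (-p) :=
      Real.rpow_le_rpow_of_nonpos hW hc.1.le (by linarith)
    have h2 := mul_le_mul_of_nonneg_right h1 (sub_pos.2 h).le
    linarith

theorem one_sub_mul_le_rpow_neg {p t : ℝ} (hp : 0 ≤ p) (ht : 0 ≤ t) :
    1 - p * t ≤ (1 + t) ^ (-p) := by
  have h1 : Real.log (1 + t) ≤ t := by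
    have := Real.log_le_sub_one_of_pos (by linarith : 0 < 1 + t)
    linarith
  rw [Real.rpow_def_of_pos (by linarith)]
  have h2 := Real.add_one_le_exp (Real.log (1 + t) * -p)
  have h3 := mul_le_mul_of_nonneg_left h1 hp
  linarith

/-- Integrate `σ ^ (-p) ≥ W ^ (-p) (1 - p (σ - W)/W)`, a form of Bernoulli's inequality, from `W` to
`V`. -/
theorem primitive_ge_quadratic (hΨ : ∀ W : ℝ, 0 < W → HasDerivAt Ψ (W ^ (-p)) W) (hp : 0 ≤ p)
    {V W : ℝ} (hW : 0 < W) (hVW : W ≤ V) :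
    Ψ W + (V - W) * W ^ (-p) - p / 2 * (W ^ (-p) / W) * (V - W) ^ 2 ≤ Ψ V := by
  set f : ℝ → ℝ := fun σ =>
    Ψ σ - (σ - W) * W ^ (-p) + p / 2 * (W ^ (-p) / W) * (σ - W) ^ 2 with hf
  have hder : ∀ σ, 0 < σ → HasDerivAt f
      (σ ^ (-p) - W ^ (-p) + p * (W ^ (-p) / W) * (σ - W)) σ := by
    intro σ hσ
    have h1 : HasDerivAt (fun σ : ℝ => σ - W) 1 σ := (hasDerivAt_id σ).sub_const W
    refine (((hΨ σ hσ).sub (h1.mul_const (W ^ (-p)))).add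
      ((h1.pow 2).const_mul (p / 2 * (W ^ (-p) / W)))).congr_deriv ?_
    push_cast
    ring
  have hmono : MonotoneOn f (Set.Ici W) := by
    refine monotoneOn_of_hasDerivWithinAt_nonneg (convex_Ici W)
      (fun σ hσ => (hder σ (hW.trans_le hσ)).continuousAt.continuousWithinAt)
      (fun σ hσ => (hder σ ?_).hasDerivWithinAt) fun σ hσ => ?_
    · rw [interior_Ici] at hσ
      exact hW.trans hσ
    · rw [interior_Ici] at hσ
      have hσ' : W < σ := hσ
      have ht : 0 ≤ (σ - W) / W := div_nonneg (by linarith) hW.le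
      have h1 := one_sub_mul_le_rpow_neg hp ht
      have h2 : σ ^ (-p) = W ^ (-p) * (1 + (σ - W) / W) ^ (-p) := by
        rw [← Real.mul_rpow hW.le (by linarith)]
        congr 1
        field_simp
        ring
      have h3 := mul_le_mul_of_nonneg_left h1 (Real.rpow_nonneg hW.le (-p))
      rw [h2]
      have h4 : W ^ (-p) * (1 - p * ((σ - W) / W)) =
          W ^ (-p) - p * (W ^ (-p) / W) * (σ - W) := by ring
      linarith
  have h := hmono (Set.mem_Ici.2 le_rfl) (Set.mem_Ici.2 hVW) hVW
  simp only [hf, sub_self] at h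
  linarith

theorem exists_primitive_taylor (hΨ : ∀ W : ℝ, 0 < W → HasDerivAt Ψ (W ^ (-p)) W) (hp : 0 ≤ p) :
    ∃ C : ℝ, 0 ≤ C ∧ ∀ W u : ℝ, 0 < W → |u| ≤ W / 2 →
      W ^ (-p) * (u - p / 2 * (u ^ 2 / W) + p * (p + 1) / 6 * (u ^ 3 / W ^ 2) -
        C * (u ^ 4 / W ^ 3)) ≤ Ψ (W + u) - Ψ W := by
  obtain ⟨C, hC, hT⟩ := one_add_rpow_taylor_two hp
  refine ⟨C, hC, fun W u hW hu => ?_⟩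
  set κ := W ^ (-p)
  have hκ : 0 < κ := Real.rpow_pos_of_pos hW _
  have hder : ∀ t : ℝ, |t| ≤ 1 / 2 → HasDerivAt
      (fun t : ℝ => (Ψ (W + W * t) - Ψ W) / (κ * W) -
        (t - p / 2 * t ^ 2 + p * (p + 1) / 6 * t ^ 3))
      ((1 + t) ^ (-p) - (1 - p * t + p * (p + 1) / 2 * t ^ 2)) t := by
    intro t ht
    have ht' : 0 < 1 + t := by linarith [(abs_le.1 ht).1]
    have h0 : 0 < W + W * t := by nlinarith
    have h1 : HasDerivAt (fun t : ℝ => W + W * t) (W * 1) t :=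
      ((hasDerivAt_id t).const_mul W).const_add W
    have h2 := ((hΨ _ h0).comp t h1).sub_const (Ψ W)
    refine ((h2.div_const (κ * W)).sub ((((hasDerivAt_id t)).sub
      (((hasDerivAt_id t).pow 2).const_mul (p / 2))).add
      (((hasDerivAt_id t).pow 3).const_mul (p * (p + 1) / 6)))).congr_deriv ?_
    have h3 : (W + W * t) ^ (-p) = κ * (1 + t) ^ (-p) := by
      rw [← Real.mul_rpow hW.le ht'.le]
      congr 1
      ring
    rw [h3]
    simp only [id]
    push_cast
    field_simp
    ring
  have ht : |u / W| ≤ 1 / 2 := by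
    rw [abs_div, abs_of_pos hW, div_le_iff₀ hW]
    linarith
  have h := (abs_le.1 (abs_le_of_hasDerivAt hder hC hT (by simp) ht)).1
  have e1 : W + W * (u / W) = W + u := by field_simp
  have e2 : |u / W| ^ 4 = u ^ 4 / W ^ 4 := by
    rw [← div_pow, ← abs_pow, abs_of_nonneg (by positivity)]
  simp only [e1] at h
  norm_num only at h
  rw [e2] at h
  have h' := mul_le_mul_of_nonneg_left h (by positivity : 0 ≤ κ * W)
  have e3 : κ * W * ((Ψ (W + u) - Ψ W) / (κ * W) - (u / W - p / 2 * (u / W) ^ 2 +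
      p * (p + 1) / 6 * (u / W) ^ 3)) = Ψ (W + u) - Ψ W -
      κ * (u - p / 2 * (u ^ 2 / W) + p * (p + 1) / 6 * (u ^ 3 / W ^ 2)) := by
    field_simp
  have e4 : κ * W * -(C * (u ^ 4 / W ^ 4)) = - (κ * (C * (u ^ 4 / W ^ 3))) := by
    field_simp
  rw [e3, e4] at h'
  linarith

end Primitive

/-! ### A subharmonic radial potential -/

theorem nsq_toR_add_unitVec (x : Site d) (i : Fin d) :
    nsq (toR (x + unitVec i)) = nsq (toR x) + (2 * toR x i + 1) := by
  rw [toR_add, toR_unitVec, nsq_add, dot_single, nsq_single]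
  ring

theorem nsq_toR_sub_unitVec (x : Site d) (i : Fin d) :
    nsq (toR (x - unitVec i)) = nsq (toR x) + (-(2 * toR x i) + 1) := by
  have := nsq_toR_add_unitVec (x - unitVec i) i
  rw [sub_add_cancel] at this
  have h2 : toR (x - unitVec i) i = toR x i - 1 := by
    simp [toR, unitVec]
  rw [h2] at this
  linarith

theorem lap_radial (F : ℝ → ℝ) (x : Site d) :
    lap (fun y => F (nsq (toR y))) x = ∑ i, (F (nsq (toR x) + (2 * toR x i + 1)) +
      F (nsq (toR x) + (-(2 * toR x i) + 1)) - 2 * F (nsq (toR x))) := by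
  simp only [lap, nsq_toR_add_unitVec, nsq_toR_sub_unitVec]

theorem sq_apply_le_nsq (y : Fin d → ℝ) (i : Fin d) : y i ^ 2 ≤ nsq y :=
  Finset.single_le_sum (f := fun i => y i ^ 2) (fun _ _ => sq_nonneg _) (Finset.mem_univ i)

theorem sum_pow_four_le (y : Fin d → ℝ) : ∑ i, y i ^ 4 ≤ nsq y ^ 2 := by
  have : ∑ i, y i ^ 4 ≤ ∑ i, nsq y * y i ^ 2 := by
    refine Finset.sum_le_sum fun i _ => ?_
    have := mul_le_mul_of_nonneg_right (sq_apply_le_nsq y i) (sq_nonneg (y i))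
    calc y i ^ 4 = y i ^ 2 * y i ^ 2 := by ring
      _ ≤ _ := this
  rw [← Finset.mul_sum] at this
  rw [sq]
  exact this

/-- The function `W ↦ Ψ(W + a)`, continued linearly to the left of `M`. -/
noncomputable def flattened (Ψ : ℝ → ℝ) (p a M S : ℝ) : ℝ :=
  if M ≤ S then Ψ (S + a) else Ψ (M + a) + (S - M) * (M + a) ^ (-p)

section Flattened

variable {p a M : ℝ} {Ψ : ℝ → ℝ}

theorem le_flattened (hΨ : ∀ W : ℝ, 0 < W → HasDerivAt Ψ (W ^ (-p)) W) (hp : 0 ≤ p)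
    (ha : 0 < a) (hM : 0 ≤ M) {S : ℝ} (hS : -a < S) : Ψ (S + a) ≤ flattened Ψ p a M S := by
  unfold flattened
  split_ifs with h
  · exact le_rfl
  · have := primitive_le_tangent hΨ hp (V := S + a) (W := M + a) (by linarith) (by linarith)
    rwa [add_sub_add_right_eq_sub] at this

/-- Continuing a concave function by its tangent line keeps it concave. The tangent is taken at `W -
a`, where the slope is `W ^ (-p)`. -/
theorem flattened_le_tangent (hΨ : ∀ W : ℝ, 0 < W → HasDerivAt Ψ (W ^ (-p)) W) (hp : 0 ≤ p)
    (ha : 0 < a) (hM : 0 ≤ M) {W : ℝ} (hW : M + a ≤ W) (S : ℝ) :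
    flattened Ψ p a M S ≤ flattened Ψ p a M (W - a) + (S - (W - a)) * W ^ (-p) := by
  have h0 : flattened Ψ p a M (W - a) = Ψ W := by
    rw [flattened, if_pos (by linarith), sub_add_cancel]
  rw [h0]
  unfold flattened
  split_ifs with h
  · have := primitive_le_tangent hΨ hp (V := S + a) (W := W) (by linarith) (by linarith)
    rwa [show S + a - W = S - (W - a) by ring] at this
  · have h1 := primitive_le_tangent hΨ hp (V := M + a) (W := W) (by linarith) (by linarith)
    have h2 : W ^ (-p) ≤ (M + a) ^ (-p) :=
      Real.rpow_le_rpow_of_nonpos (by linarith) hW (by linarith)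
    have h3 := mul_le_mul_of_nonneg_left h2 (by linarith : 0 ≤ M - S)
    linarith

theorem quadratic_le_flattened (hΨ : ∀ W : ℝ, 0 < W → HasDerivAt Ψ (W ^ (-p)) W) (hp : 0 ≤ p)
    (ha : 0 < a) (hM : 0 ≤ M) {W S : ℝ} (hW : M + a ≤ W) (hS : W - a ≤ S) :
    flattened Ψ p a M (W - a) + (S - (W - a)) * W ^ (-p) -
      p / 2 * (W ^ (-p) / W) * (S - (W - a)) ^ 2 ≤ flattened Ψ p a M S := by
  rw [flattened, if_pos (by linarith), flattened, if_pos (by linarith), sub_add_cancel]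
  have := primitive_ge_quadratic hΨ hp (V := S + a) (W := W) (by linarith) (by linarith)
  rwa [show S + a - W = S - (W - a) by ring] at this

theorem linear_le_flattened (hΨ : ∀ W : ℝ, 0 < W → HasDerivAt Ψ (W ^ (-p)) W) (hp : 0 ≤ p)
    (ha : 0 < a) (hM : 0 ≤ M) {S u : ℝ} (hS : S < M) :
    (M + a) ^ (-p) * (u - p / 2 * (u ^ 2 / (M + a))) ≤
      flattened Ψ p a M (S + u) - flattened Ψ p a M S := by
  have hk : 0 < (M + a) ^ (-p) := Real.rpow_pos_of_pos (by linarith) _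
  have hMa : 0 < M + a := by linarith
  rw [flattened, flattened, if_neg (not_le.2 hS)]
  split_ifs with h
  · have h1 := primitive_ge_quadratic hΨ hp (V := S + u + a) (W := M + a) hMa (by linarith)
    have h2 : (S + u + a - (M + a)) ^ 2 ≤ u ^ 2 :=
      pow_le_pow_left₀ (by linarith) (by linarith) 2
    have h3 := mul_le_mul_of_nonneg_left h2
      (by positivity : 0 ≤ p / 2 * ((M + a) ^ (-p) / (M + a)))
    have h4 : (M + a) ^ (-p) * (u - p / 2 * (u ^ 2 / (M + a))) =
      (M + a) ^ (-p) * u - p / 2 * ((M + a) ^ (-p) / (M + a)) * u ^ 2 := by ring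
    rw [h4]
    linarith
  · have : 0 ≤ (M + a) ^ (-p) * (p / 2 * (u ^ 2 / (M + a))) := by positivity
    linarith

end Flattened

/-- In the linear range the function is affine in `|x|²`, whose Laplacian is `2d`. This positive
mass near the origin will compensate the `n` grains put there. -/
theorem lap_flattened_eq {p a M : ℝ} (Ψ : ℝ → ℝ) {x : Site d}
    (hx : ∀ y, Adj x y → nsq (toR y) < M) (hx' : nsq (toR x) < M) :
    lap (fun y => flattened Ψ p a M (nsq (toR y))) x = 2 * d * (M + a) ^ (-p) := by
  have h1 : ∀ i, nsq (toR x) + (2 * toR x i + 1) < M := fun i => by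
    rw [← nsq_toR_add_unitVec]
    exact hx _ (adj_add_unitVec x i)
  have h2 : ∀ i, nsq (toR x) + (-(2 * toR x i) + 1) < M := fun i => by
    rw [← nsq_toR_sub_unitVec]
    exact hx _ (adj_sub_unitVec x i)
  rw [lap_radial]
  simp only [flattened, if_neg (not_le.2 hx'), if_neg (not_le.2 (h1 _)), if_neg (not_le.2 (h2 _))]
  rw [Finset.sum_congr rfl (g := fun _ => 2 * (M + a) ^ (-p)) fun i _ => by ring]
  simp
  ring

/-- If `a` is large, then `x ↦ Θ(|x|²)` is subharmonic for the flattened primitive `Θ` of the power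
`-d/2`. -/
theorem exists_lap_flattened_nonneg {Ψ : ℝ → ℝ}
    (hΨ : ∀ W : ℝ, 0 < W → HasDerivAt Ψ (W ^ (-((d : ℝ) / 2))) W) (hd : 0 < d) :
    ∃ a : ℝ, 1 ≤ a ∧ ∀ (M : ℝ) (x : Site d), 0 ≤ M →
      0 ≤ lap (fun y => flattened Ψ ((d : ℝ) / 2) a M (nsq (toR y))) x := by
  have hd' : (1 : ℝ) ≤ d := by exact_mod_cast hd
  have hp : 0 ≤ (d : ℝ) / 2 := by positivity
  obtain ⟨C, hC, hT⟩ := exists_primitive_taylor hΨ hp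
  -- The `6` keeps the increments `±2xᵢ + 1` within the Taylor range `W/2`; the rest makes `2da`
  -- exceed the error terms `d²/2 + C(80 + 2d)`.
  refine ⟨6 + d + C * (80 + 2 * d), by nlinarith, fun M x hM => ?_⟩
  set a := 6 + d + C * (80 + 2 * d) with ha
  have hC1 : 0 ≤ C * (80 + 2 * d) := by positivity
  have ha0 : 0 < a := by linarith
  set S := nsq (toR x) with hS
  have hS0 : 0 ≤ S := nsq_nonneg _
  have hsum : ∑ i, toR x i ^ 2 = S := rfl
  rw [lap_radial]
  -- For `S ≥ M` expand `Ψ` at `W = S + a`: the leading terms leave `2da/W`, positive because of the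
  -- shift `a`. For `S < M` the slope is that at `M + a`, and a second-order lower bound is enough.
  rcases le_or_gt M S with hMS | hSM
  · set W := S + a with hW
    have hW0 : 1 ≤ W := by linarith
    have hκ : 0 < W ^ (-((d : ℝ) / 2)) := Real.rpow_pos_of_pos (by linarith) _
    set κ := W ^ (-((d : ℝ) / 2))
    have hu : ∀ i, |2 * toR x i + 1| ≤ W / 2 ∧ |-(2 * toR x i) + 1| ≤ W / 2 := by
      intro i
      have h1 := sq_apply_le_nsq (toR x) i
      have : toR x i ^ 2 + 6 ≤ W := by linarith
      constructor <;> rw [abs_le] <;> constructor <;>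
        nlinarith [sq_nonneg (toR x i - 2), sq_nonneg (toR x i + 2)]
    have hi : ∀ i, κ * (2 - d / 4 * ((8 * toR x i ^ 2 + 2) / W) -
        C * ((32 * toR x i ^ 4 + 48 * toR x i ^ 2 + 2) / W ^ 3)) ≤
        flattened Ψ ((d : ℝ) / 2) a M (S + (2 * toR x i + 1)) +
        flattened Ψ ((d : ℝ) / 2) a M (S + (-(2 * toR x i) + 1)) -
        2 * flattened Ψ ((d : ℝ) / 2) a M S := by
      intro i
      have h1 := hT W _ (by linarith) (hu i).1
      have h2 := hT W _ (by linarith) (hu i).2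
      have h3 := (abs_le.1 (hu i).1).1
      have h4 := (abs_le.1 (hu i).2).1
      have f1 := le_flattened hΨ hp ha0 hM (S := S + (2 * toR x i + 1)) (by linarith)
      have f2 := le_flattened hΨ hp ha0 hM (S := S + (-(2 * toR x i) + 1)) (by linarith)
      have f3 : flattened Ψ ((d : ℝ) / 2) a M S = Ψ W := by rw [flattened, if_pos hMS]
      rw [show S + (2 * toR x i + 1) + a = W + (2 * toR x i + 1) by ring] at f1
      rw [show S + (-(2 * toR x i) + 1) + a = W + (-(2 * toR x i) + 1) by ring] at f2
      rw [f3]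
      have h5 : 0 ≤ κ * ((d : ℝ) / 2 * (d / 2 + 1) / 6 * ((24 * toR x i ^ 2 + 2) / W ^ 2)) := by
        positivity
      have h6 := add_le_add h1 h2
      refine le_trans ?_ (h6.trans (by linarith))
      rw [← sub_nonneg]
      refine h5.trans (le_of_eq ?_)
      ring
    refine le_trans ?_ (Finset.sum_le_sum fun i _ => hi i)
    rw [← Finset.mul_sum]
    refine mul_nonneg hκ.le ?_
    have e : ∑ i, (2 - d / 4 * ((8 * toR x i ^ 2 + 2) / W) -
        C * ((32 * toR x i ^ 4 + 48 * toR x i ^ 2 + 2) / W ^ 3)) =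
        2 * d - d / 4 * ((8 * S + 2 * d) / W) -
        C * ((32 * ∑ i, toR x i ^ 4 + 48 * S + 2 * d) / W ^ 3) := by
      rw [← hsum]
      simp only [Finset.sum_sub_distrib, ← Finset.mul_sum, ← Finset.sum_div,
        Finset.sum_add_distrib, Finset.sum_const, Finset.card_univ, Fintype.card_fin, nsmul_eq_mul]
      ring
    rw [e]
    have h4 : ∑ i, toR x i ^ 4 ≤ S ^ 2 := sum_pow_four_le (toR x)
    have h5 : (32 * ∑ i, toR x i ^ 4 + 48 * S + 2 * d) / W ^ 3 ≤ (80 + 2 * d) / W := by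
      rw [div_le_div_iff₀ (by positivity) (by linarith)]
      have hSW : S ≤ W := by linarith
      have h6 : S ^ 2 ≤ W ^ 2 := pow_le_pow_left₀ hS0 hSW 2
      have h7 : W ≤ W ^ 2 := by nlinarith
      have h8 : (2 : ℝ) * d ≤ 2 * d * W ^ 2 := by nlinarith
      have h9 : 32 * ∑ i, toR x i ^ 4 + 48 * S + 2 * d ≤ (80 + 2 * d) * W ^ 2 := by nlinarith
      calc _ ≤ (80 + 2 * d) * W ^ 2 * W := mul_le_mul_of_nonneg_right h9 (by linarith)
        _ = _ := by ring
    have h6 := mul_le_mul_of_nonneg_left h5 hC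
    have h7 : 2 * d - d / 4 * ((8 * S + 2 * d) / W) - C * ((80 + 2 * d) / W) =
        (2 * d * a - d ^ 2 / 2 - C * (80 + 2 * d)) / W := by
      rw [hW]
      field_simp
      ring
    have h8 : 0 ≤ (2 * d * a - d ^ 2 / 2 - C * (80 + 2 * d)) / W := by
      refine div_nonneg ?_ (by linarith)
      rw [ha]
      nlinarith
    linarith
  · have hMa : 0 < M + a := by linarith
    have hκ : 0 < (M + a) ^ (-((d : ℝ) / 2)) := Real.rpow_pos_of_pos hMa _
    set κ := (M + a) ^ (-((d : ℝ) / 2))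
    have hi : ∀ i, κ * (2 - d / 4 * ((8 * toR x i ^ 2 + 2) / (M + a))) ≤
        flattened Ψ ((d : ℝ) / 2) a M (S + (2 * toR x i + 1)) +
        flattened Ψ ((d : ℝ) / 2) a M (S + (-(2 * toR x i) + 1)) -
        2 * flattened Ψ ((d : ℝ) / 2) a M S := by
      intro i
      have h1 := linear_le_flattened hΨ hp ha0 hM hSM (u := 2 * toR x i + 1)
      have h2 := linear_le_flattened hΨ hp ha0 hM hSM (u := -(2 * toR x i) + 1)
      refine (le_of_eq ?_).trans ((add_le_add h1 h2).trans (le_of_eq ?_)) <;> ring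
    refine le_trans ?_ (Finset.sum_le_sum fun i _ => hi i)
    rw [← Finset.mul_sum]
    refine mul_nonneg hκ.le ?_
    have e : ∑ i, (2 - d / 4 * ((8 * toR x i ^ 2 + 2) / (M + a))) =
        2 * d - d / 4 * ((8 * S + 2 * d) / (M + a)) := by
      rw [← hsum]
      simp only [Finset.sum_sub_distrib, ← Finset.mul_sum, ← Finset.sum_div,
        Finset.sum_add_distrib, Finset.sum_const, Finset.card_univ, Fintype.card_fin, nsmul_eq_mul]
      ring
    rw [e]
    have h1 : (8 * S + 2 * d) / (M + a) ≤ 8 := by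
      rw [div_le_iff₀ hMa]
      linarith
    nlinarith

end Sandpile

namespace Sandpile

open Finset

variable {d : ℕ}

/-! ### Averaging the odometer over a ball -/

theorem adj_add_left {x y z : Site d} : Adj (x + y) (x + z) ↔ Adj y z := by
  simp [Adj]

theorem degreeIn_image_add (B : Finset (Site d)) (x b : Site d) :
    degreeIn (B.image (x + ·)) (x + b) = degreeIn B b := by
  unfold degreeIn
  rw [Finset.sum_image fun _ _ _ _ h => add_left_cancel h]
  simp only [adj_add_left]

/-- The average over `x + B` of the odometer. -/
noncomputable def avgOdometer (B : Finset (Site d)) (l : List (Site d)) (x : Site d) : ℝ :=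
  (#B : ℝ)⁻¹ * ∑ b ∈ B, odometer l (x + b)

/-- If all of `x + B` has toppled, the edge count gives at least `K - H` grains per site on average;
averaging also spreads the point mass `-n` uniformly over `-B`. -/
theorem le_lap_avgOdometer {n : ℕ} {H : ℤ} {l : List (Site d)} {B : Finset (Site d)} {K : ℝ}
    (hB : B.Nonempty) (hK : (K - H) * #B ≤ (∑ b ∈ B, degreeIn B b) / 2)
    (hl : Legal (initial d n H) l) {x : Site d} (hx : ∀ b ∈ B, x + b ∈ l) :
    K - (if -x ∈ B then (n : ℝ) else 0) / #B ≤ lap (avgOdometer B l) x := by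
  have hB0 : (0 : ℝ) < #B := by exact_mod_cast hB.card_pos
  have hinj : Set.InjOn (x + ·) (B : Set (Site d)) := fun _ _ _ _ h => add_left_cancel h
  have h1 := sum_lap_odometer_ge hl (A := B.image (x + ·)) fun a ha => by
    obtain ⟨b, hb, rfl⟩ := Finset.mem_image.1 ha
    exact hx b hb
  rw [Finset.sum_image hinj, Finset.sum_image hinj, Finset.card_image_of_injOn hinj] at h1
  simp only [degreeIn_image_add] at h1
  have h2 : (0 : Site d) ∈ B.image (x + ·) ↔ -x ∈ B := by
    constructor
    · intro h
      obtain ⟨b, hb, hxb⟩ := Finset.mem_image.1 h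
      rwa [neg_eq_of_add_eq_zero_right hxb]
    · exact fun h => Finset.mem_image.2 ⟨-x, h, add_neg_cancel x⟩
  simp only [h2] at h1
  have h3 : lap (avgOdometer B l) x = (#B : ℝ)⁻¹ * ∑ b ∈ B, lap (odometer l) (x + b) := by
    unfold avgOdometer
    rw [lap_const_mul, lap_sum]
    simp only [lap_comp_add]
  rw [h3, ← div_eq_inv_mul, le_div_iff₀ hB0, sub_mul, div_mul_cancel₀ _ hB0.ne']
  linarith

theorem avgOdometer_le {l : List (Site d)} {B : Finset (Site d)} {C : ℝ} {x : Site d}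
    (hB : B.Nonempty) (h : ∀ b ∈ B, odometer l (x + b) ≤ C) : avgOdometer B l x ≤ C := by
  have hB0 : (0 : ℝ) < #B := by exact_mod_cast hB.card_pos
  rw [avgOdometer, ← div_eq_inv_mul, div_le_iff₀ hB0]
  refine (Finset.sum_le_sum h).trans ?_
  simp [mul_comm]

theorem odometer_le_card_mul {l : List (Site d)} {B : Finset (Site d)} (hB : (0 : Site d) ∈ B)
    (x : Site d) : odometer l x ≤ #B * avgOdometer B l x := by
  have hB0 : (0 : ℝ) < #B := by exact_mod_cast Finset.card_pos.2 ⟨0, hB⟩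
  rw [avgOdometer, mul_inv_cancel_left₀ hB0.ne']
  have := Finset.single_le_sum (f := fun b => odometer l (x + b))
    (fun b _ => odometer_nonneg l (x + b)) hB
  simpa using this

/-- Sites of the ball of radius `r - 1` have all `2d` neighbours in the ball of radius `r`. For
large balls the edge density is therefore close to `d` per site. -/
theorem card_mul_le_sum_degreeIn (r : ℝ) :
    d * (#(closedBallFinset d (r - 1)) : ℝ) ≤
      (∑ b ∈ closedBallFinset d r, degreeIn (closedBallFinset d r) b) / 2 := by
  have hsub : closedBallFinset d (r - 1) ⊆ closedBallFinset d r := by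
    intro x hx
    rw [mem_closedBallFinset] at hx ⊢
    linarith
  have h := Finset.sum_le_sum_of_subset_of_nonneg hsub
    fun b _ _ => degreeIn_nonneg (closedBallFinset d r) b
  have h2 : ∑ b ∈ closedBallFinset d (r - 1), degreeIn (closedBallFinset d r) b =
      #(closedBallFinset d (r - 1)) * (2 * (d : ℝ)) := by
    rw [Finset.sum_congr rfl (g := fun _ => 2 * (d : ℝ)), Finset.sum_const, nsmul_eq_mul]
    intro b hb
    refine degreeIn_eq_of_nbrs fun y hy => ?_
    rw [mem_closedBallFinset] at hb ⊢
    have := enorm2_toR_le_of_adj 0 hy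
    simp only [sub_zero] at this
    linarith
  rw [h2] at h
  linarith

theorem rpow_sq_neg_half {R : ℝ} (hR : 0 ≤ R) (d : ℕ) :
    (R ^ 2) ^ (-((d : ℝ) / 2)) = (R ^ d)⁻¹ := by
  rw [Real.rpow_neg (sq_nonneg R), ← Real.rpow_natCast R 2, ← Real.rpow_mul hR,
    ← Real.rpow_natCast R d]
  congr 2
  push_cast
  ring

theorem exists_mul_pow_le (d : ℕ) {q : ℝ} (hq : q < 1) (c e B : ℝ) :
    ∃ L : ℝ, B ≤ L ∧ q * (L + e) ^ d ≤ (L - c) ^ d := by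
  have h1 : Filter.Tendsto (fun L : ℝ => (1 - (c + e) / (L + e)) ^ d) Filter.atTop
      (nhds ((1 - 0) ^ d)) :=
    (tendsto_const_nhds.sub (tendsto_const_nhds.div_atTop
      (Filter.tendsto_atTop_add_const_right _ e Filter.tendsto_id))).pow d
  rw [sub_zero, one_pow] at h1
  obtain ⟨L, hL, hLB, hL1⟩ := ((h1.eventually (lt_mem_nhds hq)).and
    ((Filter.eventually_ge_atTop B).and (Filter.eventually_ge_atTop (1 - e)))).exists
  refine ⟨L, hLB, ?_⟩
  have h2 : 0 < L + e := by linarith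
  have h3 : (L - c) ^ d = (1 - (c + e) / (L + e)) ^ d * (L + e) ^ d := by
    rw [← mul_pow]
    congr 1
    field_simp
    ring
  rw [h3]
  exact mul_le_mul_of_nonneg_right hL.le (by positivity)

/-- Large balls have small boundary, and about as many points as their volume says. -/
theorem exists_radius_card (hd : 0 < d) {q a : ℝ} (hq : q < 1) (ha : 0 ≤ a) :
    ∃ L : ℝ, 1 ≤ L ∧
      q * #(closedBallFinset d L) ≤ #(closedBallFinset d (L - 1)) ∧
      q * unitBallVolume d ≤ ((L + 2) ^ 2 + a) ^ (-((d : ℝ) / 2)) * #(closedBallFinset d L) := by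
  have hd' : (1 : ℝ) ≤ d := by exact_mod_cast hd
  have hω := unitBallVolume_pos d
  obtain ⟨L, hL, h⟩ := exists_mul_pow_le d (q := max q 0) (max_lt hq one_pos) (d + 1)
    (2 + a + 2 * d) (d + 2)
  have hq0 : 0 ≤ max q 0 := le_max_right _ _
  have hqq : q ≤ max q 0 := le_max_left _ _
  have hc1 := card_closedBallFinset_le hd (r := L) (by linarith)
  have hc2 := le_card_closedBallFinset hd (r := L - 1) (by linarith)
  have hc3 := le_card_closedBallFinset hd (r := L) (by linarith)
  refine ⟨L, by linarith, ?_, ?_⟩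
  · calc q * (#(closedBallFinset d L) : ℝ)
        ≤ max q 0 * (unitBallVolume d * (L + 2 * d) ^ d) :=
          mul_le_mul hqq hc1 (Nat.cast_nonneg _) hq0
      _ ≤ max q 0 * (unitBallVolume d * (L + (2 + a + 2 * d)) ^ d) := by
          have : 0 ≤ L + 2 * d := by linarith
          have : L + 2 * d ≤ L + (2 + a + 2 * d) := by linarith
          gcongr
      _ = unitBallVolume d * (max q 0 * (L + (2 + a + 2 * d)) ^ d) := by ring
      _ ≤ unitBallVolume d * (L - (d + 1)) ^ d := by gcongr
      _ = unitBallVolume d * (L - 1 - d) ^ d := by ring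
      _ ≤ _ := hc2
  · have h1 : ((L + 2 + a) ^ d)⁻¹ ≤ ((L + 2) ^ 2 + a) ^ (-((d : ℝ) / 2)) := by
      rw [← rpow_sq_neg_half (by linarith) d]
      refine Real.rpow_le_rpow_of_nonpos (by nlinarith) ?_ ?_
      · nlinarith
      · linarith
    have h2 : 0 < L + 2 + a := by linarith
    have h3 : q * unitBallVolume d * (L + 2 + a) ^ d ≤ #(closedBallFinset d L) := by
      calc q * unitBallVolume d * (L + 2 + a) ^ d
          ≤ max q 0 * unitBallVolume d * (L + (2 + a + 2 * d)) ^ d := by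
            have : (L + 2 + a) ^ d ≤ (L + (2 + a + 2 * d)) ^ d :=
              pow_le_pow_left₀ h2.le (by linarith) d
            have h4 := mul_le_mul_of_nonneg_right hqq hω.le
            exact mul_le_mul h4 this (by positivity) (by positivity)
        _ = unitBallVolume d * (max q 0 * (L + (2 + a + 2 * d)) ^ d) := by ring
        _ ≤ unitBallVolume d * (L - (d + 1)) ^ d := by gcongr
        _ ≤ unitBallVolume d * (L - d) ^ d := by
            gcongr ?_ * ?_ ^ d
            · linarith
            · linarith
        _ ≤ _ := hc3
    calc q * unitBallVolume d ≤ ((L + 2 + a) ^ d)⁻¹ * #(closedBallFinset d L) := by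
          rw [← div_eq_inv_mul, le_div_iff₀ (by positivity)]
          exact h3
      _ ≤ _ := by gcongr

/-! ### The outer barrier -/

/-- A nonnegative radial function that is small just outside the ball of radius `R`, and whose
Laplacian is the constant `2d` but for a negative mass near the origin. -/
noncomputable def outerBarrier (Ψ : ℝ → ℝ) (d : ℕ) (a M R : ℝ) (x : Site d) : ℝ :=
  (nsq (toR x) - (R ^ 2 - a)) - R ^ d * (flattened Ψ ((d : ℝ) / 2) a M (nsq (toR x)) -
    flattened Ψ ((d : ℝ) / 2) a M (R ^ 2 - a))

section Barrier

variable {Ψ : ℝ → ℝ} {a M R : ℝ}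

/-- The barrier is `R^d` times the gap between the concave function and its tangent at `R² - a`,
where the slope is `R^(-d)`. -/
theorem outerBarrier_nonneg
    (hΨ : ∀ W : ℝ, 0 < W → HasDerivAt Ψ (W ^ (-((d : ℝ) / 2))) W) (ha : 0 < a) (hM : 0 ≤ M)
    (hR : 0 < R) (hMR : M + a ≤ R ^ 2) (x : Site d) : 0 ≤ outerBarrier Ψ d a M R x := by
  have h := flattened_le_tangent hΨ (by positivity) ha hM hMR (nsq (toR x))
  rw [rpow_sq_neg_half hR.le] at h
  have hRd : 0 < R ^ d := by positivity
  have h2 := mul_le_mul_of_nonneg_left h hRd.le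
  rw [mul_add, mul_left_comm, mul_inv_cancel₀ hRd.ne', mul_one] at h2
  unfold outerBarrier
  linarith

/-- The gap below the tangent is quadratic, at most `(d/4) T²/R²` with `T = |x|² - (R² - a)`, and `T
= O(R)` in the shell. Hence the bound does not depend on `R`. -/
theorem outerBarrier_le
    (hΨ : ∀ W : ℝ, 0 < W → HasDerivAt Ψ (W ^ (-((d : ℝ) / 2))) W) (ha : 0 < a) (hM : 0 ≤ M)
    (hR : 1 ≤ R) (hMR : M + a ≤ R ^ 2) {x : Site d} (h1 : R ≤ enorm2 (toR x))
    (h2 : enorm2 (toR x) ≤ R + 2) : outerBarrier Ψ d a M R x ≤ d / 4 * (8 + a) ^ 2 := by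
  have hS1 : R ^ 2 ≤ nsq (toR x) := by
    rw [← enorm2_sq]
    exact pow_le_pow_left₀ (by linarith) h1 2
  have hS2 : nsq (toR x) ≤ (R + 2) ^ 2 := by
    rw [← enorm2_sq]
    exact pow_le_pow_left₀ (enorm2_nonneg _) h2 2
  have h := quadratic_le_flattened hΨ (by positivity) ha hM hMR (S := nsq (toR x)) (by linarith)
  rw [rpow_sq_neg_half (by linarith)] at h
  have hRd : 0 < R ^ d := by positivity
  have h3 := mul_le_mul_of_nonneg_left h hRd.le
  set T := nsq (toR x) - (R ^ 2 - a) with hT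
  have hT0 : 0 ≤ T := by linarith
  have hT1 : T ≤ (8 + a) * R := by nlinarith
  have e : R ^ d * (flattened Ψ ((d : ℝ) / 2) a M (R ^ 2 - a) + T * (R ^ d)⁻¹ -
      (d : ℝ) / 2 / 2 * ((R ^ d)⁻¹ / R ^ 2) * T ^ 2) =
      R ^ d * flattened Ψ ((d : ℝ) / 2) a M (R ^ 2 - a) + T - d / 4 * (T ^ 2 / R ^ 2) := by
    field_simp
    ring
  rw [e] at h3
  have h4 : T ^ 2 / R ^ 2 ≤ (8 + a) ^ 2 := by
    rw [div_le_iff₀ (by positivity), ← mul_pow]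
    exact pow_le_pow_left₀ hT0 hT1 2
  have h5 := mul_le_mul_of_nonneg_left h4 (by positivity : (0 : ℝ) ≤ d / 4)
  unfold outerBarrier
  linarith

theorem lap_outerBarrier (x : Site d) : lap (outerBarrier Ψ d a M R) x =
    2 * d - R ^ d * lap (fun y => flattened Ψ ((d : ℝ) / 2) a M (nsq (toR y))) x := by
  have h1 : lap (fun y : Site d => nsq (toR y)) x = 2 * d := by
    refine (lap_radial id x).trans ?_
    rw [Finset.sum_congr rfl (g := fun _ => (2 : ℝ)) fun i _ => by simp only [id]; ring]
    simp
    ring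
  unfold outerBarrier
  rw [lap_sub, lap_const_mul, lap_sub (fun y => nsq (toR y)), h1,
    lap_sub (fun y => flattened Ψ ((d : ℝ) / 2) a M (nsq (toR y))), lap_const, lap_const,
    sub_zero, sub_zero]

end Barrier

end Sandpile

/-! ### Conclusion of the outer bound. -/

namespace Sandpile

open Finset

variable {d : ℕ}

/-- Outside of a suitable ball the odometer is bounded, uniformly in the number of grains. -/
theorem exists_odometer_le (hd : 2 ≤ d) {H : ℤ} {K : ℝ} (hK0 : 0 < K)
    (hK : K < d + H) :
    ∃ R₀ M : ℝ, 0 ≤ R₀ ∧ ∀ (n : ℕ) (R : ℝ) (l : List (Site d)), R₀ ≤ R →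
      (n : ℝ) = K * (unitBallVolume d * R ^ d) → Legal (initial d n H) l →
      Stable (run (initial d n H) l) → ∀ x, R ≤ enorm2 (toR x) → odometer l x ≤ M := by
  classical
  have hd' : (2 : ℝ) ≤ d := by exact_mod_cast hd
  have : NeZero d := ⟨by omega⟩
  have hω := unitBallVolume_pos d
  obtain ⟨K', hKK', hK'⟩ := exists_between hK
  have hK'0 : 0 < K' := hK0.trans hKK'
  obtain ⟨Ψ, hΨ⟩ := exists_primitive_rpow_neg ((d : ℝ) / 2)
  obtain ⟨a, ha, hsub⟩ := exists_lap_flattened_nonneg hΨ (by omega : 0 < d)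
  -- The first entry of the maximum makes the edge density of `B` yield `K'`; the second makes the
  -- mass of the flattened potential outweigh `n / #B`, using up the gap between `K` and `K'`.
  obtain ⟨L, hL, hL1, hL2⟩ := exists_radius_card (by omega : 0 < d)
    (q := max ((K' - H) / d) (K / K')) (a := a)
    (max_lt (by rw [div_lt_one (by linarith)]; linarith) (by rwa [div_lt_one hK'0]))
    (by linarith)
  set B := closedBallFinset d L with hB
  have h0B : (0 : Site d) ∈ B := by
    rw [hB, mem_closedBallFinset]
    have : enorm2 (toR (0 : Site d)) = 0 := by simp [enorm2, nsq, toR]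
    linarith
  have hBne : B.Nonempty := ⟨0, h0B⟩
  have hB0 : (0 : ℝ) < #B := by exact_mod_cast hBne.card_pos
  set k := ((L + 2) ^ 2 + a) ^ (-((d : ℝ) / 2)) with hk
  have hdeg : (K' - H) * #B ≤ (∑ b ∈ B, degreeIn B b) / 2 := by
    refine le_trans ?_ (card_mul_le_sum_degreeIn L)
    have h1 := (mul_le_mul_of_nonneg_right (le_max_left ((K' - H) / d) (K / K')) hB0.le).trans hL1
    rwa [div_mul_eq_mul_div, div_le_iff₀ (by linarith), mul_comm (#(closedBallFinset d (L - 1)) : ℝ)]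
      at h1
  have hmass : K * unitBallVolume d ≤ K' * (k * #B) := by
    have h1 := (mul_le_mul_of_nonneg_right (le_max_right ((K' - H) / d) (K / K')) hω.le).trans hL2
    rwa [div_mul_eq_mul_div, div_le_iff₀ hK'0, mul_comm _ K'] at h1
  set j : ℕ := ⌈2 * (d * L)⌉₊ with hj
  set C₀ : ℝ := (2 * d - 1 + H) * ((2 * d + 1) ^ j - 1) with hC₀
  have hH0 : 0 ≤ 2 * (d : ℝ) - 1 + H := by linarith
  -- Normalized so that the constant part of the Laplacian of `c` times the barrier is `K'`.
  set c : ℝ := K' / (2 * d) with hc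
  have hc0 : 0 < c := by positivity
  have hc2 : c * (2 * d) = K' := div_mul_cancel₀ _ (by positivity)
  set C₁ : ℝ := c * (d / 4 * (8 + a) ^ 2) with hC₁
  have hC₁0 : 0 ≤ C₁ := by positivity
  refine ⟨L + 3 + a, #B * (C₀ + C₁), by linarith, fun n R l hR hn hl hst x₀ hx₀ => ?_⟩
  have hMR : (L + 2) ^ 2 + a ≤ R ^ 2 := by nlinarith
  have hR1 : 1 ≤ R := by linarith
  -- On `D` the averaged odometer has a large Laplacian; off `D` some site of `x + B` does not
  -- topple, so the odometer is bounded on all of `x + B`.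
  set D := l.toFinset.filter fun x => ∀ b ∈ B, x + b ∈ l with hD
  have hlap : ∀ x ∈ D, K' - (if -x ∈ B then (n : ℝ) else 0) / #B ≤ lap (avgOdometer B l) x :=
    fun x hx => le_lap_avgOdometer hBne hdeg hl (Finset.mem_filter.1 hx).2
  have hneg : ∀ x, -x ∈ B → enorm2 (toR x) ≤ L := by
    intro x hx
    rw [hB, mem_closedBallFinset] at hx
    rwa [show toR (-x) = -toR x by ext i; simp [toR], enorm2_neg] at hx
  have hout : ∀ x, x ∉ D → avgOdometer B l x ≤ C₀ := by
    intro x hx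
    obtain ⟨b, hb, hbl⟩ : ∃ b ∈ B, x + b ∉ l := by
      by_contra! hc
      refine hx (Finset.mem_filter.2 ⟨List.mem_toFinset.2 ?_, hc⟩)
      simpa using hc 0 h0B
    refine avgOdometer_le hBne fun b' hb' => ?_
    refine odometer_le_of_notMem (by omega) hH0 hbl (j := j) (fun w _ => hst w) _ ?_
    rw [add_sub_add_left_eq_sub]
    have h1 := l1_add_le b' (-b)
    rw [l1_neg, ← sub_eq_add_neg] at h1
    have h2 : ∀ v ∈ B, (l1 v : ℝ) ≤ d * L := fun v hv =>
      (l1_le_mul_enorm2 v).trans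
        (mul_le_mul_of_nonneg_left (mem_closedBallFinset.1 hv) (by linarith))
    have h3 : ((l1 b' + l1 b : ℕ) : ℝ) ≤ 2 * (d * L) := by
      push_cast
      linarith [h2 b hb, h2 b' hb']
    have h4 : l1 b' + l1 b ≤ j := by
      exact_mod_cast h3.trans (Nat.le_ceil _)
    omega
  -- Maximum principle on `D`. Flattening up to radius `L + 2` covers the support `-B` of the
  -- averaged source together with its neighbours, where the mass of the barrier must beat `n / #B`.
  have hinner : ∀ x, avgOdometer B l x ≤ C₀ + c * outerBarrier Ψ d a ((L + 2) ^ 2) R x := by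
    have hnn := outerBarrier_nonneg (d := d) hΨ (by linarith : 0 < a) (sq_nonneg (L + 2))
      (by linarith : 0 < R) hMR
    intro x
    have := le_of_lap_nonneg (D := D) (C := C₀)
      (g := fun x => avgOdometer B l x - c * outerBarrier Ψ d a ((L + 2) ^ 2) R x) ?_ ?_ x
    · linarith
    · intro y hy
      rw [lap_sub, lap_const_mul, lap_outerBarrier, mul_sub, hc2]
      have h1 := hlap y hy
      split_ifs at h1 with hyB
      · have hyL := hneg y hyB
        have hlt : ∀ z : Site d, enorm2 (toR z) ≤ L + 1 → nsq (toR z) < (L + 2) ^ 2 := by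
          intro z hz
          rw [← enorm2_sq]
          exact pow_lt_pow_left₀ (by linarith) (enorm2_nonneg _) two_ne_zero
        rw [lap_flattened_eq Ψ (fun z hz => hlt z ?_) (hlt y (by linarith))]
        · have h2 : (n : ℝ) / #B ≤ c * (R ^ d * (2 * d * k)) := by
            rw [div_le_iff₀ hB0, hn]
            have := mul_le_mul_of_nonneg_left hmass (by positivity : 0 ≤ R ^ d)
            calc K * (unitBallVolume d * R ^ d) = R ^ d * (K * unitBallVolume d) := by ring
              _ ≤ R ^ d * (K' * (k * #B)) := this
              _ = c * (R ^ d * (2 * d * k)) * #B := by rw [← hc2]; ring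
          linarith
        · have := enorm2_toR_le_of_adj 0 hz
          simp only [sub_zero] at this
          linarith
      · have h2 : 0 ≤ c * (R ^ d * lap (fun y =>
            flattened Ψ ((d : ℝ) / 2) a ((L + 2) ^ 2) (nsq (toR y))) y) :=
          mul_nonneg hc0.le (mul_nonneg (by positivity) (hsub _ y (sq_nonneg _)))
        rw [zero_div] at h1
        linarith
    · intro y hy
      have h1 := hout y hy
      have h2 := mul_nonneg hc0.le (hnn y)
      linarith
  have hshell : ∀ x, R ≤ enorm2 (toR x) → enorm2 (toR x) ≤ R + 2 →
      avgOdometer B l x ≤ C₀ + C₁ := by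
    intro x h1 h2
    refine (hinner x).trans (add_le_add_right (mul_le_mul_of_nonneg_left ?_ hc0.le) _)
    exact outerBarrier_le hΨ (by linarith) (sq_nonneg _) hR1 hMR h1 h2
  -- Beyond radius `R + 1` there is no source, so the average is subharmonic on `D` there. Replacing
  -- it by a constant inside radius `R` does not affect neighbours of the sites considered.
  have hfar := le_of_lap_nonneg (D := D.filter fun x => R + 1 < enorm2 (toR x)) (C := C₀ + C₁)
    (g := fun x => if R ≤ enorm2 (toR x) then avgOdometer B l x else C₀ + C₁) ?_ ?_ x₀
  · rw [if_pos hx₀] at hfar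
    exact (odometer_le_card_mul h0B x₀).trans (mul_le_mul_of_nonneg_left hfar hB0.le)
  · intro x hx
    obtain ⟨hxD, hxR⟩ := Finset.mem_filter.1 hx
    have h1 := hlap x hxD
    rw [if_neg (fun h => by linarith [hneg x h]), zero_div, sub_zero] at h1
    refine (hK'0.le.trans h1).trans (lap_mono (fun y hy => ?_) ?_)
    · have := enorm2_toR_le_of_adj 0 hy.symm
      simp only [sub_zero] at this
      rw [if_pos (by linarith)]
    · rw [if_pos (by linarith)]
  · intro x hx
    split_ifs with h
    · rcases le_or_gt (enorm2 (toR x)) (R + 1) with h2 | h2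
      · exact hshell x h (by linarith)
      · have := hout x fun hxD => hx (Finset.mem_filter.2 ⟨hxD, h2⟩)
        linarith
    · exact le_rfl

/-- All visited sites lie in a ball that is only slightly too large. -/
theorem exists_visited_subset_latticeBall (hd : 2 ≤ d) {H : ℤ} (hH : 1 - (d : ℤ) ≤ H) {K : ℝ}
    (hK0 : 0 < K) (hK : K < d + H) :
    ∃ c : ℝ, ∀ (n : ℕ) (R : ℝ), 0 ≤ R → (n : ℝ) = K * (unitBallVolume d * R ^ d) →
      visited d n H ⊆ latticeBall d (R + c) := by
  have hω := unitBallVolume_pos d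
  obtain ⟨R₀, M, hR₀, hM⟩ := exists_odometer_le (H := H) hd hK0 hK
  obtain ⟨s, hs⟩ := exists_radius_notMem (d := d) (by omega) M
  have hbig : ∀ (n : ℕ) (R : ℝ), R₀ ≤ R → (n : ℝ) = K * (unitBallVolume d * R ^ d) →
      visited d n H ⊆ latticeBall d (R + (s + 2)) := by
    intro n R hR hn
    have hs0 := Nat.cast_nonneg (α := ℝ) s
    obtain ⟨l, hl, hst⟩ := exists_stable (n := n) (by omega) hH
    have hmem : ∀ y ∈ l, enorm2 (toR y) < R + s + 1 := by
      intro y hy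
      by_contra! hyR
      refine hs n H l y hH hl (fun x hx => ?_) hy
      have h1 : enorm2 (toR x - toR y) ≤ s := by
        rw [← toR_sub]
        exact (enorm2_le_l1 _).trans (by exact_mod_cast hx)
      have h2 := enorm2_sub_le (toR x) (toR x - toR y)
      rw [sub_sub_cancel] at h2
      refine ⟨?_, hM n R l hR hn hl hst x (by linarith)⟩
      rintro rfl
      have : enorm2 (toR (0 : Site d)) = 0 := by simp [enorm2, nsq, toR]
      linarith
    rw [visited_eq_visitedBy l hl hst]
    rintro x (⟨rfl, -⟩ | ⟨y, hy, hyx⟩)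
    · rw [mem_latticeBall]
      have : enorm2 (toR (0 : Site d)) = 0 := by simp [enorm2, nsq, toR]
      linarith
    · rw [mem_latticeBall]
      have h1 := hmem y hy
      have h2 := enorm2_toR_le_of_adj 0 hyx
      simp only [sub_zero] at h2
      linarith
  -- Radii below `R₀` correspond to at most `m` grains, so monotonicity in `n` reduces them to the
  -- single pair `m`, `R₁`.
  set m : ℕ := ⌈K * (unitBallVolume d * R₀ ^ d)⌉₊ with hm
  obtain ⟨R₁, hR₁, hmR₁⟩ : ∃ R₁, 0 ≤ R₁ ∧ (m : ℝ) = K * (unitBallVolume d * R₁ ^ d) := by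
    have h0 : 0 ≤ (m : ℝ) / (K * unitBallVolume d) := by positivity
    refine ⟨((m : ℝ) / (K * unitBallVolume d)) ^ ((d : ℝ)⁻¹), by positivity, ?_⟩
    rw [Real.rpow_inv_natCast_pow h0 (by omega)]
    field_simp
  have hR₀₁ : R₀ ≤ R₁ := by
    have h1 : K * (unitBallVolume d * R₀ ^ d) ≤ K * (unitBallVolume d * R₁ ^ d) := by
      rw [← hmR₁]
      exact Nat.le_ceil _
    exact le_of_pow_le_pow_left₀ (by omega) hR₁
      (le_of_mul_le_mul_left (le_of_mul_le_mul_left h1 hK0) hω)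
  refine ⟨R₁ + (s + 2), fun n R hR hn x hx => ?_⟩
  rw [mem_latticeBall]
  rcases le_or_gt R₀ R with h | h
  · have := mem_latticeBall.1 (hbig n R h hn hx)
    linarith
  · have hnm : n ≤ m := by
      have : (n : ℝ) ≤ m := by
        rw [hn]
        refine le_trans ?_ (Nat.le_ceil _)
        gcongr
      exact_mod_cast this
    have := mem_latticeBall.1 (hbig m R₁ hR₀₁ hmR₁ (visited_mono hnm hx))
    linarith

end Sandpile

theorem theorem1p5 (d : ℕ) (hd : 2 ≤ d) :
    (∃ c₂ : ℝ, ∀ H : ℤ, 2 - 2 * (d : ℤ) ≤ H →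
      ∀ (n : ℕ) (r : ℝ), 0 ≤ r → (n : ℝ) = Sandpile.unitBallVolume d * r ^ d →
        Sandpile.latticeBall d ((2 * (d : ℝ) - 1 + (H : ℝ)) ^ (-(1 / (d : ℝ))) * r - c₂) ⊆
          Sandpile.visited d n H) ∧
    (∀ H : ℤ, 1 - (d : ℤ) ≤ H → ∀ ε : ℝ, 0 < ε → ε < (d : ℝ) + (H : ℝ) →
      ∃ c₂' : ℝ, ∀ (n : ℕ) (r : ℝ), 0 ≤ r → (n : ℝ) = Sandpile.unitBallVolume d * r ^ d →
        Sandpile.visited d n H ⊆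
          Sandpile.latticeBall d (((d : ℝ) - ε + (H : ℝ)) ^ (-(1 / (d : ℝ))) * r + c₂')) := by
  -- With `R = K^(-1/d) r`, the ball of radius `R` has volume `n / K`: the `n` grains fill it at
  -- density `K`.
  have hscale : ∀ {K r : ℝ} {n : ℕ}, 0 < K → (n : ℝ) = Sandpile.unitBallVolume d * r ^ d →
      (n : ℝ) = K * (Sandpile.unitBallVolume d * (K ^ (-(1 / (d : ℝ))) * r) ^ d) := by
    intro K r n hK hn
    rw [mul_left_comm, Sandpile.rpow_neg_inv_mul_pow (by omega) hK, hn]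
  constructor
  · obtain ⟨c, hc⟩ := Sandpile.exists_latticeBall_subset_visited hd
    refine ⟨c, fun H hH n r hr hn => ?_⟩
    have hK : 0 < 2 * (d : ℝ) - 1 + H := by
      have : (0 : ℤ) < 2 * d - 1 + H := by omega
      exact_mod_cast this
    exact hc H n _ hH (by positivity) (hscale hK hn)
  · intro H hH ε hε hεH
    have hK : 0 < (d : ℝ) - ε + H := by linarith
    obtain ⟨c, hc⟩ := Sandpile.exists_visited_subset_latticeBall hd hH hK (by linarith)
    exact ⟨c, fun n r hr hn => hc n _ (by positivity) (hscale hK hn)⟩
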